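/- **Notation.** All gradings are by $\mathbb Z\times\mathbb Z$; write $\deg=(\deg_h,\deg_t)$ for the cohomological degree and the $t$-degree. The ground field is $\mathbb F=\mathbb F_2$ (so there are no signs). A $t$-graded DG algebra or (bi)module is a $\mathbb Z\times\mathbb Z$-graded one over $\mathbb F$ with a differential of degree $(1,0)$ satisfying $d^2=0$ and the Leibniz rule. $M[a]\{b\}$ is $M$ with the component of degree $(i,j)$ equal to $M^{(i+a,j+b)}$. *The ring.* $U_T$ is the associative unital $\mathbb Z$-algebra with unit $I$, generators $E,F,T,T^{-1}$ and relations $E^2=F^2=0$, $EF+FE=I-T$, $ET=TE$, $FT=TF$, $TT^{-1}=T^{-1}T=I$. *The algebra.* Let $\mathcal B=\{F,I,EF,E\}$ with parity $p(F)=1$, $p(I)=p(EF)=0$, $p(E)=-1$. $A$ is the unital $\mathbb F$-algebra generated by orthogonal idempotents $e(\gamma)$, $\gamma\in\mathcal B$, with $\sum_\gamma e(\gamma)=1$, and $\rho=\rho(I,EF)$, $\rho'=\rho(EF,I)$ with $e(I)\rho=\rho e(EF)=\rho$, $e(EF)\rho'=\rho' e(I)=\rho'$ and $\rho\rho'=0$;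 it has $d=0$, $\deg\rho'=(1,1)$, and the other generators have degree $(0,0)$. Put $P(\gamma)=A\,e(\gamma)$. *The category.* $DGP(A)$ is the smallest class of $t$-graded DG left $A$-modules that contains $0$ and the $P(\gamma)$ and is closed under the shifts $[\pm1]$, $\{\pm1\}$, mapping cones of closed maps of degree $(0,0)$, and isomorphisms of DG modules. $HP(A)$ has these objects; its morphisms are the closed $A$-linear maps of degree $(0,0)$ modulo chain homotopy. $K_0$ of a triangulated category is the abelian group generated by the classes $[X]$ of objects, with $[Y]=[X]+[Z]$ for each distinguished triangle $X\to Y\to Z\to X[1]$. *Tensor products.* An element $m$ of a DG $A$-module has parity $i$ if $m=\sum_{p(\gamma)=i}e(\gamma)m$. For DG $A$-modules $X,Y$ the space $X\otimes_{\mathbb F}Y$ is a DG module over the algebra $A\otimes_{\mathbb F} A$ (zero differential), with differential $d\otimes1+1\otimes d$ and the gradings $\deg_t(x\otimes y)=\deg_t x+\deg_t y$, $\deg_h(x\otimes y)=\deg_h x+\deg_h y+2\deg_t(x)\,p(y)$; the same formula grades $A\otimes A$. *The bimodule.* $N=\bigoplus_{\gamma_1,\gamma_2\in\mathcal B}N(\gamma_1,\gamma_2)$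 is the following DG $(A,A\otimes A)$-bimodule. As a left module, with generators named on the right: - $N(I,\gamma)=P(\gamma)\ni m_{I,\gamma}$ and $N(\gamma,I)=P(\gamma)\ni m_{\gamma,I}$ (the same generator if $\gamma=I$); $N(E,F)=P(EF)$; - $N(F,EF)=P(F)\oplus P(F)\{1\}[1]\ni m_{F,EF},\,m'_{F,EF}$; - $N(EF,E)=P(E)\oplus P(E)\{1\}[-1]\ni m_{EF,E},\,m'_{EF,E}$; - $N(EF,EF)=P(EF)\oplus P(EF)\{1\}[1]\ni m_{EF,EF},\,m'_{EF,EF}$; - $N(F,E)=P(I)\oplus P(EF)[-1]\oplus P(I)\{1\}[-1]\ni n_1,n_2,n_3$, with $dn_1=\rho n_2$, $dn_2=\rho' n_3$, $dn_3=0$; - $N(E,E)=N(E,EF)=N(F,F)=N(EF,F)=0$; all other differentials are $0$. The right action is left $A$-linear; $e(\gamma_1)\otimes e(\gamma_2)$ acts as the projection to $N(\gamma_1,\gamma_2)$. On generators, the other nonzero actions are as follows. - $\rho'\otimes1$: $m_{EF,I}\mapsto\rho' m_{I,I}$, $\;m'_{EF,EF}\mapsto m_{I,EF}$, $\;m'_{EF,E}\mapsto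 m_{I,E}$; - $\rho\otimes1$: $m_{I,I}\mapsto\rho\, m_{EF,I}$, $\;m_{I,EF}\mapsto m_{EF,EF}$, $\;m_{I,E}\mapsto m_{EF,E}$; - $1\otimes\rho'$: $m_{I,EF}\mapsto\rho' m_{I,I}$, $\;m'_{F,EF}\mapsto m_{F,I}$, $\;m_{EF,EF}\mapsto\rho'\rho\, m_{EF,I}$, $\;m'_{EF,EF}\mapsto m_{EF,I}$; - $1\otimes\rho$: $m_{I,I}\mapsto\rho\, m_{I,EF}$, $\;m_{F,I}\mapsto m_{F,EF}$, $\;m_{EF,I}\mapsto m_{EF,EF}+\rho'\rho\, m'_{EF,EF}$. **Theorem.** $HP(A)$ is a triangulated category, with shift $[1]$ and with distinguished triangles those isomorphic to the standard triangles $X\xrightarrow{u}Y\to\mathrm{Cone}(u)\to X[1]$. The assignment $(X,Y)\mapsto N\otimes_{A\otimes A}(X\otimes_{\mathbb F}Y)$ induces a bifunctor $\mathcal M:HP(A)\times HP(A)\to HP(A)$ that commutes with the shift and is exact in each variable. There is an isomorphism of abelian groups $\varphi:K_0(HP(A))\to U_T$ with $\varphi[P(\gamma)]=\gamma$ for $\gamma\in\mathcal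 B$ (where $I$ is the unit and $EF$ the product of $E$ and $F$) and $\varphi[X\{1\}]=T\,\varphi[X]$ for every object $X$. The bifunctor induces a biadditive map $K_0(\mathcal M)$ on $K_0(HP(A))$, with $K_0(\mathcal M)([X],[Y])=[\mathcal M(X,Y)]$, and $\varphi$ carries it to the multiplication of $U_T$: $\varphi(K_0(\mathcal M)(x,y))=\varphi(x)\varphi(y)$. -/

import Mathlib

open CategoryTheory CategoryTheory.Limits CategoryTheory.Pretriangulated
open scoped TensorProduct

noncomputable section

namespace UTCat

/-- The ground field with two elements. All signs of the general theory of DG modules are trivial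
over it, which is why no signs appear below. -/
abbrev F2 : Type := ZMod 2

/-! ### Gradings -/

section Gradings

set_option linter.unusedSectionVars false

variable {ι M : Type} [DecidableEq ι] [AddCommGroup M] [Module F2 M]

theorem isInternal_of_coact (gr : ι → Submodule F2 M) (D : M →ₗ[F2] (ι →₀ M))
    (h1 : ∀ i, ∀ x ∈ gr i, D x = Finsupp.single i x) (h2 : ⨆ i, gr i = ⊤) :
    DirectSum.IsInternal gr := by
  refine DirectSum.isInternal_submodule_of_iSupIndep_of_iSup_eq_top ?_ h2
  rw [iSupIndep_def]
  intro i
  rw [Submodule.disjoint_def]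
  intro x hx hx'
  have h3 : (⨆ j, ⨆ (_ : j ≠ i), gr j) ≤ LinearMap.ker ((Finsupp.lapply i).comp D) := by
    refine iSup_le fun j => iSup_le fun hj => ?_
    intro y hy
    simp [LinearMap.mem_ker, h1 j y hy, hj]
  have h4 := h3 hx'
  simpa [LinearMap.mem_ker, h1 i x hx] using h4

theorem exists_coact {gr : ι → Submodule F2 M} (h : DirectSum.IsInternal gr) :
    ∃ D : M →ₗ[F2] (ι →₀ M), ∀ i, ∀ x ∈ gr i, D x = Finsupp.single i x := by
  let e := LinearEquiv.ofBijective (DirectSum.coeLinearMap gr) h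
  refine ⟨(DirectSum.toModule F2 ι (ι →₀ M)
    (fun i => (Finsupp.lsingle i).comp (gr i).subtype)).comp e.symm.toLinearMap, ?_⟩
  intro i x hx
  have : e.symm x = DirectSum.lof F2 ι (fun i => gr i) i ⟨x, hx⟩ := by
    rw [LinearEquiv.symm_apply_eq]
    exact (DirectSum.coeLinearMap_lof gr i ⟨x, hx⟩).symm
  simp [this]

theorem coact_mem {gr : ι → Submodule F2 M} (h : ⨆ i, gr i = ⊤) {D : M →ₗ[F2] (ι →₀ M)}
    (hD : ∀ i, ∀ x ∈ gr i, D x = Finsupp.single i x) (x : M) (i : ι) : D x i ∈ gr i := by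
  have h3 : (⨆ j, gr j) ≤ (gr i).comap ((Finsupp.lapply i).comp D) := by
    refine iSup_le fun j y hy => ?_
    by_cases hj : j = i
    · subst hj; simpa [hD j y hy] using hy
    · simp [hD j y hy, hj]
  exact h3 (h ▸ Submodule.mem_top)

theorem coact_sum {gr : ι → Submodule F2 M} (h : ⨆ i, gr i = ⊤) {D : M →ₗ[F2] (ι →₀ M)}
    (hD : ∀ i, ∀ x ∈ gr i, D x = Finsupp.single i x) (x : M) :
    ((D x).sum fun _ y => y) = x := by
  have h3 : (⨆ j, gr j) ≤ LinearMap.eqLocus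
      ((Finsupp.lsum F2 (fun _ : ι => (LinearMap.id : M →ₗ[F2] M))).comp D) LinearMap.id := by
    refine iSup_le fun j y hy => ?_
    simp [hD j y hy]
  have := h3 (h ▸ Submodule.mem_top : x ∈ _)
  rw [LinearMap.mem_eqLocus] at this
  exact this

/-- A homogeneous subspace inherits an internal grading. -/
theorem isInternal_sub {gr : ι → Submodule F2 M} (h : DirectSum.IsInternal gr)
    {N : Type} [AddCommGroup N] [Module F2 N] (j : N →ₗ[F2] M) (hj : Function.Injective j)
    (hN : ∀ D : M →ₗ[F2] (ι →₀ M), (∀ i, ∀ x ∈ gr i, D x = Finsupp.single i x) →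
      ∀ x i, D (j x) i ∈ LinearMap.range j) :
    DirectSum.IsInternal (fun i => (gr i).comap j) := by
  obtain ⟨D, hD⟩ := exists_coact h
  have ht := h.submodule_iSup_eq_top
  refine DirectSum.isInternal_submodule_of_iSupIndep_of_iSup_eq_top ?_ ?_
  · have := h.submodule_iSupIndep
    rw [iSupIndep_def] at this ⊢
    intro i
    have h1 := this i
    rw [Submodule.disjoint_def] at h1 ⊢
    intro x hx hx'
    apply hj
    rw [map_zero]
    refine h1 _ hx ?_
    have h2 : (⨆ k, ⨆ (_ : k ≠ i), (gr k).comap j) ≤ (⨆ k, ⨆ (_ : k ≠ i), gr k).comap j := by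
      refine iSup_le fun k => iSup_le fun hk => Submodule.comap_mono ?_
      exact le_iSup_of_le k (le_iSup_of_le hk le_rfl)
    exact h2 hx'
  · rw [eq_top_iff]
    intro x _
    choose y hy using hN D hD x
    have hx : x = ∑ i ∈ (D (j x)).support, y i := by
      apply hj
      rw [map_sum]
      conv_lhs => rw [← coact_sum ht hD (j x)]
      exact Finset.sum_congr rfl fun i _ => (hy i).symm
    rw [hx]
    refine Submodule.sum_mem _ fun i _ => ?_
    refine Submodule.mem_iSup_of_mem i ?_
    change j (y i) ∈ gr i
    rw [hy]
    exact coact_mem ht hD _ _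

/-- The family of subspaces of `M ⊗ M'` spanned by tensors of homogeneous elements, the tensor of
elements of degrees `i` and `j` being given the degree `θ i j`. -/
def tensorGr {κ G M' : Type} [AddCommGroup M'] [Module F2 M'] (gr : ι → Submodule F2 M)
    (gr' : κ → Submodule F2 M') (θ : ι → κ → G) (g : G) : Submodule F2 (M ⊗[F2] M') :=
  Submodule.span F2 {z | ∃ i j, θ i j = g ∧ ∃ x ∈ gr i, ∃ y ∈ gr' j, x ⊗ₜ[F2] y = z}

theorem tensorGr_mem {κ G M' : Type} [AddCommGroup M'] [Module F2 M'] {gr : ι → Submodule F2 M}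
    {gr' : κ → Submodule F2 M'} {θ : ι → κ → G} {i j x y} (hx : x ∈ gr i) (hy : y ∈ gr' j) :
    x ⊗ₜ[F2] y ∈ tensorGr gr gr' θ (θ i j) :=
  Submodule.subset_span ⟨i, j, rfl, x, hx, y, hy, rfl⟩

theorem tmul_induction {κ M' : Type} [AddCommGroup M'] [Module F2 M'] {gr : ι → Submodule F2 M}
    {gr' : κ → Submodule F2 M'} (h : ⨆ i, gr i = ⊤) (h' : ⨆ i, gr' i = ⊤)
    (S : Submodule F2 (M ⊗[F2] M'))
    (H : ∀ i j, ∀ x ∈ gr i, ∀ y ∈ gr' j, x ⊗ₜ[F2] y ∈ S) : S = ⊤ := by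
  rw [eq_top_iff, ← TensorProduct.span_tmul_eq_top, Submodule.span_le]
  rintro _ ⟨x, y, rfl⟩
  have h1 : ∀ i, ∀ x ∈ gr i, ∀ y, x ⊗ₜ[F2] y ∈ S := by
    intro i x hx y
    have : (⨆ i, gr' i) ≤ S.comap (TensorProduct.mk F2 M M' x) :=
      iSup_le fun j y hy => H i j x hx y hy
    exact this (h' ▸ Submodule.mem_top)
  have : (⨆ i, gr i) ≤ S.comap ((TensorProduct.mk F2 M M').flip y) :=
    iSup_le fun j x hx => h1 j x hx y
  exact this (h ▸ Submodule.mem_top)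

theorem isInternal_tensorGr {κ G M' : Type} [DecidableEq κ] [DecidableEq G] [AddCommGroup M']
    [Module F2 M'] {gr : ι → Submodule F2 M} {gr' : κ → Submodule F2 M'} (θ : ι → κ → G)
    (h : DirectSum.IsInternal gr) (h' : DirectSum.IsInternal gr') :
    DirectSum.IsInternal (tensorGr gr gr' θ) := by
  obtain ⟨D, hD⟩ := exists_coact h
  obtain ⟨D', hD'⟩ := exists_coact h'
  refine isInternal_of_coact _ ((Finsupp.lmapDomain _ F2 (fun p : ι × κ => θ p.1 p.2)) ∘ₗ
    (finsuppTensorFinsupp F2 F2 M M' ι κ).toLinearMap ∘ₗ TensorProduct.map D D') ?_ ?_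
  · intro g x hx
    induction hx using Submodule.span_induction with
    | mem z hz =>
      obtain ⟨i, j, rfl, x, hx, y, hy, rfl⟩ := hz
      simp [hD i x hx, hD' j y hy]
    | zero => simp
    | add x y _ _ hx hy => rw [map_add, hx, hy, Finsupp.single_add]
    | smul a x _ hx => rw [map_smul, hx, Finsupp.smul_single]
  · refine tmul_induction h.submodule_iSup_eq_top h'.submodule_iSup_eq_top _ ?_
    intro i j x hx y hy
    exact Submodule.mem_iSup_of_mem (θ i j) (tensorGr_mem hx hy)

/-- The image of an internal grading under a quotient map whose kernel is homogeneous. -/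
theorem isInternal_map {gr : ι → Submodule F2 M} (h : DirectSum.IsInternal gr)
    {N : Type} [AddCommGroup N] [Module F2 N] (q : M →ₗ[F2] N) (hq : Function.Surjective q)
    (hN : ∀ D : M →ₗ[F2] (ι →₀ M), (∀ i, ∀ x ∈ gr i, D x = Finsupp.single i x) →
      ∀ x, q x = 0 → ∀ i, q (D x i) = 0) :
    DirectSum.IsInternal (fun i => (gr i).map q) := by
  obtain ⟨D, hD⟩ := exists_coact h
  have ht := h.submodule_iSup_eq_top
  have hk : LinearMap.ker q ≤ LinearMap.ker ((Finsupp.mapRange.linearMap q).comp D) := by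
    intro x hx
    rw [LinearMap.mem_ker] at hx ⊢
    ext i
    simpa using hN D hD x hx i
  let e := q.quotKerEquivOfSurjective hq
  refine isInternal_of_coact _ (((LinearMap.ker q).liftQ _ hk).comp e.symm.toLinearMap) ?_ ?_
  · rintro i _ ⟨x, hx, rfl⟩
    have : e.symm (q x) = (LinearMap.ker q).mkQ x := by
      rw [LinearEquiv.symm_apply_eq]; rfl
    simp [this, hD i x hx]
  · rw [← Submodule.map_iSup, ht, Submodule.map_top, LinearMap.range_eq_top.2 hq]

theorem isInternal_prod {gr : ι → Submodule F2 M} (h : DirectSum.IsInternal gr)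
    {N : Type} [AddCommGroup N] [Module F2 N] {gr' : ι → Submodule F2 N}
    (h' : DirectSum.IsInternal gr') :
    DirectSum.IsInternal (fun i => (gr i).prod (gr' i)) := by
  obtain ⟨D, hD⟩ := exists_coact h
  obtain ⟨D', hD'⟩ := exists_coact h'
  refine isInternal_of_coact _
    (((Finsupp.mapRange.linearMap (LinearMap.inl F2 M N)) ∘ₗ D ∘ₗ LinearMap.fst F2 M N) +
     ((Finsupp.mapRange.linearMap (LinearMap.inr F2 M N)) ∘ₗ D' ∘ₗ LinearMap.snd F2 M N)) ?_ ?_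
  · rintro i ⟨x, y⟩ ⟨hx, hy⟩
    simp only [LinearMap.add_apply, LinearMap.comp_apply, LinearMap.fst_apply,
      LinearMap.snd_apply, hD i x hx, hD' i y hy, Finsupp.mapRange.linearMap_apply,
      Finsupp.mapRange_single, ← Finsupp.single_add]
    simp
  · rw [eq_top_iff]
    rintro ⟨x, y⟩ -
    have h1 : (⨆ i, gr i) ≤ (⨆ i, (gr i).prod (gr' i)).comap (LinearMap.inl F2 M N) :=
      iSup_le fun i x hx => Submodule.mem_iSup_of_mem i ⟨hx, Submodule.zero_mem _⟩
    have h2 : (⨆ i, gr' i) ≤ (⨆ i, (gr i).prod (gr' i)).comap (LinearMap.inr F2 M N) :=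
      iSup_le fun i x hx => Submodule.mem_iSup_of_mem i ⟨Submodule.zero_mem _, hx⟩
    have e1 := h1 (h.submodule_iSup_eq_top ▸ Submodule.mem_top : x ∈ _)
    have e2 := h2 (h'.submodule_iSup_eq_top ▸ Submodule.mem_top : y ∈ _)
    rw [Submodule.mem_comap] at e1 e2
    have := Submodule.add_mem _ e1 e2
    simpa using this

theorem isInternal_reindex {gr : ι → Submodule F2 M} (h : DirectSum.IsInternal gr)
    {κ : Type} [DecidableEq κ] (e : κ ≃ ι) :
    DirectSum.IsInternal (fun i => gr (e i)) := by
  obtain ⟨D, hD⟩ := exists_coact h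
  refine isInternal_of_coact _ ((Finsupp.lmapDomain M F2 e.symm).comp D) ?_ ?_
  · intro i x hx
    simp [hD _ x hx]
  · rw [e.iSup_comp (g := gr)]
    exact h.submodule_iSup_eq_top

theorem isInternal_pi {J : Type} [Fintype J] [DecidableEq J] {gr : J → ι → Submodule F2 M}
    (h : ∀ j, DirectSum.IsInternal (gr j)) :
    DirectSum.IsInternal (fun i => Submodule.pi Set.univ (fun j => gr j i)) := by
  choose D hD using fun j => exists_coact (h j)
  refine isInternal_of_coact _ (∑ j, (Finsupp.mapRange.linearMap
    (LinearMap.single F2 (fun _ : J => M) j)) ∘ₗ D j ∘ₗ LinearMap.proj j) ?_ ?_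
  · intro i x hx
    have hx' : ∀ j, D j (x j) = Finsupp.single i (x j) := fun j => hD j i _ (hx j trivial)
    simp only [LinearMap.sum_apply, LinearMap.comp_apply, LinearMap.proj_apply, hx',
      Finsupp.mapRange.linearMap_apply, Finsupp.mapRange_single, ← Finsupp.single_finsetSum]
    congr 1
    exact Finset.univ_sum_single x
  · rw [eq_top_iff]
    intro x _
    rw [← Finset.univ_sum_single x]
    refine Submodule.sum_mem _ fun j _ => ?_
    have h1 : (⨆ i, gr j i) ≤ (⨆ i, Submodule.pi Set.univ (fun j => gr j i)).comap
        (LinearMap.single F2 (fun _ : J => M) j) := by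
      refine iSup_le fun i x hx => Submodule.mem_iSup_of_mem i ?_
      intro k _
      by_cases hk : k = j
      · subst hk; simpa using hx
      · simp [hk]
    exact h1 ((h j).submodule_iSup_eq_top ▸ Submodule.mem_top)

end Gradings

/-! ### `t`-graded DG algebras and modules -/

/-- A `t`-graded DG algebra over `F2`; the first component of the grading is the cohomological
degree, the second one is the `t`-degree. -/
structure DGAlg where
  carrier : Type
  [ring : Ring carrier]
  [algebra : Algebra F2 carrier]
  gr : ℤ × ℤ → Submodule F2 carrier
  internal : DirectSum.IsInternal gr
  one_mem : (1 : carrier) ∈ gr 0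
  mul_mem : ∀ {p q x y}, x ∈ gr p → y ∈ gr q → x * y ∈ gr (p + q)
  d : carrier →ₗ[F2] carrier
  d_mem : ∀ {p x}, x ∈ gr p → d x ∈ gr (p + (1, 0))
  d_d : ∀ x, d (d x) = 0
  d_mul : ∀ x y, d (x * y) = d x * y + x * d y

attribute [instance] DGAlg.ring DGAlg.algebra

instance : CoeSort DGAlg Type := ⟨DGAlg.carrier⟩

/-- A `t`-graded DG left module over `R`. -/
structure DGMod (R : DGAlg) where
  carrier : Type
  [addCommGroup : AddCommGroup carrier]
  [moduleF2 : Module F2 carrier]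
  [module : Module R carrier]
  [tower : IsScalarTower F2 R carrier]
  gr : ℤ × ℤ → Submodule F2 carrier
  internal : DirectSum.IsInternal gr
  smul_mem : ∀ {p q} {r : R} {x}, r ∈ R.gr p → x ∈ gr q → r • x ∈ gr (p + q)
  d : carrier →ₗ[F2] carrier
  d_mem : ∀ {p x}, x ∈ gr p → d x ∈ gr (p + (1, 0))
  d_d : ∀ x, d (d x) = 0
  d_smul : ∀ (r : R) x, d (r • x) = R.d r • x + r • d x

attribute [instance] DGMod.addCommGroup DGMod.moduleF2 DGMod.module DGMod.tower

section Modules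

variable {R : DGAlg}

instance : CoeSort (DGMod R) Type := ⟨DGMod.carrier⟩

namespace DGMod

/-- Morphisms of DG modules: closed `R`-linear maps of degree `(0, 0)`. -/
@[ext]
structure Hom (M N : DGMod R) where
  f : M →ₗ[R] N
  map_mem : ∀ {p x}, x ∈ M.gr p → f x ∈ N.gr p
  comm : ∀ x, f (M.d x) = N.d (f x)

instance : Category (DGMod R) where
  Hom := Hom
  id M := ⟨LinearMap.id, fun h => h, fun _ => rfl⟩
  comp u v := ⟨v.f.comp u.f, fun h => v.map_mem (u.map_mem h), fun x => by simp [u.comm, v.comm]⟩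

@[ext]
theorem hom_ext {M N : DGMod R} {u v : M ⟶ N} (h : ∀ x, u.f x = v.f x) : u = v :=
  Hom.ext (LinearMap.ext h)

instance (M N : DGMod R) : Zero (M ⟶ N) :=
  ⟨⟨0, fun _ => Submodule.zero_mem _, fun x => by simp⟩⟩
instance (M N : DGMod R) : Add (M ⟶ N) :=
  ⟨fun u v => ⟨u.f + v.f, fun h => Submodule.add_mem _ (u.map_mem h) (v.map_mem h),
    fun x => by simp [u.comm, v.comm]⟩⟩
instance (M N : DGMod R) : Neg (M ⟶ N) :=
  ⟨fun u => ⟨-u.f, fun h => Submodule.neg_mem _ (u.map_mem h), fun x => by simp [u.comm]⟩⟩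
instance (M N : DGMod R) : Sub (M ⟶ N) :=
  ⟨fun u v => ⟨u.f - v.f, fun h => Submodule.sub_mem _ (u.map_mem h) (v.map_mem h),
    fun x => by simp [u.comm, v.comm]⟩⟩
instance (M N : DGMod R) : SMul ℕ (M ⟶ N) :=
  ⟨fun n u => ⟨n • u.f, fun h => Submodule.smul_of_tower_mem _ n (u.map_mem h),
    fun x => by simp [u.comm]⟩⟩
instance (M N : DGMod R) : SMul ℤ (M ⟶ N) :=
  ⟨fun n u => ⟨n • u.f, fun h => Submodule.smul_of_tower_mem _ n (u.map_mem h),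
    fun x => by simp [u.comm]⟩⟩

instance (M N : DGMod R) : AddCommGroup (M ⟶ N) :=
  Function.Injective.addCommGroup (fun u : M ⟶ N => u.f) (fun _ _ h => Hom.ext h) rfl
    (fun _ _ => rfl) (fun _ => rfl) (fun _ _ => rfl) (fun _ _ => rfl) (fun _ _ => rfl)

@[simp] theorem add_f {M N : DGMod R} (u v : M ⟶ N) : (u + v).f = u.f + v.f := rfl
@[simp] theorem sub_f {M N : DGMod R} (u v : M ⟶ N) : (u - v).f = u.f - v.f := rfl
@[simp] theorem zero_f {M N : DGMod R} : (0 : M ⟶ N).f = 0 := rfl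
@[simp] theorem comp_f {M N L : DGMod R} (u : M ⟶ N) (v : N ⟶ L) : (u ≫ v).f = v.f.comp u.f := rfl
@[simp] theorem id_f (M : DGMod R) : Hom.f (𝟙 M) = LinearMap.id := rfl

instance : Preadditive (DGMod R) where
  add_comp _ _ _ u v w := by ext x; simp
  comp_add _ _ _ u v w := by ext x; simp

/-- The zero DG module. -/
def zero (R : DGAlg) : DGMod R where
  carrier := PUnit
  gr _ := ⊥
  internal := isInternal_of_coact _ 0 (fun _ _ _ => Subsingleton.elim _ _)
    (Subsingleton.elim _ _)
  smul_mem _ _ := Submodule.mem_bot _ |>.2 (Subsingleton.elim _ _)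
  d := 0
  d_mem _ := Submodule.zero_mem _
  d_d _ := rfl
  d_smul _ _ := rfl

/-- The degree shift `M[a]{b}`, with `M[a]{b}` in degree `(i, j)` equal to `M` in degree
`(i + a, j + b)`. -/
def twist (M : DGMod R) (s : ℤ × ℤ) : DGMod R where
  carrier := M
  gr p := M.gr (p + s)
  internal := isInternal_reindex M.internal (Equiv.addRight s)
  smul_mem hr hx := by rw [add_assoc]; exact M.smul_mem hr hx
  d := M.d
  d_mem hx := by rw [add_right_comm]; exact M.d_mem hx
  d_d := M.d_d
  d_smul := M.d_smul

/-- The functor `M ↦ M[a]{b}`. -/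
def twistFunctor (s : ℤ × ℤ) : DGMod R ⥤ DGMod R where
  obj M := M.twist s
  map u := ⟨u.f, fun h => u.map_mem h, u.comm⟩

/-- The isomorphism `M[0] ≅ M`. -/
def twistZero (M : DGMod R) (s : ℤ × ℤ) (hs : s = 0) : M.twist s ≅ M where
  hom := ⟨LinearMap.id, fun {p x} (h : x ∈ M.gr (p + s)) => by
    have e : p + s = p := by rw [hs, add_zero]
    exact e ▸ h, fun _ => rfl⟩
  inv := ⟨LinearMap.id, fun {p x} (h : x ∈ M.gr p) => by
    have e : p = p + s := by rw [hs, add_zero]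
    exact (e ▸ h : x ∈ M.gr (p + s)), fun _ => rfl⟩

/-- The isomorphism between `M[a + b]` and `M[a][b]`. -/
def twistAdd (M : DGMod R) (s a b : ℤ × ℤ) (hs : s = a + b) :
    M.twist s ≅ (M.twist a).twist b where
  hom := ⟨LinearMap.id, fun {p x} (h : x ∈ M.gr (p + s)) => by
    have e : p + s = p + b + a := by rw [hs, add_assoc, add_comm b]
    exact (e ▸ h : x ∈ M.gr (p + b + a)), fun _ => rfl⟩
  inv := ⟨LinearMap.id, fun {p x} (h : x ∈ M.gr (p + b + a)) => by
    have e : p + b + a = p + s := by rw [hs, add_assoc, add_comm b]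
    exact (e ▸ h : x ∈ M.gr (p + s)), fun _ => rfl⟩

theorem eqToHom_twist_f (M : DGMod R) {s s' : ℤ × ℤ} (hs : s = s') (h : M.twist s = M.twist s')
    (x : M) : (eqToHom h).f x = x := by
  subst hs; rfl

instance : HasShift (DGMod R) ℤ :=
  hasShiftMk _ _
    { F := fun n => twistFunctor (n, 0)
      zero := NatIso.ofComponents (fun M => M.twistZero _ rfl)
      add := fun n m => NatIso.ofComponents (fun M => M.twistAdd _ (n, 0) (m, 0) rfl)
      assoc_hom_app := fun a b c M => by
        apply hom_ext
        intro x
        exact (eqToHom_twist_f M (show ((a + b + c, 0) : ℤ × ℤ) = (a + (b + c), 0) by rw [add_assoc]) (by rw [add_assoc]) x).symm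
      zero_add_hom_app := fun n M => by
        apply hom_ext
        intro x
        exact (eqToHom_twist_f M (show ((0 + n, 0) : ℤ × ℤ) = (n, 0) by rw [zero_add]) (by rw [zero_add]) x).symm
      add_zero_hom_app := fun n M => by
        apply hom_ext
        intro x
        exact (eqToHom_twist_f M (show ((n + 0, 0) : ℤ × ℤ) = (n, 0) by rw [add_zero]) (by rw [add_zero]) x).symm }

/-- The mapping cone of `u : M ⟶ N`: the module `M[1] ⊕ N` with differential
`(x, y) ↦ (d x, u x + d y)`. -/
def cone {M N : DGMod R} (u : M ⟶ N) : DGMod R where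
  carrier := M × N
  gr p := (M.gr (p + (1, 0))).prod (N.gr p)
  internal := isInternal_prod (M.twist (1, 0)).internal N.internal
  smul_mem hr hx := ⟨(M.twist (1, 0)).smul_mem hr hx.1, N.smul_mem hr hx.2⟩
  d := (M.d.comp (LinearMap.fst F2 M N)).prod
    ((u.f.restrictScalars F2).comp (LinearMap.fst F2 M N) + N.d.comp (LinearMap.snd F2 M N))
  d_mem hx := ⟨(M.twist (1, 0)).d_mem hx.1,
    Submodule.add_mem _ (u.map_mem hx.1) (N.d_mem hx.2)⟩
  d_d x := by
    refine Prod.ext (M.d_d _) ?_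
    change u.f (M.d x.1) + N.d (u.f x.1 + N.d x.2) = 0
    rw [map_add, N.d_d, u.comm, add_zero, ZModModule.add_self]
  d_smul r x := by
    refine Prod.ext (M.d_smul _ _) ?_
    change u.f (r • x.1) + N.d (r • x.2) = (R.d r • x.2) + r • (u.f x.1 + N.d x.2)
    rw [map_smul, N.d_smul, smul_add]
    abel

/-- The standard triangle `M ⟶ N ⟶ cone u ⟶ M[1]`. -/
def coneTriangle {M N : DGMod R} (u : M ⟶ N) : Triangle (DGMod R) where
  obj₁ := M
  obj₂ := N
  obj₃ := cone u
  mor₁ := u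
  mor₂ := { f := LinearMap.inr R M N
            map_mem := fun h => ⟨Submodule.zero_mem _, h⟩
            comm := fun x => Prod.ext (map_zero M.d).symm (by
              change N.d x = u.f 0 + N.d x
              rw [map_zero, zero_add]) }
  mor₃ := { f := LinearMap.fst R M N
            map_mem := fun h => h.1
            comm := fun x => rfl }

/-- Two morphisms are homotopic when they differ by `d h + h d` for some `R`-linear `h` of degree
`(-1, 0)`. -/
def homotopic (R : DGAlg) : HomRel (DGMod R) := fun M N u v =>
  ∃ h : M →ₗ[R] N, (∀ {p x}, x ∈ M.gr p → h x ∈ N.gr (p + (-1, 0))) ∧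
    ∀ x, u.f x - v.f x = N.d (h x) + h (M.d x)

instance : Congruence (homotopic R) where
  equivalence := by
    refine ⟨fun u => ⟨0, fun _ => Submodule.zero_mem _, fun x => by simp⟩, ?_, ?_⟩
    · rintro u v ⟨h, hh, e⟩
      refine ⟨-h, fun hx => Submodule.neg_mem _ (hh hx), fun x => ?_⟩
      have := e x
      simp only [LinearMap.neg_apply, map_neg]
      rw [← neg_sub, this]
      abel
    · rintro u v w ⟨h, hh, e⟩ ⟨h', hh', e'⟩
      refine ⟨h + h', fun hx => Submodule.add_mem _ (hh hx) (hh' hx), fun x => ?_⟩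
      have h1 := e x
      have h2 := e' x
      simp only [LinearMap.add_apply, map_add]
      rw [← sub_add_sub_cancel _ (v.f x), h1, h2]
      abel
  comp_left := by
    rintro L M N u v w ⟨h, hh, e⟩
    refine ⟨h.comp u.f, fun hx => hh (u.map_mem hx), fun x => ?_⟩
    simp only [comp_f, LinearMap.comp_apply, u.comm]
    exact e _
  comp_right := by
    rintro L M N u v w ⟨h, hh, e⟩
    refine ⟨w.f.comp h, fun hx => w.map_mem (hh hx), fun x => ?_⟩
    simp only [comp_f, LinearMap.comp_apply]
    rw [← map_sub, e, map_add, w.comm]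

theorem homotopic_add ⦃M N : DGMod R⦄ (u₁ u₂ v₁ v₂ : M ⟶ N) :
    homotopic R u₁ u₂ → homotopic R v₁ v₂ → homotopic R (u₁ + v₁) (u₂ + v₂) := by
  rintro ⟨h, hh, e⟩ ⟨h', hh', e'⟩
  refine ⟨h + h', fun hx => Submodule.add_mem _ (hh hx) (hh' hx), fun x => ?_⟩
  have h1 := e x
  have h2 := e' x
  simp only [LinearMap.add_apply, map_add, add_f]
  rw [add_sub_add_comm, h1, h2]
  abel

instance : (homotopic R).IsCompatibleWithShift ℤ where
  condition := by
    rintro n M N u v ⟨h, hh, e⟩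
    refine ⟨h, fun {p x} (hx : x ∈ M.gr (p + (n, 0))) => ?_, e⟩
    have e : p + (n, 0) + (-1, 0) = p + (-1, 0) + (n, 0) := by abel
    exact (e ▸ hh hx : h x ∈ N.gr (p + (-1, 0) + (n, 0)))

instance shift_additive (n : ℤ) : (shiftFunctor (DGMod R) n).Additive where
  map_add := rfl

end DGMod

/-! ### The homotopy category -/

/-- The homotopy category of all `t`-graded DG `R`-modules. -/
abbrev K (R : DGAlg) := CategoryTheory.Quotient (DGMod.homotopic R)

/-- The functor from DG modules to the homotopy category. -/
abbrev toK (R : DGAlg) : DGMod R ⥤ K R := CategoryTheory.Quotient.functor (DGMod.homotopic R)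

instance (R : DGAlg) : Preadditive (K R) :=
  CategoryTheory.Quotient.preadditive _ DGMod.homotopic_add

instance (R : DGAlg) : (toK R).Additive where
  map_add := rfl

instance (R : DGAlg) (n : ℤ) : (shiftFunctor (K R) n).Additive := by
  have : ((shiftFunctor (DGMod R) n) ⋙ toK R).Additive := inferInstance
  have : (toK R ⋙ shiftFunctor (K R) n).Additive :=
    Functor.additive_of_iso ((toK R).commShiftIso n)
  exact Functor.additive_of_full_essSurj_comp (toK R) _

/-- The smallest class of DG `R`-modules that contains the given modules `P i` and `0`, and is
closed under the shifts `[±1]` and `{±1}`, mapping cones and isomorphisms of DG modules. -/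
inductive Generated {R : DGAlg} {ι : Type} (P : ι → DGMod R) : DGMod R → Prop
  | zero : Generated P (DGMod.zero R)
  | basic (i : ι) : Generated P (P i)
  | twist (M : DGMod R) (s : ℤ × ℤ) : Generated P M → Generated P (M.twist s)
  | cone {M N : DGMod R} (u : M ⟶ N) : Generated P M → Generated P N →
      Generated P (DGMod.cone u)
  | iso {M N : DGMod R} (e : M ≅ N) : Generated P M → Generated P N

/-- The objects of the homotopy category coming from `Generated P`. -/
def generatedK {R : DGAlg} {ι : Type} (P : ι → DGMod R) : ObjectProperty (K R) :=
  fun X => Generated P X.as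

instance {R : DGAlg} {ι : Type} (P : ι → DGMod R) : (generatedK P).IsStableUnderShift ℤ where
  isStableUnderShiftBy n :=
    { le_shift := by
        rintro ⟨M⟩ hM
        have : generatedK P ((toK R).obj (M⟦n⟧)) := Generated.twist M (n, 0) hM
        rwa [← CategoryTheory.Quotient.functor_obj_shift] at this }

/-- The homotopy category (`0`th homology category) of the DG modules in `Generated P`. -/
abbrev HPOf {R : DGAlg} {ι : Type} (P : ι → DGMod R) := (generatedK P).FullSubcategory

instance {R : DGAlg} {ι : Type} (P : ι → DGMod R) (n : ℤ) :
    (shiftFunctor (HPOf P) n).Additive := inferInstance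

instance {R : DGAlg} {ι : Type} (P : ι → DGMod R) : HasZeroObject (HPOf P) where
  zero := ⟨⟨⟨DGMod.zero R⟩, Generated.zero⟩, by
    rw [IsZero.iff_id_eq_zero]
    ext
    exact congrArg (toK R).map (DGMod.hom_ext fun x => rfl)⟩

end Modules

/-! ### Bimodules and tensor products -/

/-- A `t`-graded DG `(R, S)`-bimodule; the right action of `S` is an action of `Sᵐᵒᵖ`. -/
structure DGBimod (R S : DGAlg) extends DGMod R where
  [rightModule : Module (MulOpposite S) carrier]
  [rightTower : IsScalarTower F2 (MulOpposite S) carrier]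
  [smulComm : SMulCommClass R (MulOpposite S) carrier]
  op_smul_mem : ∀ {p q} {s : S} {x}, x ∈ gr p → s ∈ S.gr q → MulOpposite.op s • x ∈ gr (p + q)
  d_op_smul : ∀ (s : S) x,
    d (MulOpposite.op s • x) = MulOpposite.op s • d x + MulOpposite.op (S.d s) • x

attribute [instance] DGBimod.rightModule DGBimod.rightTower DGBimod.smulComm

namespace DGBimod

variable {R S : DGAlg} (N : DGBimod R S) (X : DGMod S)

/-- The relations `n s ⊗ x = n ⊗ s x` defining the tensor product over `S`. -/
def relSet : Set (N.carrier ⊗[F2] X.carrier) :=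
  {z | ∃ (n : N.carrier) (s : S) (x : X), (MulOpposite.op s • n) ⊗ₜ[F2] x - n ⊗ₜ[F2] (s • x) = z}

/-- The submodule of relations. -/
def rel : Submodule R (N.carrier ⊗[F2] X.carrier) := Submodule.span R (N.relSet X)

theorem rel_induction {V : Type} [AddCommGroup V] [Module F2 V]
    (φ : N.carrier ⊗[F2] X.carrier →ₗ[F2] V)
    (h : ∀ (n : N.carrier) (s : S) (x : X),
      φ ((MulOpposite.op s • n) ⊗ₜ[F2] x) = φ (n ⊗ₜ[F2] (s • x))) :
    ∀ z ∈ N.rel X, φ z = 0 := by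
  intro z hz
  refine Submodule.closure_induction (p := fun z _ => φ z = 0) ?_ ?_ ?_ hz
  · exact map_zero φ
  · intro x y _ _ hx hy; rw [map_add, hx, hy, add_zero]
  · rintro r _ ⟨n, s, x, rfl⟩
    rw [smul_sub, TensorProduct.smul_tmul', TensorProduct.smul_tmul', map_sub,
      smul_comm r (MulOpposite.op s) n, h, sub_self]

/-- The underlying module of `N ⊗_S X`. -/
abbrev TensorCarrier : Type := (N.carrier ⊗[F2] X.carrier) ⧸ N.rel X

/-- The quotient map `N ⊗ X ⟶ N ⊗_S X`. -/
def proj : N.carrier ⊗[F2] X.carrier →ₗ[F2] N.TensorCarrier X :=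
  (N.rel X).mkQ.restrictScalars F2

theorem proj_surjective : Function.Surjective (N.proj X) := (N.rel X).mkQ_surjective

theorem proj_eq_zero (z : N.carrier ⊗[F2] X.carrier) : N.proj X z = 0 ↔ z ∈ N.rel X :=
  Submodule.Quotient.mk_eq_zero _

theorem proj_rel (n : N.carrier) (s : S) (x : X) :
    N.proj X ((MulOpposite.op s • n) ⊗ₜ[F2] x) = N.proj X (n ⊗ₜ[F2] (s • x)) := by
  rw [← sub_eq_zero, ← map_sub, proj_eq_zero]
  exact Submodule.subset_span ⟨n, s, x, rfl⟩

/-- The linear map out of `N ⊗_S X` induced by an `S`-balanced linear map. -/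
def lift {V : Type} [AddCommGroup V] [Module F2 V] (φ : N.carrier ⊗[F2] X.carrier →ₗ[F2] V)
    (h : ∀ (n : N.carrier) (s : S) (x : X),
      φ ((MulOpposite.op s • n) ⊗ₜ[F2] x) = φ (n ⊗ₜ[F2] (s • x))) : N.TensorCarrier X →ₗ[F2] V :=
  (((N.rel X).restrictScalars F2).liftQ φ (fun z hz => N.rel_induction X φ h z hz)) ∘ₗ
    (Submodule.Quotient.restrictScalarsEquiv F2 (N.rel X)).symm.toLinearMap

@[simp]
theorem lift_proj {V : Type} [AddCommGroup V] [Module F2 V]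
    (φ : N.carrier ⊗[F2] X.carrier →ₗ[F2] V)
    (h : ∀ (n : N.carrier) (s : S) (x : X),
      φ ((MulOpposite.op s • n) ⊗ₜ[F2] x) = φ (n ⊗ₜ[F2] (s • x))) (z) :
    N.lift X φ h (N.proj X z) = φ z := rfl

/-- The differential of `N ⊗ X`. -/
def preD : N.carrier ⊗[F2] X.carrier →ₗ[F2] N.carrier ⊗[F2] X.carrier :=
  TensorProduct.map N.d LinearMap.id + TensorProduct.map LinearMap.id X.d

theorem preD_tmul (n : N.carrier) (x : X) :
    N.preD X (n ⊗ₜ[F2] x) = N.d n ⊗ₜ[F2] x + n ⊗ₜ[F2] X.d x := by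
  simp [preD]

/-- The grading of `N ⊗ X`. -/
def preGr : ℤ × ℤ → Submodule F2 (N.carrier ⊗[F2] X.carrier) :=
  tensorGr N.gr X.gr (fun p q => p + q)

theorem tensor_induction {V : Type} [AddCommGroup V] [Module F2 V]
    (φ ψ : N.TensorCarrier X →ₗ[F2] V)
    (h : ∀ n x, φ (N.proj X (n ⊗ₜ[F2] x)) = ψ (N.proj X (n ⊗ₜ[F2] x))) (z) : φ z = ψ z := by
  obtain ⟨z, rfl⟩ := N.proj_surjective X z
  have : φ.comp (N.proj X) = ψ.comp (N.proj X) := TensorProduct.ext' h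
  exact LinearMap.congr_fun this z

theorem internal_tensor :
    DirectSum.IsInternal (fun p => (N.preGr X p).map (N.proj X)) := by
  have hN := N.internal.submodule_iSup_eq_top
  have hX := X.internal.submodule_iSup_eq_top
  have hS := S.internal.submodule_iSup_eq_top
  refine isInternal_map (isInternal_tensorGr _ N.internal X.internal) _ (N.proj_surjective X) ?_
  intro D hD z hz i
  have hD' : ∀ {p q n x}, n ∈ N.gr p → x ∈ X.gr q →
      D (n ⊗ₜ[F2] x) = Finsupp.single (p + q) (n ⊗ₜ[F2] x) := fun hn hx =>
    hD _ _ (tensorGr_mem (θ := fun p q => p + q) hn hx)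
  let φ : N.carrier ⊗[F2] X.carrier →ₗ[F2] N.TensorCarrier X :=
    (N.proj X) ∘ₗ (Finsupp.lapply i) ∘ₗ D
  refine N.rel_induction X φ ?_ z ((N.proj_eq_zero X z).1 hz)
  have h1 : ∀ {p q r n s x}, n ∈ N.gr p → s ∈ S.gr q → x ∈ X.gr r →
      φ ((MulOpposite.op s • n) ⊗ₜ[F2] x) = φ (n ⊗ₜ[F2] (s • x)) := by
    intro p q r n s x hn hs hx
    have e1 := hD' (N.op_smul_mem hn hs) hx
    have e2 := hD' hn (X.smul_mem hs hx)
    simp only [φ, LinearMap.comp_apply, e1, e2, Finsupp.lapply_apply, Finsupp.single_apply,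
      add_assoc]
    split_ifs
    · exact N.proj_rel X n s x
    · rfl
  have h2 : ∀ {p q n s}, n ∈ N.gr p → s ∈ S.gr q → ∀ x,
      φ ((MulOpposite.op s • n) ⊗ₜ[F2] x) = φ (n ⊗ₜ[F2] (s • x)) := by
    intro p q n s hn hs x
    refine Submodule.iSup_induction X.gr
      (motive := fun x => φ ((MulOpposite.op s • n) ⊗ₜ[F2] x) = φ (n ⊗ₜ[F2] (s • x)))
      (hX ▸ Submodule.mem_top : x ∈ _) (fun r x hx => h1 hn hs hx) (by simp) ?_
    intro x y hx hy
    rw [TensorProduct.tmul_add, smul_add, TensorProduct.tmul_add, map_add, map_add, hx, hy]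
  have h3 : ∀ {p n}, n ∈ N.gr p → ∀ (s : S) (x : X),
      φ ((MulOpposite.op s • n) ⊗ₜ[F2] x) = φ (n ⊗ₜ[F2] (s • x)) := by
    intro p n hn (s : S) x
    refine Submodule.iSup_induction S.gr
      (motive := fun s => φ ((MulOpposite.op s • n) ⊗ₜ[F2] x) = φ (n ⊗ₜ[F2] (s • x)))
      (hS ▸ Submodule.mem_top : s ∈ _) (fun r s hs => h2 hn hs x) (by simp) ?_
    intro s t hs ht
    rw [MulOpposite.op_add, add_smul, add_smul, TensorProduct.add_tmul, TensorProduct.tmul_add,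
      map_add, map_add, hs, ht]
  intro n s x
  refine Submodule.iSup_induction N.gr
    (motive := fun n => φ ((MulOpposite.op s • n) ⊗ₜ[F2] x) = φ (n ⊗ₜ[F2] (s • x)))
    (hN ▸ Submodule.mem_top : n ∈ _) (fun p n hn => h3 hn s x) (by simp) ?_
  intro m n hm hn
  rw [smul_add, TensorProduct.add_tmul, TensorProduct.add_tmul, map_add, map_add, hm, hn]

/-- The DG `R`-module `N ⊗_S X`. -/
def tensor : DGMod R where
  carrier := N.TensorCarrier X
  gr p := (N.preGr X p).map (N.proj X)
  internal := N.internal_tensor X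
  smul_mem := by
    rintro p q r _ hr ⟨z, hz, rfl⟩
    change N.proj X (r • z) ∈ _
    refine Submodule.mem_map_of_mem ?_
    induction hz using Submodule.span_induction with
    | mem z hz =>
      obtain ⟨i, j, rfl, n, hn, x, hx, rfl⟩ := hz
      rw [TensorProduct.smul_tmul', ← add_assoc]
      exact tensorGr_mem (θ := fun p q => p + q) (N.smul_mem hr hn) hx
    | zero => rw [smul_zero]; exact Submodule.zero_mem _
    | add x y _ _ hx hy => rw [smul_add]; exact Submodule.add_mem _ hx hy
    | smul a x _ hx => rw [smul_comm]; exact Submodule.smul_mem _ _ hx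
  d := N.lift X ((N.proj X).comp (N.preD X)) (by
    intro n s x
    simp only [LinearMap.comp_apply, preD_tmul, map_add, N.d_op_smul, X.d_smul,
      TensorProduct.add_tmul, TensorProduct.tmul_add, proj_rel]
    abel)
  d_mem := by
    rintro p _ ⟨z, hz, rfl⟩
    rw [lift_proj]
    refine Submodule.mem_map_of_mem ?_
    induction hz using Submodule.span_induction with
    | mem z hz =>
      obtain ⟨i, j, rfl, n, hn, x, hx, rfl⟩ := hz
      rw [preD_tmul]
      refine Submodule.add_mem _ ?_ ?_
      · rw [add_right_comm]
        exact tensorGr_mem (θ := fun p q => p + q) (N.d_mem hn) hx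
      · rw [add_assoc]
        exact tensorGr_mem (θ := fun p q => p + q) hn (X.d_mem hx)
    | zero => rw [map_zero]; exact Submodule.zero_mem _
    | add x y _ _ hx hy => rw [map_add]; exact Submodule.add_mem _ hx hy
    | smul a x _ hx => rw [map_smul]; exact Submodule.smul_mem _ _ hx
  d_d z := by
    obtain ⟨z, rfl⟩ := N.proj_surjective X z
    simp only [lift_proj, LinearMap.comp_apply]
    induction z with
    | zero => simp
    | add x y hx hy => rw [map_add, map_add, map_add, hx, hy, add_zero]
    | tmul n x =>
      simp only [preD_tmul, map_add, N.d_d, X.d_d, TensorProduct.zero_tmul,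
        TensorProduct.tmul_zero, zero_add, add_zero, ZModModule.add_self, map_zero]
  d_smul r z := by
    obtain ⟨z, rfl⟩ := N.proj_surjective X z
    change N.lift X _ _ (N.proj X (r • z)) = N.proj X (R.d r • z) + r • N.proj X (N.preD X z)
    change _ = _ + N.proj X (r • N.preD X z)
    simp only [lift_proj, LinearMap.comp_apply, ← map_add]
    congr 1
    induction z with
    | zero => simp
    | add x y hx hy => simp only [smul_add, map_add, hx, hy]; abel
    | tmul n x =>
      simp only [preD_tmul, TensorProduct.smul_tmul', N.d_smul, TensorProduct.add_tmul, smul_add]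
      abel

/-- The map `N ⊗ X ⟶ N ⊗ Y` induced by `u : X ⟶ Y`. -/
def preMap {X Y : DGMod S} (u : X ⟶ Y) : N.carrier ⊗[F2] X.carrier →ₗ[R] N.carrier ⊗[F2] Y.carrier :=
  TensorProduct.AlgebraTensorModule.map LinearMap.id (u.f.restrictScalars F2)

theorem preMap_comm {X Y : DGMod S} (u : X ⟶ Y) (z : N.carrier ⊗[F2] X.carrier) :
    N.preMap u (N.preD X z) = N.preD Y (N.preMap u z) := by
  induction z with
  | zero => simp
  | add x y hx hy => rw [map_add, map_add, hx, hy, map_add, map_add]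
  | tmul n x => simp [preMap, preD_tmul, u.comm]

/-- The map `N ⊗_S X ⟶ N ⊗_S Y` induced by `u : X ⟶ Y`. -/
def tensorMap {X Y : DGMod S} (u : X ⟶ Y) : N.tensor X ⟶ N.tensor Y where
  f := (N.rel X).mapQ (N.rel Y) (N.preMap u) (by
      rw [rel, Submodule.span_le]
      rintro _ ⟨n, s, x, rfl⟩
      refine Submodule.subset_span ⟨n, s, u.f x, ?_⟩
      simp [preMap])
  map_mem := by
    rintro p _ ⟨z, hz, rfl⟩
    refine Submodule.mem_map_of_mem (f := N.proj Y) ?_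
    induction hz using Submodule.span_induction with
    | mem z hz =>
      obtain ⟨i, j, rfl, n, hn, x, hx, rfl⟩ := hz
      exact tensorGr_mem (θ := fun p q => p + q) hn (u.map_mem hx)
    | zero => rw [map_zero]; exact Submodule.zero_mem _
    | add x y _ _ hx hy => rw [map_add]; exact Submodule.add_mem _ hx hy
    | smul a x _ hx =>
      have := Submodule.smul_mem (N.preGr Y p) a hx
      rwa [← LinearMap.map_smul_of_tower] at this
  comm z := by
    obtain ⟨z, rfl⟩ := N.proj_surjective X z
    exact congrArg (N.proj Y) (N.preMap_comm u z)

/-- The functor `N ⊗_S -`. -/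
def tensorFunctor : DGMod S ⥤ DGMod R where
  obj X := N.tensor X
  map u := N.tensorMap u
  map_id X := by
    apply DGMod.hom_ext
    intro z
    obtain ⟨z, rfl⟩ := N.proj_surjective X z
    refine congrArg (N.proj X) ?_
    induction z with
    | zero => simp
    | add x y hx hy => rw [map_add, hx, hy]
    | tmul n x => rfl
  map_comp {X Y Z} u v := by
    apply DGMod.hom_ext
    intro z
    obtain ⟨z, rfl⟩ := N.proj_surjective X z
    refine congrArg (N.proj Z) ?_
    induction z with
    | zero => simp
    | add x y hx hy => rw [map_add, hx, hy, map_add, map_add]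
    | tmul n x => rfl

end DGBimod

theorem coact_comm {ι M : Type} [DecidableEq ι] [AddCommGroup M] [Module F2 M]
    {gr : ι → Submodule F2 M} (h : ⨆ i, gr i = ⊤) {D : M →ₗ[F2] (ι →₀ M)}
    (hD : ∀ i, ∀ x ∈ gr i, D x = Finsupp.single i x) (f : M →ₗ[F2] M)
    (hf : ∀ i, ∀ x ∈ gr i, f x ∈ gr i) (x : M) (i : ι) : D (f x) i = f (D x i) := by
  have h3 : (⨆ j, gr j) ≤ LinearMap.eqLocus ((Finsupp.lapply i).comp (D.comp f))
      (f.comp ((Finsupp.lapply i).comp D)) := by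
    refine iSup_le fun j y hy => ?_
    rw [LinearMap.mem_eqLocus]
    simp only [LinearMap.comp_apply, hD j y hy, hD j _ (hf j y hy), Finsupp.lapply_apply,
      Finsupp.single_apply]
    split_ifs <;> simp
  exact h3 (h ▸ Submodule.mem_top : x ∈ _)

/-- The left DG module `R · e` generated by an element `e` of degree `(0, 0)` with `d e = 0`,
with the grading and the differential inherited from `R`. -/
def DGAlg.leftIdeal (R : DGAlg) (e : R) (he : e ∈ R.gr 0) (hd : R.d e = 0) : DGMod R where
  carrier := ↥(Submodule.span R {e})
  gr p := (R.gr p).comap ((Submodule.span R {e}).subtype.restrictScalars F2)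
  internal := by
    refine isInternal_sub R.internal _ Subtype.val_injective ?_
    intro D hD x p
    obtain ⟨r, hr⟩ := Submodule.mem_span_singleton.1 x.2
    have := coact_comm R.internal.submodule_iSup_eq_top hD (LinearMap.mulRight F2 e)
      (fun i x hx => by simpa using R.mul_mem hx he) r p
    rw [LinearMap.mulRight_apply, LinearMap.mulRight_apply] at this
    refine ⟨⟨D r p * e, Submodule.mem_span_singleton.2 ⟨D r p, rfl⟩⟩, ?_⟩
    change D r p * e = D x.1 p
    rw [← this, ← hr, smul_eq_mul]
  smul_mem hr hx := R.mul_mem hr hx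
  d := LinearMap.restrict R.d
    (p := (Submodule.span R {e}).restrictScalars F2)
    (q := (Submodule.span R {e}).restrictScalars F2) (by
      intro x hx
      obtain ⟨r, rfl⟩ := Submodule.mem_span_singleton.1 hx
      rw [smul_eq_mul, R.d_mul, hd, mul_zero, add_zero]
      exact Submodule.mem_span_singleton.2 ⟨_, rfl⟩)
  d_mem hx := R.d_mem hx
  d_d x := Subtype.ext (R.d_d x.1)
  d_smul r x := Subtype.ext (R.d_mul r x.1)

/-- A DG algebra as a left module over itself. -/
def DGAlg.self (R : DGAlg) : DGMod R where
  carrier := R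
  gr := R.gr
  internal := R.internal
  smul_mem := R.mul_mem
  d := R.d
  d_mem := R.d_mem
  d_d := R.d_d
  d_smul := R.d_mul

/-! ### The algebra `A` -/

/-- The set `{F, I, EF, E}` of vertices. -/
inductive Vtx
  | F | I | EF | E
  deriving DecidableEq

instance : Fintype Vtx := ⟨{.F, .I, .EF, .E}, fun v => by cases v <;> decide⟩

/-- The parity of a vertex. -/
def Vtx.parity : Vtx → ℤ
  | F => 1
  | I => 0
  | EF => 0
  | E => -1

/-- Generators of `A`: the idempotents `e(γ)` and the arrows `ρ(I, EF)` and `ρ(EF, I)`. -/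
inductive AGen
  | e (v : Vtx) | rIEF | rEFI

/-- The defining relations of `A`. -/
inductive ARel : FreeAlgebra F2 AGen → FreeAlgebra F2 AGen → Prop
  | idem (v : Vtx) : ARel (FreeAlgebra.ι F2 (.e v) * FreeAlgebra.ι F2 (.e v))
      (FreeAlgebra.ι F2 (.e v))
  | orth (v w : Vtx) : v ≠ w → ARel (FreeAlgebra.ι F2 (.e v) * FreeAlgebra.ι F2 (.e w)) 0
  | unit : ARel (∑ v, FreeAlgebra.ι F2 (.e v)) 1
  | e_rIEF : ARel (FreeAlgebra.ι F2 (.e .I) * FreeAlgebra.ι F2 .rIEF) (FreeAlgebra.ι F2 .rIEF)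
  | rIEF_e : ARel (FreeAlgebra.ι F2 .rIEF * FreeAlgebra.ι F2 (.e .EF)) (FreeAlgebra.ι F2 .rIEF)
  | e_rEFI : ARel (FreeAlgebra.ι F2 (.e .EF) * FreeAlgebra.ι F2 .rEFI) (FreeAlgebra.ι F2 .rEFI)
  | rEFI_e : ARel (FreeAlgebra.ι F2 .rEFI * FreeAlgebra.ι F2 (.e .I)) (FreeAlgebra.ι F2 .rEFI)
  | rIEF_rEFI : ARel (FreeAlgebra.ι F2 .rIEF * FreeAlgebra.ι F2 .rEFI) 0

/-- The underlying algebra of `A`, a quotient of the path algebra of the quiver with vertices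
`F, I, EF, E` and arrows `I ⇄ EF`. -/
abbrev AAlg : Type := RingQuot ARel

namespace AAlg

/-- The generators as elements of `A`. -/
def gen (x : AGen) : AAlg := RingQuot.mkAlgHom F2 ARel (FreeAlgebra.ι F2 x)
/-- The idempotent `e(γ)`. -/
def e (v : Vtx) : AAlg := gen (.e v)
/-- The arrow `ρ(I, EF)`. -/
def rIEF : AAlg := gen .rIEF
/-- The arrow `ρ(EF, I)`. -/
def rEFI : AAlg := gen .rEFI

@[simp] theorem e_mul_self (v : Vtx) : e v * e v = e v := by
  have := RingQuot.mkAlgHom_rel F2 (ARel.idem v)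
  rwa [map_mul] at this
theorem e_mul_of_ne {v w : Vtx} (h : v ≠ w) : e v * e w = 0 := by
  have := RingQuot.mkAlgHom_rel F2 (ARel.orth v w h)
  rwa [map_mul, map_zero] at this
theorem sum_e : ∑ v, e v = 1 := by
  have := RingQuot.mkAlgHom_rel F2 ARel.unit
  rwa [map_sum, map_one] at this
@[simp] theorem e_mul_rIEF : e .I * rIEF = rIEF := by
  have := RingQuot.mkAlgHom_rel F2 ARel.e_rIEF
  rwa [map_mul] at this
@[simp] theorem rIEF_mul_e : rIEF * e .EF = rIEF := by
  have := RingQuot.mkAlgHom_rel F2 ARel.rIEF_e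
  rwa [map_mul] at this
@[simp] theorem e_mul_rEFI : e .EF * rEFI = rEFI := by
  have := RingQuot.mkAlgHom_rel F2 ARel.e_rEFI
  rwa [map_mul] at this
@[simp] theorem rEFI_mul_e : rEFI * e .I = rEFI := by
  have := RingQuot.mkAlgHom_rel F2 ARel.rEFI_e
  rwa [map_mul] at this
@[simp] theorem rIEF_mul_rEFI : rIEF * rEFI = 0 := by
  have := RingQuot.mkAlgHom_rel F2 ARel.rIEF_rEFI
  rwa [map_mul, map_zero] at this

theorem e_mul_e (v w : Vtx) : e v * e w = if v = w then e v else 0 := by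
  split_ifs with h
  · rw [h, e_mul_self]
  · exact e_mul_of_ne h

theorem mem_subalgebra (S : Subalgebra F2 AAlg) (h : ∀ x, gen x ∈ S) (a : AAlg) : a ∈ S := by
  obtain ⟨a, rfl⟩ := RingQuot.mkAlgHom_surjective F2 ARel a
  induction a with
  | grade0 r => rw [AlgHom.commutes]; exact S.algebraMap_mem r
  | grade1 x => exact h x
  | mul x y hx hy => rw [map_mul]; exact S.mul_mem hx hy
  | add x y hx hy => rw [map_add]; exact S.add_mem hx hy

/-- Construct algebra maps out of `A`. -/
def lift {B : Type} [Ring B] [Algebra F2 B] (f : AGen → B)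
    (idem : ∀ v, f (.e v) * f (.e v) = f (.e v))
    (orth : ∀ v w, v ≠ w → f (.e v) * f (.e w) = 0)
    (unit : ∑ v, f (.e v) = 1)
    (h1 : f (.e .I) * f .rIEF = f .rIEF) (h2 : f .rIEF * f (.e .EF) = f .rIEF)
    (h3 : f (.e .EF) * f .rEFI = f .rEFI) (h4 : f .rEFI * f (.e .I) = f .rEFI)
    (h5 : f .rIEF * f .rEFI = 0) : AAlg →ₐ[F2] B :=
  RingQuot.liftAlgHom F2 ⟨FreeAlgebra.lift F2 f, by
    rintro _ _ (v | ⟨v, w, h⟩ | _ | _ | _ | _ | _ | _)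
    · simp [idem]
    · simp [orth v w h]
    · simp [unit]
    · simp [h1]
    · simp [h2]
    · simp [h3]
    · simp [h4]
    · simp [h5]⟩

@[simp]
theorem lift_gen {B : Type} [Ring B] [Algebra F2 B] (f : AGen → B)
    (idem orth unit h1 h2 h3 h4 h5) (x : AGen) :
    lift f idem orth unit h1 h2 h3 h4 h5 (gen x) = f x := by
  simp [lift, gen, RingQuot.liftAlgHom_mkAlgHom_apply]

/-- The degrees of the generators of `A`. -/
def genDeg : AGen → ℤ × ℤ
  | .rEFI => (1, 1)
  | _ => 0

/-- `Mono x p` means that `x` is a product of generators of `A` with total degree `p`. -/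
inductive Mono : AAlg → ℤ × ℤ → Prop
  | gen (x : AGen) : Mono (gen x) (genDeg x)
  | mul {x y p q} : Mono x p → Mono y q → Mono (x * y) (p + q)

/-- The grading of `A`. -/
def gr (p : ℤ × ℤ) : Submodule F2 AAlg := Submodule.span F2 {x | Mono x p}

theorem gen_mem (x : AGen) : gen x ∈ gr (genDeg x) := Submodule.subset_span (.gen x)
theorem e_mem (v : Vtx) : e v ∈ gr 0 := gen_mem (.e v)
theorem rIEF_mem : rIEF ∈ gr 0 := gen_mem .rIEF
theorem rEFI_mem : rEFI ∈ gr (1, 1) := gen_mem .rEFI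

theorem one_mem : (1 : AAlg) ∈ gr 0 := by
  rw [← sum_e]
  exact Submodule.sum_mem _ fun v _ => e_mem v

theorem mul_mem {p q : ℤ × ℤ} {x y : AAlg} (hx : x ∈ gr p) (hy : y ∈ gr q) :
    x * y ∈ gr (p + q) := by
  induction hx, hy using Submodule.span_induction₂ with
  | mem_mem x y hx hy => exact Submodule.subset_span (.mul hx hy)
  | zero_left y hy => rw [zero_mul]; exact Submodule.zero_mem _
  | zero_right y hy => rw [mul_zero]; exact Submodule.zero_mem _
  | add_left x y z _ _ _ h1 h2 => rw [add_mul]; exact Submodule.add_mem _ h1 h2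
  | add_right x y z _ _ _ h1 h2 => rw [mul_add]; exact Submodule.add_mem _ h1 h2
  | smul_left r x y _ _ h => rw [smul_mul_assoc]; exact Submodule.smul_mem _ _ h
  | smul_right r x y _ _ h => rw [mul_smul_comm]; exact Submodule.smul_mem _ _ h

/-- The coaction describing the grading of `A`. -/
def coact : AAlg →ₐ[F2] AddMonoidAlgebra AAlg (ℤ × ℤ) :=
  lift (fun x => AddMonoidAlgebra.single (genDeg x) (gen x))
    (fun v => by
      rw [AddMonoidAlgebra.single_mul_single]
      exact congrArg _ (e_mul_self v))
    (fun v w h => by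
      rw [AddMonoidAlgebra.single_mul_single]
      exact (congrArg _ (e_mul_of_ne h)).trans (by simp))
    (by
      have h : ∀ v, AddMonoidAlgebra.single (genDeg (.e v)) (gen (.e v)) =
        AddMonoidAlgebra.singleAddHom (0 : ℤ × ℤ) (e v) := fun v => rfl
      simp only [h]
      rw [← map_sum, sum_e]; rfl)
    (by rw [AddMonoidAlgebra.single_mul_single]; exact congrArg _ e_mul_rIEF)
    (by rw [AddMonoidAlgebra.single_mul_single]; exact congrArg _ rIEF_mul_e)
    (by rw [AddMonoidAlgebra.single_mul_single]; exact congrArg _ e_mul_rEFI)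
    (by rw [AddMonoidAlgebra.single_mul_single]; exact congrArg _ rEFI_mul_e)
    (by
      rw [AddMonoidAlgebra.single_mul_single]
      exact (congrArg _ rIEF_mul_rEFI).trans (by simp))

theorem internal : DirectSum.IsInternal gr := by
  let D : AAlg →ₗ[F2] (ℤ × ℤ →₀ AAlg) :=
    { toFun := fun x => (coact x).coeff
      map_add' := fun x y => by simp
      map_smul' := fun r x => by simp }
  refine isInternal_of_coact _ D ?_ ?_
  · intro p x hx
    induction hx using Submodule.span_induction with
    | mem x hx =>
      have : coact x = AddMonoidAlgebra.single p x := by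
        induction hx with
        | gen x => exact lift_gen ..
        | mul _ _ hx hy => rw [map_mul, hx, hy, AddMonoidAlgebra.single_mul_single]
      change (coact x).coeff = _
      rw [this]; rfl
    | zero => simp
    | add x y _ _ hx hy => rw [map_add, hx, hy, Finsupp.single_add]
    | smul r x _ hx => rw [map_smul, hx, Finsupp.smul_single]
  · let S : Subalgebra F2 AAlg := Submodule.toSubalgebra (⨆ p, gr p)
      (Submodule.mem_iSup_of_mem 0 one_mem) (by
        intro x y hx hy
        refine Submodule.iSup_induction gr (motive := fun x => x * y ∈ ⨆ p, gr p) hx ?_ ?_ ?_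
        · intro p x hx
          refine Submodule.iSup_induction gr (motive := fun y => x * y ∈ ⨆ p, gr p) hy ?_ ?_ ?_
          · intro q y hy
            exact Submodule.mem_iSup_of_mem _ (mul_mem hx hy)
          · rw [mul_zero]; exact Submodule.zero_mem _
          · intro y z hy hz
            rw [mul_add]; exact Submodule.add_mem _ hy hz
        · rw [zero_mul]; exact Submodule.zero_mem _
        · intro y z hy hz
          rw [add_mul]; exact Submodule.add_mem _ hy hz)
    rw [eq_top_iff]
    intro x _
    exact mem_subalgebra S (fun x => Submodule.mem_iSup_of_mem _ (gen_mem x)) x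

/-- The central idempotent of `A` cutting out the summand of parity `p`. -/
def cent (p : ℤ) : AAlg := ∑ v : Vtx, if v.parity = p then e v else 0

theorem cent_mem (p : ℤ) : cent p ∈ gr 0 :=
  Submodule.sum_mem _ fun v _ => by
    split_ifs
    · exact e_mem v
    · exact Submodule.zero_mem _

theorem cent_mul_e (p : ℤ) (v : Vtx) : cent p * e v = if v.parity = p then e v else 0 := by
  rw [cent, Finset.sum_mul, Finset.sum_eq_single v]
  · split_ifs <;> simp
  · intro w _ hw
    split_ifs
    · exact e_mul_of_ne hw
    · exact zero_mul _
  · simp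

theorem e_mul_cent (p : ℤ) (v : Vtx) : e v * cent p = if v.parity = p then e v else 0 := by
  rw [cent, Finset.mul_sum, Finset.sum_eq_single v]
  · split_ifs <;> simp
  · intro w _ hw
    split_ifs
    · exact e_mul_of_ne hw.symm
    · exact mul_zero _
  · simp

theorem cent_comm (p : ℤ) (x : AAlg) : cent p * x = x * cent p := by
  have : x ∈ Subalgebra.centralizer F2 {cent p} := by
    refine mem_subalgebra _ (fun x => ?_) x
    rw [Subalgebra.mem_centralizer_iff]
    rintro _ rfl
    rcases x with v | _ | _
    · exact (cent_mul_e p v).trans (e_mul_cent p v).symm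
    · change cent p * rIEF = rIEF * cent p
      have h1 : cent p * rIEF = if (0 : ℤ) = p then rIEF else 0 := by
        conv_lhs => rw [← e_mul_rIEF, ← mul_assoc, cent_mul_e, ite_mul, e_mul_rIEF, zero_mul]
        rfl
      have h2 : rIEF * cent p = if (0 : ℤ) = p then rIEF else 0 := by
        conv_lhs => rw [← rIEF_mul_e, mul_assoc, e_mul_cent, mul_ite, rIEF_mul_e, mul_zero]
        rfl
      rw [h1, h2]
    · change cent p * rEFI = rEFI * cent p
      have h1 : cent p * rEFI = if (0 : ℤ) = p then rEFI else 0 := by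
        conv_lhs => rw [← e_mul_rEFI, ← mul_assoc, cent_mul_e, ite_mul, e_mul_rEFI, zero_mul]
        rfl
      have h2 : rEFI * cent p = if (0 : ℤ) = p then rEFI else 0 := by
        conv_lhs => rw [← rEFI_mul_e, mul_assoc, e_mul_cent, mul_ite, rEFI_mul_e, mul_zero]
        rfl
      rw [h1, h2]
  exact (Subalgebra.mem_centralizer_iff F2).1 this _ rfl

theorem cent_mul_cent (p q : ℤ) : cent p * cent q = if p = q then cent p else 0 := by
  rw [cent, Finset.sum_mul]
  simp only [ite_mul, zero_mul, e_mul_cent]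
  split_ifs with h
  · subst h
    exact Finset.sum_congr rfl fun v _ => by split_ifs <;> rfl
  · refine Finset.sum_eq_zero fun v _ => ?_
    split_ifs with h1 h2
    · exact absurd (h1.symm.trans h2) h
    · rfl
    · rfl

end AAlg

/-- The `t`-graded DG algebra `A`, with trivial differential. -/
def A : DGAlg where
  carrier := AAlg
  gr := AAlg.gr
  internal := AAlg.internal
  one_mem := AAlg.one_mem
  mul_mem := AAlg.mul_mem
  d := 0
  d_mem _ := Submodule.zero_mem _
  d_d _ := rfl
  d_mul x y := by simp

/-- The projective DG module `P(γ) = A · e(γ)`. -/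
def P (v : Vtx) : DGMod A := A.leftIdeal (AAlg.e v) (AAlg.e_mem v) rfl

/-! ### The algebra `A ⊗ A` and the external tensor product -/

namespace A

/-- The idempotent `e(γ)` of `A`. -/
def e (v : Vtx) : A := AAlg.e v
/-- The central idempotent of `A` cutting out the summand of parity `p`. -/
def cent (p : ℤ) : A := AAlg.cent p

theorem e_mem (v : Vtx) : e v ∈ A.gr 0 := AAlg.e_mem v
theorem sum_e : ∑ v, e v = 1 := AAlg.sum_e
theorem cent_eq (p : ℤ) : cent p = ∑ v : Vtx, if v.parity = p then e v else 0 := rfl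
theorem cent_mul_e (p : ℤ) (v : Vtx) : cent p * e v = if v.parity = p then e v else 0 :=
  AAlg.cent_mul_e p v
theorem e_mul_cent (p : ℤ) (v : Vtx) : e v * cent p = if v.parity = p then e v else 0 :=
  AAlg.e_mul_cent p v
theorem cent_comm (p : ℤ) (x : A) : cent p * x = x * cent p := AAlg.cent_comm p x
theorem cent_mul_cent (p q : ℤ) : cent p * cent q = if p = q then cent p else 0 :=
  AAlg.cent_mul_cent p q
theorem d_eq (x : A) : A.d x = 0 := rfl

end A

/-- The homogeneous elements of a DG `A`-module of a given degree and a given parity. An element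
`m` has parity `p` when it lies in the sum of the subspaces `e(γ) M` over the vertices `γ` of
parity `p`. -/
def parityGr (M : DGMod A) (q : (ℤ × ℤ) × ℤ) : Submodule F2 M where
  carrier := {m | m ∈ M.gr q.1 ∧ A.cent q.2 • m = m}
  add_mem' hx hy := ⟨Submodule.add_mem _ hx.1 hy.1, by rw [smul_add, hx.2, hy.2]⟩
  zero_mem' := ⟨Submodule.zero_mem _, smul_zero _⟩
  smul_mem' r x hx := ⟨Submodule.smul_mem _ r hx.1, by rw [smul_comm, hx.2]⟩

theorem internal_parityGr (M : DGMod A) : DirectSum.IsInternal (parityGr M) := by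
  obtain ⟨D, hD⟩ := exists_coact M.internal
  refine isInternal_of_coact _ (∑ v : Vtx, (Finsupp.lmapDomain M F2
    (fun d : ℤ × ℤ => (d, v.parity))) ∘ₗ D ∘ₗ Algebra.lsmul F2 F2 M (A.e v)) ?_ ?_
  · rintro ⟨d, p⟩ x ⟨hx, hp⟩
    have h1 : ∀ v : Vtx, D (A.e v • x) = Finsupp.single d (A.e v • x) :=
      fun v => hD _ _ (by simpa using M.smul_mem (A.e_mem v) hx)
    have h2 : ∀ v : Vtx, Finsupp.single (d, v.parity) (A.e v • x) =
        Finsupp.singleAddHom (d, p) ((if v.parity = p then A.e v else 0) • x) := by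
      intro v
      split_ifs with h
      · rw [h]; rfl
      · have : A.e v • x = 0 := by
          rw [← hp, ← mul_smul, A.e_mul_cent, if_neg h, zero_smul]
        rw [this]; simp
    simp only [LinearMap.sum_apply, LinearMap.comp_apply, Algebra.lsmul_coe, h1,
      Finsupp.lmapDomain_apply, Finsupp.mapDomain_single, h2]
    rw [← map_sum, ← Finset.sum_smul]
    exact congrArg _ hp
  · rw [eq_top_iff, ← M.internal.submodule_iSup_eq_top]
    refine iSup_le fun d x hx => ?_
    have : x = ∑ v : Vtx, A.e v • x := by
      rw [← Finset.sum_smul, A.sum_e, one_smul]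
    rw [this]
    refine Submodule.sum_mem _ fun v _ => Submodule.mem_iSup_of_mem (d, v.parity) ⟨?_, ?_⟩
    · simpa using M.smul_mem (A.e_mem v) hx
    · rw [← mul_smul, A.cent_mul_e, if_pos rfl]

/-- The degree of `m₁ ⊗ m₂`, with `m₁` of degree `p` and `m₂` of degree `q.1` and parity `q.2`:
`deg_t = deg_t m₁ + deg_t m₂` and
`deg_h = deg_h m₁ + deg_h m₂ + 2 * deg_t m₁ * parity m₂`. -/
def twistDeg (p : ℤ × ℤ) (q : (ℤ × ℤ) × ℤ) : ℤ × ℤ :=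
  (p.1 + q.1.1 + 2 * p.2 * q.2, p.2 + q.1.2)

/-- The grading of `M₁ ⊗ M₂`. -/
def chiGr (M₁ M₂ : DGMod A) : ℤ × ℤ → Submodule F2 (M₁.carrier ⊗[F2] M₂.carrier) :=
  tensorGr M₁.gr (parityGr M₂) twistDeg

theorem chiGr_mem {M₁ M₂ : DGMod A} {p q} {x : M₁} {y : M₂} (hx : x ∈ M₁.gr p)
    (hy : y ∈ parityGr M₂ q) : x ⊗ₜ[F2] y ∈ chiGr M₁ M₂ (twistDeg p q) := tensorGr_mem hx hy

/-- The homogeneous elements of `A` of a given degree and a given parity. -/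
def parityGrA (q : (ℤ × ℤ) × ℤ) : Submodule F2 A where
  carrier := {a | a ∈ A.gr q.1 ∧ A.cent q.2 * a = a}
  add_mem' hx hy := ⟨Submodule.add_mem _ hx.1 hy.1, by rw [mul_add, hx.2, hy.2]⟩
  zero_mem' := ⟨Submodule.zero_mem _, mul_zero _⟩
  smul_mem' r x hx := ⟨Submodule.smul_mem _ r hx.1, by rw [mul_smul_comm, hx.2]⟩

theorem internal_parityGrA : DirectSum.IsInternal parityGrA := internal_parityGr A.self

/-- The grading of `A ⊗ A`. -/
def grAA : ℤ × ℤ → Submodule F2 (A.carrier ⊗[F2] A.carrier) := tensorGr A.gr parityGrA twistDeg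

theorem grAA_mem {p q} {x y : A} (hx : x ∈ A.gr p) (hy : y ∈ parityGrA q) :
    x ⊗ₜ[F2] y ∈ grAA (twistDeg p q) := tensorGr_mem hx hy

/-- The action of `A ⊗ A` on `M₁ ⊗ M₂`. -/
def chiAct (M₁ M₂ : DGMod A) :
    A.carrier ⊗[F2] A.carrier →ₐ[F2] Module.End F2 (M₁.carrier ⊗[F2] M₂.carrier) :=
  (Module.endTensorEndAlgHom (R := F2) (A := F2)).comp
    (Algebra.TensorProduct.map (Algebra.lsmul F2 F2 M₁) (Algebra.lsmul F2 F2 M₂))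

@[simp]
theorem chiAct_tmul (M₁ M₂ : DGMod A) (a b : A) (x : M₁) (y : M₂) :
    chiAct M₁ M₂ (a ⊗ₜ b) (x ⊗ₜ y) = (a • x) ⊗ₜ (b • y) := rfl

theorem chiAct_mem (M₁ M₂ : DGMod A) {p q : ℤ × ℤ} {r : A.carrier ⊗[F2] A.carrier}
    {z : M₁.carrier ⊗[F2] M₂.carrier} (hr : r ∈ grAA p) (hz : z ∈ chiGr M₁ M₂ q) :
    chiAct M₁ M₂ r z ∈ chiGr M₁ M₂ (p + q) := by
  induction hr, hz using Submodule.span_induction₂ with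
  | mem_mem r z hr hz =>
    obtain ⟨i, ⟨j, s⟩, rfl, a, ha, b, hb, rfl⟩ := hr
    obtain ⟨k, ⟨l, t⟩, rfl, x, hx, y, hy, rfl⟩ := hz
    rw [chiAct_tmul]
    by_cases h : s = t
    · subst h
      have h1 : b • y ∈ parityGr M₂ (j + l, s) := by
        refine ⟨M₂.smul_mem hb.1 hy.1, ?_⟩
        rw [← mul_smul, hb.2]
      have h2 := chiGr_mem (M₁.smul_mem ha hx) h1
      have h3 : twistDeg i (j, s) + twistDeg k (l, s) = twistDeg (i + k) (j + l, s) := by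
        ext <;> simp [twistDeg] <;> ring
      rw [h3]
      exact h2
    · have h1 : b • y = 0 := by
        rw [← hy.2, ← hb.2, ← mul_smul]
        have : (A.cent s * b) * A.cent t = 0 := by
          rw [mul_assoc, ← A.cent_comm, ← mul_assoc, A.cent_mul_cent, if_neg h, zero_mul]
        rw [this, zero_smul]
      rw [h1, TensorProduct.tmul_zero]
      exact Submodule.zero_mem _
  | zero_left y hy => rw [map_zero]; exact Submodule.zero_mem _
  | zero_right y hy => rw [map_zero]; exact Submodule.zero_mem _
  | add_left x y z _ _ _ h1 h2 => rw [map_add]; exact Submodule.add_mem _ h1 h2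
  | add_right x y z _ _ _ h1 h2 => rw [map_add]; exact Submodule.add_mem _ h1 h2
  | smul_left r x y _ _ h => rw [map_smul]; exact Submodule.smul_mem _ _ h
  | smul_right r x y _ _ h => rw [map_smul]; exact Submodule.smul_mem _ _ h

theorem grAA_mul_mem {p q : ℤ × ℤ} {x y : A.carrier ⊗[F2] A.carrier} (hx : x ∈ grAA p)
    (hy : y ∈ grAA q) : x * y ∈ grAA (p + q) := by
  have h : ∀ x y : A.carrier ⊗[F2] A.carrier, x * y = chiAct A.self A.self x y := by
    intro x y
    induction x with
    | zero => rw [zero_mul, map_zero]; rfl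
    | add x x' h h' => rw [add_mul, map_add, h, h']; rfl
    | tmul a b =>
      induction y with
      | zero => rw [mul_zero]; exact (map_zero _).symm
      | add y y' h h' => rw [mul_add, h, h']; exact (map_add _ _ _).symm
      | tmul c d => rw [Algebra.TensorProduct.tmul_mul_tmul]; rfl
  rw [h]
  exact chiAct_mem A.self A.self hx hy

/-- The `t`-graded DG algebra `A ⊗ A`: the ordinary tensor product of algebras with trivial
differential and the twisted grading. -/
def AA : DGAlg where
  carrier := A.carrier ⊗[F2] A.carrier
  gr := grAA
  internal := isInternal_tensorGr _ A.internal internal_parityGrA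
  one_mem := by
    have h : (1 : A.carrier ⊗[F2] A.carrier) = ∑ v : Vtx, (1 : A) ⊗ₜ[F2] A.e v := by
      rw [← TensorProduct.tmul_sum, A.sum_e]; rfl
    rw [h]
    refine Submodule.sum_mem _ fun v _ => ?_
    have h1 : A.e v ∈ parityGrA (0, v.parity) :=
      ⟨A.e_mem v, (A.cent_mul_e _ v).trans (if_pos rfl)⟩
    have h2 := grAA_mem A.one_mem h1
    have h3 : twistDeg 0 (0, v.parity) = 0 := by ext <;> simp [twistDeg]
    rwa [h3] at h2
  mul_mem hx hy := grAA_mul_mem hx hy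
  d := 0
  d_mem _ := Submodule.zero_mem _
  d_d _ := rfl
  d_mul x y := by simp

/-- The differential of `M₁ ⊗ M₂`. -/
def chiD (M₁ M₂ : DGMod A) :
    M₁.carrier ⊗[F2] M₂.carrier →ₗ[F2] M₁.carrier ⊗[F2] M₂.carrier :=
  TensorProduct.map M₁.d LinearMap.id + TensorProduct.map LinearMap.id M₂.d

theorem chiD_tmul (M₁ M₂ : DGMod A) (x : M₁) (y : M₂) :
    chiD M₁ M₂ (x ⊗ₜ y) = M₁.d x ⊗ₜ y + x ⊗ₜ M₂.d y := rfl

theorem chiD_act (M₁ M₂ : DGMod A) (r : A.carrier ⊗[F2] A.carrier)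
    (z : M₁.carrier ⊗[F2] M₂.carrier) :
    chiD M₁ M₂ (chiAct M₁ M₂ r z) = chiAct M₁ M₂ r (chiD M₁ M₂ z) := by
  induction r with
  | zero => simp
  | add r s hr hs => simp only [map_add, LinearMap.add_apply, hr, hs]
  | tmul a b =>
    induction z with
    | zero => simp
    | add x y hx hy => simp only [map_add, hx, hy]
    | tmul x y =>
      rw [chiAct_tmul, chiD_tmul, chiD_tmul, map_add, chiAct_tmul, chiAct_tmul, M₁.d_smul,
        M₂.d_smul, A.d_eq, A.d_eq, zero_smul, zero_smul, zero_add, zero_add]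

/-- The DG `A ⊗ A`-module `M₁ ⊗ M₂`. -/
def chiObj (M₁ M₂ : DGMod A) : DGMod AA where
  carrier := M₁.carrier ⊗[F2] M₂.carrier
  module := Module.compHom _ (chiAct M₁ M₂).toRingHom
  tower := by
    let _ : Module AA (M₁.carrier ⊗[F2] M₂.carrier) := Module.compHom _ (chiAct M₁ M₂).toRingHom
    refine ⟨fun c r z => ?_⟩
    change chiAct M₁ M₂ (c • r) z = c • chiAct M₁ M₂ r z
    exact congrArg (fun f => f z) (map_smul (chiAct M₁ M₂) c r)
  gr := chiGr M₁ M₂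
  internal := isInternal_tensorGr _ M₁.internal (internal_parityGr M₂)
  smul_mem hr hz := chiAct_mem M₁ M₂ hr hz
  d := chiD M₁ M₂
  d_mem := by
    intro p z hz
    induction hz using Submodule.span_induction with
    | mem z hz =>
      obtain ⟨i, ⟨j, s⟩, rfl, x, hx, y, hy, rfl⟩ := hz
      have h1 : M₂.d y ∈ parityGr M₂ (j + (1, 0), s) := by
        refine ⟨M₂.d_mem hy.1, ?_⟩
        have := M₂.d_smul (A.cent s) y
        rw [hy.2, A.d_eq, zero_smul, zero_add] at this
        exact this.symm
      refine Submodule.add_mem _ ?_ ?_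
      · have := chiGr_mem (M₁.d_mem hx) hy
        have e : twistDeg (i + (1, 0)) (j, s) = twistDeg i (j, s) + (1, 0) := by
          ext <;> simp [twistDeg]; ring
        rwa [e] at this
      · have := chiGr_mem hx h1
        have e : twistDeg i (j + (1, 0), s) = twistDeg i (j, s) + (1, 0) := by
          ext <;> simp [twistDeg]; ring
        rwa [e] at this
    | zero => rw [map_zero]; exact Submodule.zero_mem _
    | add x y _ _ hx hy => rw [map_add]; exact Submodule.add_mem _ hx hy
    | smul a x _ hx => rw [map_smul]; exact Submodule.smul_mem _ _ hx
  d_d z := by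
    induction z with
    | zero => simp
    | add x y hx hy => rw [map_add, map_add, hx, hy, add_zero]
    | tmul x y => simp [chiD_tmul, M₁.d_d, M₂.d_d, ZModModule.add_self]
  d_smul r z := by
    change chiD M₁ M₂ (chiAct M₁ M₂ r z) = chiAct M₁ M₂ 0 z + chiAct M₁ M₂ r (chiD M₁ M₂ z)
    rw [map_zero, LinearMap.zero_apply, zero_add]
    exact chiD_act M₁ M₂ r z

/-- The underlying linear map of the tensor product of two morphisms. -/
def chiPre {M₁ M₂ M₁' M₂' : DGMod A} (u : M₁ ⟶ M₁') (v : M₂ ⟶ M₂') :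
    M₁.carrier ⊗[F2] M₂.carrier →ₗ[F2] M₁'.carrier ⊗[F2] M₂'.carrier :=
  TensorProduct.map (u.f.restrictScalars F2) (v.f.restrictScalars F2)

theorem chiPre_tmul {M₁ M₂ M₁' M₂' : DGMod A} (u : M₁ ⟶ M₁') (v : M₂ ⟶ M₂') (x : M₁) (y : M₂) :
    chiPre u v (x ⊗ₜ y) = u.f x ⊗ₜ v.f y := rfl

theorem chiPre_act {M₁ M₂ M₁' M₂' : DGMod A} (u : M₁ ⟶ M₁') (v : M₂ ⟶ M₂')
    (r : A.carrier ⊗[F2] A.carrier) (z : M₁.carrier ⊗[F2] M₂.carrier) :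
    chiPre u v (chiAct M₁ M₂ r z) = chiAct M₁' M₂' r (chiPre u v z) := by
  induction r with
  | zero => simp
  | add r s hr hs => simp only [map_add, LinearMap.add_apply, hr, hs]
  | tmul a b =>
    induction z with
    | zero => simp
    | add x y hx hy => simp only [map_add, hx, hy]
    | tmul x y => rw [chiAct_tmul, chiPre_tmul, chiPre_tmul, chiAct_tmul, map_smul, map_smul]

theorem chiPre_mem {M₁ M₂ M₁' M₂' : DGMod A} (u : M₁ ⟶ M₁') (v : M₂ ⟶ M₂') {p : ℤ × ℤ}
    {z : M₁.carrier ⊗[F2] M₂.carrier} (hz : z ∈ chiGr M₁ M₂ p) :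
    chiPre u v z ∈ chiGr M₁' M₂' p := by
  induction hz using Submodule.span_induction with
  | mem z hz =>
    obtain ⟨i, ⟨j, s⟩, rfl, x, hx, y, hy, rfl⟩ := hz
    refine chiGr_mem (u.map_mem hx) (q := (j, s)) ⟨v.map_mem hy.1, ?_⟩
    exact (v.f.map_smul _ _).symm.trans (congrArg v.f hy.2)
  | zero => rw [map_zero]; exact Submodule.zero_mem _
  | add x y _ _ hx hy => rw [map_add]; exact Submodule.add_mem _ hx hy
  | smul a x _ hx => rw [map_smul]; exact Submodule.smul_mem _ _ hx

theorem chiPre_d {M₁ M₂ M₁' M₂' : DGMod A} (u : M₁ ⟶ M₁') (v : M₂ ⟶ M₂')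
    (z : M₁.carrier ⊗[F2] M₂.carrier) :
    chiPre u v (chiD M₁ M₂ z) = chiD M₁' M₂' (chiPre u v z) := by
  induction z with
  | zero => simp
  | add x y hx hy => simp only [map_add, hx, hy]
  | tmul x y => simp only [chiD_tmul, chiPre_tmul, map_add, u.comm, v.comm]

/-- The map `M₁ ⊗ M₂ ⟶ M₁' ⊗ M₂'` induced by two morphisms. -/
def chiMap {M₁ M₂ M₁' M₂' : DGMod A} (u : M₁ ⟶ M₁') (v : M₂ ⟶ M₂') :
    chiObj M₁ M₂ ⟶ chiObj M₁' M₂' where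
  f :=
    { toFun := chiPre u v
      map_add' := map_add _
      map_smul' := chiPre_act u v }
  map_mem := chiPre_mem u v
  comm := chiPre_d u v

/-- The external tensor product functor `χ`. -/
def chi : DGMod A × DGMod A ⥤ DGMod AA where
  obj M := chiObj M.1 M.2
  map u := chiMap u.1 u.2
  map_id M := DGMod.hom_ext fun z =>
    LinearMap.congr_fun (TensorProduct.map_id (R := F2) (M := M.1.carrier) (N := M.2.carrier)) z
  map_comp u v := DGMod.hom_ext fun z => LinearMap.congr_fun
    (TensorProduct.map_comp (v.1.f.restrictScalars F2) (v.2.f.restrictScalars F2)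
      (u.1.f.restrictScalars F2) (u.2.f.restrictScalars F2)) z

/-! ### The bimodule `N` -/

namespace A

/-- The generators of `A`. -/
def gen (x : AGen) : A := AAlg.gen x
/-- The arrow `ρ(I, EF)`. -/
def rIEF : A := AAlg.rIEF
/-- The arrow `ρ(EF, I)`. -/
def rEFI : A := AAlg.rEFI

theorem rIEF_mem : rIEF ∈ A.gr 0 := AAlg.rIEF_mem
theorem rEFI_mem : rEFI ∈ A.gr (1, 1) := AAlg.rEFI_mem
theorem loop_mem : rEFI * rIEF ∈ A.gr (1, 1) := by
  simpa using A.mul_mem rEFI_mem rIEF_mem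
@[simp] theorem e_mul_self (v : Vtx) : e v * e v = e v := AAlg.e_mul_self v
@[simp] theorem e_mul_rIEF : e .I * rIEF = rIEF := AAlg.e_mul_rIEF
@[simp] theorem rIEF_mul_e : rIEF * e .EF = rIEF := AAlg.rIEF_mul_e
@[simp] theorem e_mul_rEFI : e .EF * rEFI = rEFI := AAlg.e_mul_rEFI
@[simp] theorem rEFI_mul_e : rEFI * e .I = rEFI := AAlg.rEFI_mul_e
@[simp] theorem rIEF_mul_rEFI : rIEF * rEFI = 0 := AAlg.rIEF_mul_rEFI
@[simp] theorem rIEF_mul_rEFI_mul (x : A) : rIEF * (rEFI * x) = 0 := by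
  rw [← mul_assoc, rIEF_mul_rEFI, zero_mul]
@[simp] theorem e_mul_rEFI_mul (x : A) : e .EF * (rEFI * x) = rEFI * x := by
  rw [← mul_assoc, e_mul_rEFI]

theorem gr_induction {motive : ℤ × ℤ → A → Prop}
    (gen : ∀ x, motive (AAlg.genDeg x) (gen x))
    (mul : ∀ p q x y, motive p x → motive q y → motive (p + q) (x * y))
    (zero : ∀ p, motive p 0) (add : ∀ p x y, motive p x → motive p y → motive p (x + y))
    (smul : ∀ p (r : F2) x, motive p x → motive p (r • x)) {p : ℤ × ℤ} {x : A}
    (hx : x ∈ A.gr p) : motive p x := by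
  refine Submodule.span_induction (p := fun x _ => motive p x) ?_ (zero p)
    (fun x y _ _ hx hy => add p x y hx hy) (fun r x _ hx => smul p r x hx) hx
  intro y hy
  clear hx
  induction hy with
  | gen x => exact gen x
  | mul _ _ h h' => exact mul _ _ _ _ h h'

end A

/-- The generators `m_{γ₁, γ₂}(γ)` of the left `A`-module `N`. The constructor `X_Y` stands for
`m_{X, Y}`, a prime for `m'_{X, Y}`, and `F_E₁, F_E₂, F_E₃` for `m_{F,E}(I)`, `m_{F,E}(EF)`,
`m'_{F,E}(I)`. -/
inductive Gen
  | I_I | I_F | I_EF | I_E | F_I | EF_I | E_I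
  | E_F | EF_E | EF_E' | F_EF | F_EF' | EF_EF | EF_EF' | F_E₁ | F_E₂ | F_E₃
  deriving DecidableEq

namespace Gen

instance : Fintype Gen :=
  ⟨{.I_I, .I_F, .I_EF, .I_E, .F_I, .EF_I, .E_I, .E_F, .EF_E, .EF_E', .F_EF, .F_EF', .EF_EF,
    .EF_EF', .F_E₁, .F_E₂, .F_E₃}, fun g => by cases g <;> decide⟩

/-- The first index `γ₁` of a generator of `N(γ₁, γ₂)`. -/
def left : Gen → Vtx
  | I_I | I_F | I_EF | I_E => .I
  | F_I | F_EF | F_EF' | F_E₁ | F_E₂ | F_E₃ => .F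
  | EF_I | EF_E | EF_E' | EF_EF | EF_EF' => .EF
  | E_I | E_F => .E

/-- The second index `γ₂` of a generator of `N(γ₁, γ₂)`. -/
def right : Gen → Vtx
  | I_I | F_I | EF_I | E_I => .I
  | I_F | E_F => .F
  | I_EF | F_EF | F_EF' | EF_EF | EF_EF' => .EF
  | I_E | EF_E | EF_E' | F_E₁ | F_E₂ | F_E₃ => .E

/-- The vertex `γ` such that the generator spans a shifted copy of `P(γ)`. -/
def typ : Gen → Vtx
  | I_I | F_E₁ | F_E₃ => .I
  | I_F | F_I | F_EF | F_EF' => .F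
  | I_E | E_I | EF_E | EF_E' => .E
  | I_EF | EF_I | E_F | EF_EF | EF_EF' | F_E₂ => .EF

/-- The degree of a generator; the generator of `P(γ){b}[a]` has degree `(-a, -b)`. -/
def deg : Gen → ℤ × ℤ
  | EF_E' => (1, -1)
  | F_EF' => (-1, -1)
  | EF_EF' => (-1, -1)
  | F_E₂ => (1, 0)
  | F_E₃ => (1, -1)
  | _ => 0

end Gen

namespace NMod

/-- Formal combinations `∑ a_g m_g`. -/
abbrev Free : Type := Gen → A.carrier

/-- The vector `a m_g`. -/
abbrev single (g : Gen) (a : A) : Free := Pi.single g a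

/-- The differential on generators. -/
def dGen : Gen → Free
  | .F_E₁ => single .F_E₂ A.rIEF
  | .F_E₂ => single .F_E₃ A.rEFI
  | _ => 0

/-- The right multiplication of the generators of `N` by `x ⊗ 1`, for `x` a generator of `A`. -/
def mulL : AGen → Gen → Free
  | .e v, g => if g.left = v then single g 1 else 0
  | .rEFI, .EF_I => single .I_I A.rEFI
  | .rEFI, .EF_EF' => single .I_EF 1
  | .rEFI, .EF_E' => single .I_E 1
  | .rIEF, .I_I => single .EF_I A.rIEF
  | .rIEF, .I_EF => single .EF_EF 1
  | .rIEF, .I_E => single .EF_E 1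
  | _, _ => 0

/-- The right multiplication of the generators of `N` by `1 ⊗ x`, for `x` a generator of `A`. -/
def mulR : AGen → Gen → Free
  | .e v, g => if g.right = v then single g 1 else 0
  | .rEFI, .I_EF => single .I_I A.rEFI
  | .rEFI, .F_EF' => single .F_I 1
  | .rEFI, .EF_EF => single .EF_I (A.rEFI * A.rIEF)
  | .rEFI, .EF_EF' => single .EF_I 1
  | .rIEF, .I_I => single .I_EF A.rIEF
  | .rIEF, .F_I => single .F_EF 1
  | .rIEF, .EF_I => single .EF_EF 1 + single .EF_EF' (A.rEFI * A.rIEF)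
  | _, _ => 0

/-- The `A`-linear endomorphism with prescribed values on the generators. -/
def act (M : Gen → Free) : Free →ₗ[A] Free := Fintype.linearCombination A M

@[simp] theorem smul_single (a b : A) (g : Gen) :
    a • (Pi.single g b : Free) = Pi.single g (a * b) := by
  rw [← Pi.single_smul, smul_eq_mul]

@[simp] theorem act_single (M : Gen → Free) (g : Gen) (a : A) :
    act M (single g a) = a • M g := Fintype.linearCombination_apply_single ..

theorem act_apply (M : Gen → Free) (v : Free) (g' : Gen) :
    act M v g' = ∑ g, v g * M g g' := by
  simp [act, Fintype.linearCombination_apply, Finset.sum_apply]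

theorem act_ext {f f' : Free →ₗ[A] Free} (h : ∀ g, f (single g 1) = f' (single g 1)) : f = f' :=
  (Pi.basisFun A Gen).ext fun g => by simpa using h g

/-- The underlying left `A`-module of `N`: the combinations `∑ a_g m_g` with
`a_g ∈ A e(γ)`, where `m_g` generates a copy of `P(γ)`. -/
def carrier : Submodule A Free where
  carrier := {v | ∀ g, v g * A.e g.typ = v g}
  add_mem' hx hy g := by rw [Pi.add_apply, add_mul, hx g, hy g]
  zero_mem' g := zero_mul _
  smul_mem' r x hx g := by rw [Pi.smul_apply, smul_mul_assoc, hx g]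

/-- Compatibility of the value on a generator of a copy of `P(t)`. -/
def Stab (t : Vtx) (w : Free) : Prop := ∀ g, A.e t * w g * A.e g.typ = A.e t * w g

theorem Stab.zero (t : Vtx) : Stab t 0 := fun g => by simp
theorem Stab.add {t : Vtx} {w w' : Free} (h : Stab t w) (h' : Stab t w') : Stab t (w + w') :=
  fun g => by rw [Pi.add_apply, mul_add, add_mul, h, h']
theorem Stab.single {t : Vtx} {g : Gen} {a : A} (h : A.e t * a * A.e g.typ = A.e t * a) :
    Stab t (single g a) := fun g' => by
  by_cases hg : g' = g
  · subst hg; simpa using h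
  · simp [hg]

theorem act_mem {M : Gen → Free} (hM : ∀ g, Stab g.typ (M g)) {v : Free} (hv : v ∈ carrier) :
    act M v ∈ carrier := fun g' => by
  rw [act_apply, Finset.sum_mul]
  refine Finset.sum_congr rfl fun g _ => ?_
  rw [← hv g, mul_assoc (v g), mul_assoc (v g), hM g g']

/-- The endomorphism of the left module `N` with prescribed values on the generators. -/
def actN (M : Gen → Free) (hM : ∀ g, Stab g.typ (M g)) : Module.End A carrier :=
  (act M).restrict fun _ hv => act_mem hM hv

theorem stab_dGen (g : Gen) : Stab g.typ (dGen g) := by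
  cases g <;> first | exact Stab.zero _ | exact Stab.single (by simp [Gen.typ])

theorem stab_mulL (x : AGen) (g : Gen) : Stab g.typ (mulL x g) := by
  rcases x with v | _ | _
  · simp only [mulL]
    split_ifs
    · exact Stab.single (by simp)
    · exact Stab.zero _
  all_goals
    cases g <;> first | exact Stab.zero _ | exact Stab.single (by simp [Gen.typ])

theorem stab_mulR (x : AGen) (g : Gen) : Stab g.typ (mulR x g) := by
  rcases x with v | _ | _
  · simp only [mulR]
    split_ifs
    · exact Stab.single (by simp)
    · exact Stab.zero _
  all_goals
    cases g <;> first
      | exact Stab.zero _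
      | exact Stab.single (by simp [Gen.typ, mul_assoc])
      | exact Stab.add (Stab.single (by simp [Gen.typ])) (Stab.single (by simp [Gen.typ, mul_assoc]))

/-- The representation `A → End(N)ᵒᵖ` determined by the values on generators. -/
def rep (M : AGen → Gen → Free) (hM : ∀ x g, Stab g.typ (M x g))
    (idem : ∀ v g, act (M (.e v)) (M (.e v) g) = M (.e v) g)
    (orth : ∀ v w, v ≠ w → ∀ g, act (M (.e w)) (M (.e v) g) = 0)
    (unit : ∀ g, ∑ v, M (.e v) g = single g 1)
    (h1 : ∀ g, act (M .rIEF) (M (.e .I) g) = M .rIEF g)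
    (h2 : ∀ g, act (M (.e .EF)) (M .rIEF g) = M .rIEF g)
    (h3 : ∀ g, act (M .rEFI) (M (.e .EF) g) = M .rEFI g)
    (h4 : ∀ g, act (M (.e .I)) (M .rEFI g) = M .rEFI g)
    (h5 : ∀ g, act (M .rEFI) (M .rIEF g) = 0) :
    A.carrier →ₐ[F2] (Module.End A carrier)ᵐᵒᵖ :=
  have key : ∀ (x y : AGen) (f : Free →ₗ[A] Free),
      (∀ g, act (M y) (M x g) = f (single g 1)) →
      ∀ v, act (M y) (act (M x) v) = f v := fun x y f h v =>
    LinearMap.congr_fun (act_ext (f := (act (M y)).comp (act (M x))) (f' := f)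
      (fun g => by simpa using h g)) v
  AAlg.lift (fun x => MulOpposite.op (actN (M x) (hM x)))
    (fun v => MulOpposite.unop_injective <| LinearMap.ext fun x => Subtype.ext <|
      key (.e v) (.e v) (act (M (.e v))) (fun g => by simpa using idem v g) x.1)
    (fun v w h => MulOpposite.unop_injective <| LinearMap.ext fun x => Subtype.ext <|
      key (.e v) (.e w) 0 (fun g => by simpa using orth v w h g) x.1)
    (MulOpposite.unop_injective <| LinearMap.ext fun x => Subtype.ext <| by
      have h : ∑ v, act (M (.e v)) = LinearMap.id := act_ext fun g => by
        simpa [LinearMap.sum_apply] using unit g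
      have h' := LinearMap.congr_fun h x.1
      rw [LinearMap.sum_apply] at h'
      have h2 : MulOpposite.unop (∑ v, MulOpposite.op (actN (M (.e v)) (hM (.e v)))) =
          ∑ v, actN (M (.e v)) (hM (.e v)) :=
        Finset.unop_sum _ _
      rw [h2, LinearMap.sum_apply, ← Submodule.coe_subtype, map_sum]
      exact h')
    (MulOpposite.unop_injective <| LinearMap.ext fun x => Subtype.ext <|
      key (.e .I) .rIEF (act (M .rIEF)) (fun g => by simpa using h1 g) x.1)
    (MulOpposite.unop_injective <| LinearMap.ext fun x => Subtype.ext <|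
      key .rIEF (.e .EF) (act (M .rIEF)) (fun g => by simpa using h2 g) x.1)
    (MulOpposite.unop_injective <| LinearMap.ext fun x => Subtype.ext <|
      key (.e .EF) .rEFI (act (M .rEFI)) (fun g => by simpa using h3 g) x.1)
    (MulOpposite.unop_injective <| LinearMap.ext fun x => Subtype.ext <|
      key .rEFI (.e .I) (act (M .rEFI)) (fun g => by simpa using h4 g) x.1)
    (MulOpposite.unop_injective <| LinearMap.ext fun x => Subtype.ext <|
      key .rIEF .rEFI 0 (fun g => by simpa using h5 g) x.1)

theorem rep_gen (M : AGen → Gen → Free) (hM idem orth unit h1 h2 h3 h4 h5) (x : AGen) :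
    rep M hM idem orth unit h1 h2 h3 h4 h5 (A.gen x) = MulOpposite.op (actN (M x) (hM x)) :=
  AAlg.lift_gen ..

/-- The right action of `A ⊗ 1` on `N`. -/
def repL : A.carrier →ₐ[F2] (Module.End A carrier)ᵐᵒᵖ :=
  rep mulL stab_mulL
    (fun v g => by simp only [mulL]; split_ifs with h <;> simp [mulL, h])
    (fun v w h g => by simp only [mulL]; split_ifs with h' <;> simp [mulL, h', h])
    (fun g => by simp [mulL])
    (fun g => by cases g <;> simp [mulL, Gen.left])
    (fun g => by cases g <;> simp [mulL, Gen.left])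
    (fun g => by cases g <;> simp [mulL, Gen.left])
    (fun g => by cases g <;> simp [mulL, Gen.left])
    (fun g => by cases g <;> simp [mulL])

/-- The right action of `1 ⊗ A` on `N`. -/
def repR : A.carrier →ₐ[F2] (Module.End A carrier)ᵐᵒᵖ :=
  rep mulR stab_mulR
    (fun v g => by simp only [mulR]; split_ifs with h <;> simp [mulR, h])
    (fun v w h g => by simp only [mulR]; split_ifs with h' <;> simp [mulR, h', h])
    (fun g => by simp [mulR])
    (fun g => by cases g <;> simp [mulR, Gen.right])
    (fun g => by cases g <;> simp [mulR, Gen.right])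
    (fun g => by cases g <;> simp [mulR, Gen.right])
    (fun g => by cases g <;> simp [mulR, Gen.right])
    (fun g => by cases g <;> simp [mulR, ZModModule.add_self])

theorem commute_gen (x y : AGen) (g : Gen) :
    act (mulR y) (mulL x g) = act (mulL x) (mulR y g) := by
  rcases x with v | _ | _ <;> rcases y with w | _ | _
  · by_cases h : g.left = v <;> by_cases h' : g.right = w <;> simp [mulL, mulR, h, h']
  · cases g <;> cases v <;> simp [mulL, mulR, Gen.left]
  · cases g <;> cases v <;> simp [mulL, mulR, Gen.left]
  · cases g <;> cases w <;> simp [mulL, mulR, Gen.right]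
  · cases g <;> simp [mulL, mulR]
  · cases g <;> simp [mulL, mulR]
  · cases g <;> cases w <;> simp [mulL, mulR, Gen.right]
  · cases g <;> simp [mulL, mulR]
  · cases g <;> simp [mulL, mulR, mul_assoc]

end NMod

namespace A

theorem mem_subalgebra (S : Subalgebra F2 A.carrier) (h : ∀ x, gen x ∈ S) (a : A) : a ∈ S :=
  AAlg.mem_subalgebra S h a
theorem cent_mem (p : ℤ) : cent p ∈ A.gr 0 := AAlg.cent_mem p

end A

namespace NMod

theorem repL_gen (x : AGen) :
    repL (A.gen x) = MulOpposite.op (actN (mulL x) (stab_mulL x)) := rep_gen ..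

theorem repR_gen (x : AGen) :
    repR (A.gen x) = MulOpposite.op (actN (mulR x) (stab_mulR x)) := rep_gen ..

theorem commute_rep (a b : A) : Commute (repL a) (repR b) := by
  have h0 : ∀ x y : AGen, Commute (repL (A.gen x)) (repR (A.gen y)) := by
    intro x y
    rw [repL_gen, repR_gen]
    refine MulOpposite.unop_injective (LinearMap.ext fun v => Subtype.ext ?_)
    exact LinearMap.congr_fun (act_ext (f := (act (mulR y)).comp (act (mulL x)))
      (f' := (act (mulL x)).comp (act (mulR y))) fun g => by
        simpa using commute_gen x y g) v.1
  have h1 : ∀ (x : AGen) (b : A), Commute (repL (A.gen x)) (repR b) := by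
    intro x b
    have : b ∈ (Subalgebra.centralizer F2 {repL (A.gen x)}).comap repR :=
      A.mem_subalgebra ((Subalgebra.centralizer F2 {repL (A.gen x)}).comap repR)
        (fun y => by
          rw [Subalgebra.mem_comap, Subalgebra.mem_centralizer_iff]
          rintro _ rfl
          exact h0 x y) b
    rw [Subalgebra.mem_comap, Subalgebra.mem_centralizer_iff] at this
    exact this _ rfl
  have : a ∈ (Subalgebra.centralizer F2 {repR b}).comap repL :=
    A.mem_subalgebra ((Subalgebra.centralizer F2 {repR b}).comap repL)
      (fun x => by
        rw [Subalgebra.mem_comap, Subalgebra.mem_centralizer_iff]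
        rintro _ rfl
        exact (h1 x b).symm) a
  rw [Subalgebra.mem_comap, Subalgebra.mem_centralizer_iff] at this
  exact (this _ rfl).symm

/-- The right action of `A ⊗ A` on `N`. -/
def repN : AA.carrier →ₐ[F2] (Module.End A carrier)ᵐᵒᵖ :=
  Algebra.TensorProduct.lift repL repR commute_rep

theorem repN_tmul (a b : A) : repN ((a ⊗ₜ[F2] b : A.carrier ⊗[F2] A.carrier) : AA.carrier) =
    repL a * repR b := Algebra.TensorProduct.lift_tmul ..

instance : Module (MulOpposite AA.carrier) carrier where
  smul s v := (repN s.unop).unop v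
  one_smul v := by
    change (repN 1).unop v = v
    rw [map_one]; rfl
  mul_smul s t v := by
    change (repN (t.unop * s.unop)).unop v = (repN s.unop).unop ((repN t.unop).unop v)
    rw [map_mul]; rfl
  smul_zero s := map_zero (repN s.unop).unop
  smul_add s := map_add (repN s.unop).unop
  add_smul s t v := by
    change (repN (s.unop + t.unop)).unop v = (repN s.unop).unop v + (repN t.unop).unop v
    rw [map_add]; rfl
  zero_smul v := by
    change (repN 0).unop v = 0
    rw [map_zero]; rfl

theorem op_smul_def (s : AA) (v : carrier) : MulOpposite.op s • v = (repN s).unop v := rfl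

/-- The grading on formal combinations, `a m_g` having degree `deg a + deg m_g`. -/
def freeGr (p : ℤ × ℤ) : Submodule F2 Free :=
  Submodule.pi Set.univ fun g => A.gr (p - g.deg)

theorem internal_freeGr : DirectSum.IsInternal freeGr :=
  isInternal_pi (gr := fun (g : Gen) p => A.gr (p - g.deg))
    fun g => isInternal_reindex A.internal (Equiv.subRight g.deg)

/-- The grading on `N`. -/
def gr (p : ℤ × ℤ) : Submodule F2 carrier :=
  (freeGr p).comap (carrier.subtype.restrictScalars F2)

theorem mem_gr {p : ℤ × ℤ} {v : carrier} : v ∈ gr p ↔ ∀ g, v.1 g ∈ A.gr (p - g.deg) :=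
  ⟨fun h g => h g trivial, fun h g _ => h g⟩

/-- The projection of formal combinations to `N`. -/
def retract : Free →ₗ[F2] Free where
  toFun v g := v g * A.e g.typ
  map_add' v w := by ext g; simp [add_mul]
  map_smul' r v := by ext g; simp

theorem internal_gr : DirectSum.IsInternal gr := by
  refine isInternal_sub internal_freeGr _ Subtype.val_injective ?_
  intro D hD v p
  have h := coact_comm internal_freeGr.submodule_iSup_eq_top hD retract
    (fun p v hv g _ => by
      change v g * A.e g.typ ∈ _
      simpa using A.mul_mem (hv g trivial) (A.e_mem g.typ)) v.1 p
  have hv : retract v.1 = v.1 := funext v.2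
  rw [hv] at h
  refine ⟨⟨D v.1 p, fun g => ?_⟩, rfl⟩
  exact (congrFun h g).symm

theorem act_mem_freeGr {M : Gen → Free} {v : Free} {p δ : ℤ × ℤ}
    (hv : ∀ g, v g ∈ A.gr (p - g.deg))
    (hM : ∀ g, v g ≠ 0 → ∀ g', M g g' ∈ A.gr (g.deg + δ - g'.deg)) (g' : Gen) :
    act M v g' ∈ A.gr (p + δ - g'.deg) := by
  rw [act_apply]
  refine Submodule.sum_mem _ fun g _ => ?_
  by_cases h : v g = 0
  · rw [h, zero_mul]; exact Submodule.zero_mem _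
  · have := A.mul_mem (hv g) (hM g h g')
    rwa [show p - g.deg + (g.deg + δ - g'.deg) = p + δ - g'.deg by abel] at this

theorem single_mem {p : ℤ × ℤ} {g : Gen} {a : A} (ha : a ∈ A.gr (p - g.deg)) (g' : Gen) :
    (Pi.single g a : Free) g' ∈ A.gr (p - g'.deg) := by
  by_cases h : g' = g
  · subst h; simpa using ha
  · simp [h]

theorem single_mem' {p q : ℤ × ℤ} {g : Gen} {a : A} (ha : a ∈ A.gr q) (h : q = p - g.deg)
    (g' : Gen) : (Pi.single g a : Free) g' ∈ A.gr (p - g'.deg) :=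
  single_mem (h ▸ ha) g'

theorem dGen_mem (g g' : Gen) : dGen g g' ∈ A.gr (g.deg + (1, 0) - g'.deg) := by
  cases g <;> first
    | exact Submodule.zero_mem _
    | exact single_mem' A.rIEF_mem (by decide) g'
    | exact single_mem' A.rEFI_mem (by decide) g'

theorem mulL_mem (x : AGen) (g g' : Gen) : mulL x g g' ∈
    A.gr (g.deg + (AAlg.genDeg x + (2 * (AAlg.genDeg x).2 * g.right.parity, 0)) - g'.deg) := by
  rcases x with v | _ | _
  · simp only [mulL]
    split_ifs
    · exact single_mem' A.one_mem (by ext <;> simp [AAlg.genDeg]) g'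
    · exact Submodule.zero_mem _
  all_goals
    cases g <;> first
      | exact Submodule.zero_mem _
      | exact single_mem' A.one_mem (by decide) g'
      | exact single_mem' A.rIEF_mem (by decide) g'
      | exact single_mem' A.rEFI_mem (by decide) g'

theorem mulR_mem (x : AGen) (g g' : Gen) : mulR x g g' ∈
    A.gr (g.deg + AAlg.genDeg x - g'.deg) := by
  rcases x with v | _ | _
  · simp only [mulR]
    split_ifs
    · exact single_mem' A.one_mem (by ext <;> simp [AAlg.genDeg]) g'
    · exact Submodule.zero_mem _
  · cases g <;> first
      | exact Submodule.zero_mem _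
      | exact single_mem' A.one_mem (by decide) g'
      | exact single_mem' A.rIEF_mem (by decide) g'
      | exact Submodule.add_mem _ (single_mem' A.one_mem (by decide) g')
          (single_mem' A.loop_mem (by decide) g')
  · cases g <;> first
      | exact Submodule.zero_mem _
      | exact single_mem' A.one_mem (by decide) g'
      | exact single_mem' A.rEFI_mem (by decide) g'
      | exact single_mem' A.loop_mem (by decide) g'

theorem mulL_right (x : AGen) (g g' : Gen) (h : g'.right ≠ g.right) : mulL x g g' = 0 := by
  rcases x with v | _ | _
  · simp only [mulL]
    split_ifs
    · exact Pi.single_eq_of_ne (by rintro rfl; exact h rfl) _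
    · rfl
  all_goals
    cases g <;> first
      | rfl
      | exact Pi.single_eq_of_ne (by rintro rfl; exact h rfl) _

/-- The elements of `N` supported on generators whose second index has parity `s`. -/
def Supp (s : ℤ) (v : carrier) : Prop := ∀ g : Gen, g.right.parity ≠ s → v.1 g = 0

theorem repL_mem {p : ℤ × ℤ} {a : A} (ha : a ∈ A.gr p) : ∀ (q : ℤ × ℤ) (s : ℤ) (v : carrier),
    v ∈ gr q → Supp s v →
      (repL a).unop v ∈ gr (q + (p + (2 * p.2 * s, 0))) ∧ Supp s ((repL a).unop v) := by
  refine A.gr_induction (motive := fun p a => ∀ (q : ℤ × ℤ) (s : ℤ) (v : carrier),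
    v ∈ gr q → Supp s v →
      (repL a).unop v ∈ gr (q + (p + (2 * p.2 * s, 0))) ∧ Supp s ((repL a).unop v))
    ?_ ?_ ?_ ?_ ?_ ha
  · intro x q s v hv hs
    rw [repL_gen]
    refine ⟨mem_gr.2 (act_mem_freeGr (mem_gr.1 hv) fun g hg g' => ?_), fun g' hg' => ?_⟩
    · have : g.right.parity = s := by
        by_contra h
        exact hg (hs g h)
      rw [← this]
      exact mulL_mem x g g'
    · change act (mulL x) v.1 g' = 0
      rw [act_apply]
      refine Finset.sum_eq_zero fun g _ => ?_
      by_cases h : g.right.parity = s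
      · rw [mulL_right, mul_zero]
        intro h'
        rw [h'] at hg'
        exact hg' h
      · rw [hs g h, zero_mul]
  · intro p p' x y hx hy q s v hv hs
    obtain ⟨h1, h2⟩ := hx q s v hv hs
    obtain ⟨h3, h4⟩ := hy _ s _ h1 h2
    rw [map_mul]
    refine ⟨?_, h4⟩
    have e : q + (p + (2 * p.2 * s, 0)) + (p' + (2 * p'.2 * s, 0)) =
        q + (p + p' + (2 * (p + p').2 * s, 0)) := by
      ext <;> simp <;> ring
    rw [← e]
    exact h3
  · intro p q s v _ _
    rw [map_zero]
    exact ⟨Submodule.zero_mem _, fun _ _ => rfl⟩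
  · intro p x y hx hy q s v hv hs
    obtain ⟨h1, h2⟩ := hx q s v hv hs
    obtain ⟨h3, h4⟩ := hy q s v hv hs
    rw [map_add]
    refine ⟨Submodule.add_mem _ h1 h3, fun g hg => ?_⟩
    exact (congrArg₂ (· + ·) (h2 g hg) (h4 g hg)).trans (add_zero _)
  · intro p r x hx q s v hv hs
    obtain ⟨h1, h2⟩ := hx q s v hv hs
    rw [map_smul]
    refine ⟨Submodule.smul_mem _ r h1, fun g hg => ?_⟩
    exact (congrArg (r • ·) (h2 g hg)).trans (smul_zero _)

theorem repR_mem {p : ℤ × ℤ} {a : A} (ha : a ∈ A.gr p) : ∀ (q : ℤ × ℤ) (v : carrier),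
    v ∈ gr q → (repR a).unop v ∈ gr (q + p) := by
  refine A.gr_induction (motive := fun p a => ∀ (q : ℤ × ℤ) (v : carrier),
    v ∈ gr q → (repR a).unop v ∈ gr (q + p)) ?_ ?_ ?_ ?_ ?_ ha
  · intro x q v hv
    rw [repR_gen]
    exact mem_gr.2 (act_mem_freeGr (mem_gr.1 hv) fun g _ g' => mulR_mem x g g')
  · intro p p' x y hx hy q v hv
    rw [map_mul, ← add_assoc]
    exact hy _ _ (hx _ _ hv)
  · intro p q v _
    rw [map_zero]
    exact Submodule.zero_mem _
  · intro p x y hx hy q v hv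
    rw [map_add]
    exact Submodule.add_mem _ (hx _ _ hv) (hy _ _ hv)
  · intro p r x hx q v hv
    rw [map_smul]
    exact Submodule.smul_mem _ r (hx _ _ hv)

theorem supp_cent (s : ℤ) (v : carrier) : Supp s ((repR (A.cent s)).unop v) := by
  intro g hg
  have h : repR (A.cent s) = ∑ w : Vtx, if w.parity = s then repR (A.e w) else 0 := by
    rw [A.cent_eq, map_sum]
    exact Finset.sum_congr rfl fun w _ => by split_ifs <;> simp
  rw [h, Finset.unop_sum, LinearMap.sum_apply, ← Submodule.coe_subtype, map_sum,
    Finset.sum_apply]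
  refine Finset.sum_eq_zero fun w _ => ?_
  split_ifs with hw
  · have e : repR (A.e w) = MulOpposite.op (actN (mulR (.e w)) (stab_mulR _)) := repR_gen (.e w)
    rw [e]
    change act (mulR (.e w)) v.1 g = 0
    rw [act_apply]
    refine Finset.sum_eq_zero fun g' _ => ?_
    simp only [mulR]
    split_ifs with h'
    · have h0 : (single g' 1 : Free) g = 0 := Pi.single_eq_of_ne (by
        rintro rfl
        rw [h'] at hg
        exact hg hw) _
      rw [h0, mul_zero]
    · exact mul_zero _
  · rfl

theorem repN_mem {p q : ℤ × ℤ} {r : A.carrier ⊗[F2] A.carrier} {v : carrier} (hv : v ∈ gr p)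
    (hr : r ∈ grAA q) : (repN r).unop v ∈ gr (p + q) := by
  induction hr using Submodule.span_induction with
  | mem r hr =>
    obtain ⟨i, ⟨j, s⟩, rfl, a, ha, b, hb, rfl⟩ := hr
    have h1 : repN ((a ⊗ₜ[F2] b : A.carrier ⊗[F2] A.carrier) : AA.carrier) =
        repR (A.cent s) * repL a * repR b := by
      rw [repN_tmul, ← (commute_rep a (A.cent s)).eq, mul_assoc, ← map_mul]
      exact congrArg (fun x => repL a * repR x) hb.2.symm
    rw [h1]
    have h2 := repR_mem (A.cent_mem s) p v hv
    rw [add_zero] at h2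
    have h3 := repL_mem ha p s _ h2 (supp_cent s v)
    have h4 := repR_mem hb.1 _ _ h3.1
    have e : p + (i + (2 * i.2 * s, 0)) + j = p + twistDeg i (j, s) := by
      ext <;> simp [twistDeg] <;> ring
    rw [← e]
    exact h4
  | zero =>
    change (repN (0 : AA.carrier)).unop v ∈ _
    rw [map_zero]
    exact Submodule.zero_mem _
  | add x y _ _ hx hy =>
    rw [show repN (x + y) = repN x + repN y from map_add repN x y]
    exact Submodule.add_mem _ hx hy
  | smul c x _ hx =>
    rw [show repN (c • x) = c • repN x from map_smul repN c x]
    exact Submodule.smul_mem _ c hx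

/-- The differential of `N`. -/
def d : Module.End A carrier := actN dGen stab_dGen

theorem commute_d (M : AGen → Gen → Free) (hM : ∀ x g, Stab g.typ (M x g))
    (ρ : A.carrier →ₐ[F2] (Module.End A carrier)ᵐᵒᵖ)
    (hρ : ∀ x, ρ (A.gen x) = MulOpposite.op (actN (M x) (hM x)))
    (h : ∀ x g, act dGen (M x g) = act (M x) (dGen g)) (a : A) :
    Commute (MulOpposite.op d) (ρ a) := by
  have : a ∈ (Subalgebra.centralizer F2 {MulOpposite.op d}).comap ρ :=
    A.mem_subalgebra ((Subalgebra.centralizer F2 {MulOpposite.op d}).comap ρ)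
      (fun x => by
        rw [Subalgebra.mem_comap, Subalgebra.mem_centralizer_iff]
        rintro _ rfl
        rw [hρ]
        refine MulOpposite.unop_injective (LinearMap.ext fun v => Subtype.ext ?_)
        exact (LinearMap.congr_fun (act_ext (f := (act dGen).comp (act (M x)))
          (f' := (act (M x)).comp (act dGen)) fun g => by simpa using h x g) v.1).symm) a
  rw [Subalgebra.mem_comap, Subalgebra.mem_centralizer_iff] at this
  exact this _ rfl

theorem commute_dL (a : A) : Commute (MulOpposite.op d) (repL a) :=
  commute_d mulL stab_mulL repL repL_gen (fun x g => by
    rcases x with v | _ | _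
    · cases g <;> cases v <;> simp [mulL, dGen, Gen.left]
    · cases g <;> simp [mulL, dGen]
    · cases g <;> simp [mulL, dGen]) a

theorem commute_dR (a : A) : Commute (MulOpposite.op d) (repR a) :=
  commute_d mulR stab_mulR repR repR_gen (fun x g => by
    rcases x with v | _ | _
    · cases g <;> cases v <;> simp [mulR, dGen, Gen.right]
    · cases g <;> simp [mulR, dGen]
    · cases g <;> simp [mulR, dGen]) a

theorem d_comm (r : AA) (v : carrier) : d ((repN r).unop v) = (repN r).unop (d v) := by
  have h : Commute (MulOpposite.op d) (repN r) := by
    change A.carrier ⊗[F2] A.carrier at r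
    induction r with
    | zero =>
      change Commute _ (repN (0 : AA.carrier))
      rw [map_zero]
      exact Commute.zero_right _
    | add x y hx hy =>
      rw [show repN (x + y) = repN x + repN y from map_add repN x y]
      exact hx.add_right hy
    | tmul a b =>
      rw [repN_tmul]
      exact (commute_dL a).mul_right (commute_dR b)
  exact (LinearMap.congr_fun (congrArg MulOpposite.unop h.eq) v).symm

theorem d_sq (v : carrier) : d (d v) = 0 := Subtype.ext <|
  LinearMap.congr_fun (act_ext (f := (act dGen).comp (act dGen)) (f' := 0) fun g => by
    cases g <;> simp [dGen]) v.1

end NMod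

/-- The `t`-graded DG `(A, A ⊗ A)`-bimodule `N`. -/
def N : DGBimod A AA where
  carrier := NMod.carrier
  gr := NMod.gr
  internal := NMod.internal_gr
  smul_mem {p q r v} hr hv := NMod.mem_gr.2 fun g => by
    have := A.mul_mem hr (NMod.mem_gr.1 hv g)
    rwa [← add_sub_assoc] at this
  d := NMod.d.restrictScalars F2
  d_mem hv := NMod.mem_gr.2 (NMod.act_mem_freeGr (NMod.mem_gr.1 hv) fun g _ g' =>
    NMod.dGen_mem g g')
  d_d v := NMod.d_sq v
  d_smul r v := by
    rw [A.d_eq, zero_smul, zero_add]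
    exact NMod.d.map_smul r v
  rightTower := ⟨fun c s v => by
    change (NMod.repN (c • s.unop)).unop v = c • (NMod.repN s.unop).unop v
    rw [map_smul]; rfl⟩
  smulComm := ⟨fun r s v => ((NMod.repN s.unop).unop.map_smul r v).symm⟩
  op_smul_mem hv hs := NMod.repN_mem hv hs
  d_op_smul s v := by
    rw [show AA.d s = 0 from rfl, MulOpposite.op_zero, zero_smul, add_zero]
    exact NMod.d_comm s v

/-! ### The ring `U_T` -/

/-- The generators of `U_T`. -/
inductive UGen
  | E | F | T | Tinv

/-- The defining relations of `U_T`. -/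
inductive URel : FreeAlgebra ℤ UGen → FreeAlgebra ℤ UGen → Prop
  | E_E : URel (FreeAlgebra.ι ℤ .E * FreeAlgebra.ι ℤ .E) 0
  | F_F : URel (FreeAlgebra.ι ℤ .F * FreeAlgebra.ι ℤ .F) 0
  | E_F : URel (FreeAlgebra.ι ℤ .E * FreeAlgebra.ι ℤ .F + FreeAlgebra.ι ℤ .F * FreeAlgebra.ι ℤ .E)
      (1 - FreeAlgebra.ι ℤ .T)
  | E_T : URel (FreeAlgebra.ι ℤ .E * FreeAlgebra.ι ℤ .T) (FreeAlgebra.ι ℤ .T * FreeAlgebra.ι ℤ .E)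
  | F_T : URel (FreeAlgebra.ι ℤ .F * FreeAlgebra.ι ℤ .T) (FreeAlgebra.ι ℤ .T * FreeAlgebra.ι ℤ .F)
  | T_Tinv : URel (FreeAlgebra.ι ℤ .T * FreeAlgebra.ι ℤ .Tinv) 1
  | Tinv_T : URel (FreeAlgebra.ι ℤ .Tinv * FreeAlgebra.ι ℤ .T) 1

/-- The ring `U_T`. -/
abbrev UT : Type := RingQuot URel

namespace UT

/-- The generators as elements of `U_T`. -/
def gen (x : UGen) : UT := RingQuot.mkRingHom URel (FreeAlgebra.ι ℤ x)
/-- The generator `T` of `U_T`. -/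
def T : UT := gen .T

/-- The element of `U_T` named by a vertex. -/
def ofVtx : Vtx → UT
  | .F => gen .F
  | .I => 1
  | .EF => gen .E * gen .F
  | .E => gen .E

end UT

/-! ### Grothendieck groups -/

section K0

variable (C : Type 1) [Category.{0} C] [HasZeroObject C] [HasShift C ℤ] [Preadditive C]
  [∀ n : ℤ, (shiftFunctor C n).Additive] [Pretriangulated C]

/-- The Grothendieck group of a triangulated category: the abelian group generated by the objects,
with a relation `[Y] = [X] + [Z]` for every distinguished triangle `X ⟶ Y ⟶ Z ⟶ X[1]`. -/
def K0 : Type 1 :=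
  FreeAbelianGroup C ⧸ AddSubgroup.closure
    {r : FreeAbelianGroup C | ∃ T ∈ distTriang C, r = FreeAbelianGroup.of T.obj₂ -
      (FreeAbelianGroup.of T.obj₁ + FreeAbelianGroup.of T.obj₃)}

instance : AddCommGroup (K0 C) := inferInstanceAs (AddCommGroup (_ ⧸ AddSubgroup.closure _))

variable {C}

/-- The class of an object. -/
def K0.mk (X : C) : K0 C := QuotientAddGroup.mk (FreeAbelianGroup.of X)

end K0

/-! ### The category `HP(A)` -/

/-- The objects of `DGP(A)`. -/
def dgp : ObjectProperty (DGMod A) := fun X => Generated P X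

/-- The category with the objects of `DGP(A)`, and with the closed morphisms of degree `(0, 0)`. -/
abbrev DGP := dgp.FullSubcategory

/-- The homotopy category `HP(A)`. -/
abbrev HP := HPOf P

namespace HP

/-- The quotient functor from `DGP(A)` to `HP(A)`. -/
def Q : DGP ⥤ HP := (generatedK P).lift (dgp.ι ⋙ toK A) fun X => X.property

/-- The inclusion of `HP(A)` in the homotopy category of all DG `A`-modules. -/
abbrev incl : HP ⥤ K A := (generatedK P).ι

/-- The object `P(γ)` of `HP(A)`. -/
def proj (v : Vtx) : HP := ⟨⟨P v⟩, Generated.basic v⟩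

/-- The shift `X{1}` of the `t`-grading. -/
def tShift (X : HP) : HP := ⟨⟨X.obj.as.twist (0, 1)⟩, Generated.twist _ _ X.property⟩

end HP

/-- The functor `(X, Y) ↦ N ⊗_{A ⊗ A} (X ⊗ Y)` on DG `A`-modules. -/
def MDG : DGMod A × DGMod A ⥤ DGMod A := chi ⋙ N.tensorFunctor

end UTCat

end

noncomputable section

namespace UTCat

/-! ### Morphisms in the homotopy category -/

section Homotopy

variable {R : DGAlg}

namespace DGMod

/-! Triangulated structure. The homotopy category `K A` of all DG modules is triangulated by mapping
cones, and over F_2 every sign in the axioms disappears. The third vertex of a distinguished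
triangle is determined up to isomorphism by its first map, so it is homotopy equivalent to the cone
of a representative of that map. Hence HP(A), whose objects are closed under shifts and cones, is a
triangulated subcategory.

The bifunctor. The construction N ⊗ (X ⊗ Y) makes sense on A-linear maps of any degree and satisfies
the Leibniz rule (`tensL_d`). In each variable it is therefore a DG functor (`DGFun`): it carries
homotopies to homotopies and cones to cones, so it descends to homotopy categories and is exact in
each variable. The parity term in the grading interferes only with the internal shift {b} of the
left factor, to which it adds an even cohomological shift; maps of t-degree 0 do not see it
(`tensL_deg'`).

Preservation of HP(A). Since P(γ) = A e(γ), the module N ⊗ (P(γ₁) ⊗ P(γ₂)) is the summand N(γ₁, γ₂)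
(`summandIso`), and this summand is built from shifted copies of the P(γ) by successive cones, one
for each generator (`sub_generated`). Dévissage over the construction of Y and then of X gives the
general case (`tens_generated_and_eulerClass`).

The class map. Let χ_γ(X) be the Euler characteristic of e(γ)X in which the degree (i, j) has weight
(-1)^i T^(-j). It is additive on cones and vanishes on finite-dimensional contractible modules, so
it is invariant under homotopy equivalence. The matrix of the graded dimensions of e(γ')P(γ) has
determinant 1, so there are c_γ in U_T such that X ↦ ∑ χ_γ(X) c_γ sends each P(γ) to γ. This defines
`eulerHom` on K_0.

Multiplicativity. On the P(γ) it says that the generators of N(γ₁, γ₂), weighted by their degrees,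
add up to the product γ₁γ₂ in U_T (`sum_gens`); the differential of N plays no role here. It extends
by the same dévissage, because the weights are central and an even cohomological shift has weight 1.

Bijectivity. The image of `eulerHom` is a subring that contains E, F, T and T^(-1), which gives
surjectivity. For injectivity, K_0 is spanned over the Laurent polynomials in T by the four classes
[P(γ)] (`exists_eq_sum_ofLaurent`), while F, 1, EF and E are linearly independent over them, as the
representation `U.rep` by 2 × 2 matrices shows. -/

theorem add_self {M : DGMod R} (x : M) : x + x = 0 := ZModModule.add_self x

theorem sub_eq_add {M : DGMod R} (x y : M) : x - y = x + y := ZModModule.sub_eq_add x y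

/-- A linear map of degree `δ`. -/
def HasDeg {M N : DGMod R} (f : M →ₗ[R] N) (δ : ℤ × ℤ) : Prop :=
  ∀ {p x}, x ∈ M.gr p → f x ∈ N.gr (p + δ)

theorem toK_map_eq {M N : DGMod R} {u v : M ⟶ N} (h : M →ₗ[R] N) (hh : HasDeg h (-1, 0))
    (e : ∀ x, u.f x + v.f x = N.d (h x) + h (M.d x)) : (toK R).map u = (toK R).map v :=
  CategoryTheory.Quotient.sound _ ⟨h, hh, fun x => by rw [sub_eq_add]; exact e x⟩

theorem exists_homotopy {M N : DGMod R} {u v : M ⟶ N} (h : (toK R).map u = (toK R).map v) :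
    ∃ h : M →ₗ[R] N, HasDeg h (-1, 0) ∧ ∀ x, u.f x + v.f x = N.d (h x) + h (M.d x) := by
  obtain ⟨h, hh, e⟩ := (CategoryTheory.Quotient.functor_map_eq_iff _ u v).1 h
  exact ⟨h, hh, fun x => by rw [← sub_eq_add]; exact e x⟩

/-- An isomorphism of DG modules from mutually inverse linear maps of degree `0`. -/
@[simps]
def mkIso {M N : DGMod R} (f : M →ₗ[R] N) (g : N →ₗ[R] M) (hf : HasDeg f 0) (hg : HasDeg g 0)
    (hd : ∀ x, f (M.d x) = N.d (f x)) (hgf : ∀ x, g (f x) = x) (hfg : ∀ x, f (g x) = x) :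
    M ≅ N where
  hom := ⟨f, fun {p x} h => by simpa using hf h, hd⟩
  inv := ⟨g, fun {p x} h => by simpa using hg h, fun x => by
    conv_lhs => rw [← hfg x]
    rw [← hd, hgf]⟩
  hom_inv_id := hom_ext hgf
  inv_hom_id := hom_ext hfg

end DGMod

open DGMod

/-- Characteristic 2 for morphisms. It is used later to see that the sign (-1)^(mn) in the exchange
of two shifts is trivial. -/
theorem toK_hom_add_self {X Y : K R} (f : X ⟶ Y) : f + f = 0 := by
  obtain ⟨u, rfl⟩ := (toK R).map_surjective (X := X.as) (Y := Y.as) f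
  rw [← Functor.map_add, show u + u = 0 from hom_ext fun x => DGMod.add_self (M := Y.as) (u.f x),
    Functor.map_zero]

/-! ### The triangulated structure on the homotopy category -/

/-- The inclusion of the target of a morphism in its cone. -/
def coneInr {M N : DGMod R} (u : M ⟶ N) : N ⟶ cone u := (coneTriangle u).mor₂

/-- The projection of the cone of a morphism onto the shift of its source. -/
def coneFst {M N : DGMod R} (u : M ⟶ N) : cone u ⟶ M⟦(1 : ℤ)⟧ := (coneTriangle u).mor₃

/-- The triangle in the homotopy category attached to a morphism of DG modules. -/
abbrev coneTriK {M N : DGMod R} (u : M ⟶ N) : Triangle (K R) :=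
  Triangle.mk ((toK R).map u) ((toK R).map (coneInr u))
    ((toK R).map (coneFst u) ≫ ((toK R).commShiftIso (1 : ℤ)).hom.app M)

/-- The triangles isomorphic to standard ones. -/
def distK (R : DGAlg) : Set (Triangle (K R)) :=
  {T | ∃ (M N : DGMod R) (u : M ⟶ N), Nonempty (T ≅ coneTriK u)}

theorem coneTriK_mem {M N : DGMod R} (u : M ⟶ N) : coneTriK u ∈ distK R :=
  ⟨M, N, u, ⟨Iso.refl _⟩⟩

theorem distK_of_iso {T T' : Triangle (K R)} (e : T ≅ T') (h : T' ∈ distK R) : T ∈ distK R := by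
  obtain ⟨M, N, u, ⟨i⟩⟩ := h
  exact ⟨M, N, u, ⟨e ≪≫ i⟩⟩

/-- An isomorphism between the images of two triangles, with the first component induced by a
morphism in the source category. -/
def _root_.CategoryTheory.Functor.mapTriangleIsoMk {C D : Type*} [Category C] [Category D]
    [HasShift C ℤ] [HasShift D ℤ] [Preadditive C] [Preadditive D] (F : C ⥤ D) [F.CommShift ℤ]
    [F.Additive] (T T' : Triangle C) (e₁ : F.obj T.obj₁ ≅ F.obj T'.obj₁)
    (e₂ : F.obj T.obj₂ ≅ F.obj T'.obj₂) (e₃ : F.obj T.obj₃ ≅ F.obj T'.obj₃)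
    (a : T.obj₁ ⟶ T'.obj₁) (ha : e₁.hom = F.map a)
    (h₁ : F.map T.mor₁ ≫ e₂.hom = e₁.hom ≫ F.map T'.mor₁)
    (h₂ : F.map T.mor₂ ≫ e₃.hom = e₂.hom ≫ F.map T'.mor₂)
    (h₃ : F.map (T.mor₃ ≫ a⟦1⟧') = e₃.hom ≫ F.map T'.mor₃) :
    F.mapTriangle.obj T ≅ F.mapTriangle.obj T' :=
  Triangle.isoMk (F.mapTriangle.obj T) (F.mapTriangle.obj T') e₁ e₂ e₃ h₁ h₂ (by
    change (F.map T.mor₃ ≫ (F.commShiftIso (1 : ℤ)).hom.app T.obj₁) ≫ e₁.hom⟦(1 : ℤ)⟧' =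
      e₃.hom ≫ F.map T'.mor₃ ≫ (F.commShiftIso (1 : ℤ)).hom.app T'.obj₁
    rw [← Category.assoc e₃.hom, ← h₃, ha, Functor.map_comp, Category.assoc, Category.assoc,
      Functor.commShiftIso_hom_naturality])

/-- A homotopy equivalence, as an isomorphism in the homotopy category. -/
@[simps]
def isoK {M N : DGMod R} (u : M ⟶ N) (v : N ⟶ M) (h : (toK R).map (u ≫ v) = (toK R).map (𝟙 M))
    (h' : (toK R).map (v ≫ u) = (toK R).map (𝟙 N)) : (toK R).obj M ≅ (toK R).obj N where
  hom := (toK R).map u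
  inv := (toK R).map v
  hom_inv_id := by rw [← Functor.map_comp, h, (toK R).map_id]
  inv_hom_id := by rw [← Functor.map_comp, h', (toK R).map_id]

/-- The morphism of cones induced by a square commuting up to the homotopy `h`. -/
def coneMap {M N M' N' : DGMod R} {u : M ⟶ N} {u' : M' ⟶ N'} (a : M ⟶ M') (b : N ⟶ N')
    (h : M →ₗ[R] N') (hh : HasDeg h (-1, 0))
    (e : ∀ x, b.f (u.f x) + u'.f (a.f x) = N'.d (h x) + h (M.d x)) : cone u ⟶ cone u' where
  f := (a.f.comp (LinearMap.fst R M N)).prod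
    (h.comp (LinearMap.fst R M N) + b.f.comp (LinearMap.snd R M N))
  map_mem {p x} hx := ⟨a.map_mem hx.1, Submodule.add_mem _ (by
    have := hh hx.1
    rwa [add_assoc, show ((1, 0) : ℤ × ℤ) + (-1, 0) = 0 from rfl, add_zero] at this)
    (b.map_mem hx.2)⟩
  comm x := by
    refine Prod.ext (a.comm _) ?_
    change h (M.d x.1) + b.f (u.f x.1 + N.d x.2) = u'.f (a.f x.1) + N'.d (h x.1 + b.f x.2)
    rw [map_add, map_add, b.comm, ← add_assoc, ← add_assoc]
    congr 1
    have := e x.1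
    rw [← sub_eq_zero, sub_eq_add] at this ⊢
    rw [← this]
    abel

instance : HasZeroObject (K R) where
  zero := ⟨(toK R).obj (DGMod.zero R), by
    rw [IsZero.iff_id_eq_zero]
    exact congrArg (toK R).map (DGMod.hom_ext fun x => rfl)⟩

/-- The contraction is (x, y) ↦ (y, 0). -/
theorem isZero_cone_id (M : DGMod R) : IsZero ((toK R).obj (cone (𝟙 M))) := by
  rw [IsZero.iff_id_eq_zero, ← (toK R).map_id, ← (toK R).map_zero]
  refine toK_map_eq (((LinearMap.inl R M M).comp (LinearMap.snd R M M)) :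
    (M × M) →ₗ[R] (M × M)) ?_ ?_
  · intro p x hx
    refine ⟨?_, Submodule.zero_mem _⟩
    change x.2 ∈ M.gr (p + (-1, 0) + (1, 0))
    rw [add_assoc, show ((-1, 0) : ℤ × ℤ) + (1, 0) = 0 from rfl, add_zero]
    exact hx.2
  · rintro ⟨x, y⟩
    refine Prod.ext ?_ ?_
    · change x + 0 = M.d y + (x + M.d y)
      rw [add_left_comm, DGMod.add_self]
    · change y + 0 = (y + M.d 0) + 0
      rw [map_zero, add_zero, add_zero]

theorem contractible_mem (X : K R) : contractibleTriangle X ∈ distK R :=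
  ⟨X.as, X.as, 𝟙 X.as, ⟨Triangle.isoMk (contractibleTriangle X) (coneTriK (𝟙 X.as)) (Iso.refl _)
    (Iso.refl _) ((isZero_zero _).iso (isZero_cone_id X.as)) (by
      change 𝟙 X ≫ 𝟙 X = 𝟙 X ≫ (toK R).map (𝟙 X.as)
      rw [(toK R).map_id]; rfl) ((isZero_cone_id X.as).eq_of_tgt _ _)
      ((isZero_zero _).eq_of_src _ _)⟩⟩

theorem exists_cocone {X Y : K R} (f : X ⟶ Y) :
    ∃ (Z : K R) (g : Y ⟶ Z) (h : Z ⟶ X⟦(1 : ℤ)⟧), Triangle.mk f g h ∈ distK R := by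
  obtain ⟨u, rfl⟩ := (toK R).map_surjective (X := X.as) (Y := Y.as) f
  exact ⟨_, _, _, coneTriK_mem u⟩

/-- The homotopy equivalence between the cone of `N ⟶ cone u` and `M[1]`. -/
def coneInrIso {M N : DGMod R} (u : M ⟶ N) :
    (toK R).obj (M⟦(1 : ℤ)⟧) ≅ (toK R).obj (cone (coneTriangle u).mor₂) :=
  isoK (M := M⟦(1 : ℤ)⟧) (N := cone (coneTriangle u).mor₂)
    -- The target is N[1] ⊕ M[1] ⊕ N, whose two copies of N cancel. The component u x in the first
    -- copy is forced: it makes the N-component u x + u x of the differential vanish. The homotopy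
    -- below sends the second copy of N to the first one.
    { f := u.f.prod (LinearMap.inl R M N)
      map_mem := fun {p x} hx => ⟨u.map_mem hx, hx, Submodule.zero_mem _⟩
      comm := fun x => by
        refine Prod.ext (u.comm x) (Prod.ext (zero_add (M.d x)).symm ?_)
        change (0 : N) = u.f x + (u.f x + N.d 0)
        rw [map_zero, add_zero, DGMod.add_self] }
    { f := (LinearMap.fst R M N).comp (LinearMap.snd R N (M × N))
      map_mem := fun {p x} hx => hx.2.1
      comm := fun x => by
        change (0 : M) + M.d x.2.1 = M.d x.2.1
        rw [zero_add] }
    (congrArg (toK R).map (hom_ext fun x => rfl))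
    (toK_map_eq (M := cone (coneTriangle u).mor₂) (N := cone (coneTriangle u).mor₂)
      ((LinearMap.inl R N (M × N)).comp ((LinearMap.snd R M N).comp (LinearMap.snd R N (M × N))))
      (fun {p x} hx => by
        refine ⟨?_, Submodule.zero_mem _, Submodule.zero_mem _⟩
        change x.2.2 ∈ N.gr (p + (-1, 0) + (1, 0))
        rw [add_assoc, show ((-1, 0) : ℤ × ℤ) + (1, 0) = 0 from rfl, add_zero]
        exact hx.2.2)
      (by
        rintro ⟨y', x, y⟩
        refine Prod.ext ?_ (Prod.ext ?_ ?_)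
        · change N at y'
          change u.f x + y' = N.d y + (y' + (u.f x + N.d y))
          have := DGMod.add_self (M := N) (N.d y)
          calc u.f x + y' = (N.d y + N.d y) + (u.f x + y') := by rw [this, zero_add]
            _ = _ := by abel
        · change x + x = (0 + M.d 0) + 0
          rw [map_zero, DGMod.add_self, add_zero, add_zero]
        · change (0 : N) + y = (y + (u.f 0 + N.d 0)) + 0
          rw [map_zero, map_zero, add_zero, add_zero, add_zero, zero_add]))

/-- Rotation puts a sign on the shifted map, which is invisible over F_2; the remaining point is
that the cone of N ⟶ cone u is homotopy equivalent to M[1]. -/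
theorem rotate_mem {T : Triangle (K R)} (hT : T ∈ distK R) : T.rotate ∈ distK R := by
  obtain ⟨M, N, u, ⟨e⟩⟩ := hT
  refine distK_of_iso ((rotate (K R)).mapIso e) ?_
  refine distK_of_iso ((toK R).mapTriangleRotateIso.app (coneTriangle u)) ?_
  refine ⟨N, cone u, (coneTriangle u).mor₂, ⟨(toK R).mapTriangleIsoMk (coneTriangle u).rotate
    (coneTriangle (coneTriangle u).mor₂) (Iso.refl _) (Iso.refl _) (coneInrIso u)
    (𝟙 N) ((toK R).map_id N).symm ?_ ?_ ?_⟩⟩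
  · exact (Category.comp_id _).trans (Category.id_comp _).symm
  -- This square commutes strictly with the inverse of the homotopy equivalence, but only up to
  -- homotopy with the equivalence itself.
  · exact (Iso.eq_comp_inv (coneInrIso u)).1 (congrArg (toK R).map
      (hom_ext (M := cone u) (N := M⟦(1 : ℤ)⟧) fun x => rfl))
  · refine Eq.trans ?_ ((toK R).map_comp _ _)
    refine congrArg (toK R).map (hom_ext fun x => ?_)
    change -(u.f x) = u.f x
    rw [neg_eq_iff_add_eq_zero, DGMod.add_self]

theorem DGMod.hom_neg {M N : DGMod R} (f : M ⟶ N) : -f = f :=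
  hom_ext fun x => neg_eq_iff_add_eq_zero.2 (DGMod.add_self (f.f x))

theorem DGMod.units_smul {M N : DGMod R} (ε : ℤˣ) (f : M ⟶ N) : ε • f = f := by
  rcases Int.units_eq_one_or ε with rfl | rfl
  · exact one_smul _ _
  · rw [Units.neg_smul, one_smul, DGMod.hom_neg]

/-- The structural isomorphisms of the shift only relabel degrees, so each is the identity on
elements. This lemma and the following ones, up to `shiftFunctorComm_inv_f`, record this fact, to
which every coherence check below reduces. -/
theorem DGMod.shiftFunctorAdd_hom_f (a b : ℤ) (M : DGMod R) (x : M) :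
    ((shiftFunctorAdd (DGMod R) a b).hom.app M).f x = x := rfl

theorem DGMod.shiftFunctorAdd_inv_f (a b : ℤ) (M : DGMod R) (x : M) :
    ((shiftFunctorAdd (DGMod R) a b).inv.app M).f x = x := rfl

theorem DGMod.shiftFunctorZero_hom_f (M : DGMod R) (x : M) :
    ((shiftFunctorZero (DGMod R) ℤ).hom.app M).f x = x := rfl

theorem DGMod.shiftFunctorZero_inv_f (M : DGMod R) (x : M) :
    ((shiftFunctorZero (DGMod R) ℤ).inv.app M).f x = x := rfl

theorem DGMod.shiftFunctorAdd'_hom_f (a b c : ℤ) (h : a + b = c) (M : DGMod R) (x : M) :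
    ((shiftFunctorAdd' (DGMod R) a b c h).hom.app M).f x = x := by
  subst h
  rw [shiftFunctorAdd'_eq_shiftFunctorAdd]
  exact shiftFunctorAdd_hom_f a b M x

theorem DGMod.shiftFunctorAdd'_inv_f (a b c : ℤ) (h : a + b = c) (M : DGMod R) (x : M) :
    ((shiftFunctorAdd' (DGMod R) a b c h).inv.app M).f x = x := by
  subst h
  rw [shiftFunctorAdd'_eq_shiftFunctorAdd]
  exact shiftFunctorAdd_inv_f a b M x

theorem DGMod.shiftFunctorComm_hom_f (a b : ℤ) (M : DGMod R) (x : M) :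
    ((shiftFunctorComm (DGMod R) a b).hom.app M).f x = x := by
  rw [shiftFunctorComm_eq _ a b _ rfl]
  exact (shiftFunctorAdd'_hom_f b a _ (add_comm b a) M _).trans
    (shiftFunctorAdd'_inv_f a b _ rfl M x)

theorem DGMod.shiftFunctorComm_inv_f (a b : ℤ) (M : DGMod R) (x : M) :
    ((shiftFunctorComm (DGMod R) a b).inv.app M).f x = x := by
  rw [shiftFunctorComm_eq _ a b _ rfl]
  exact (shiftFunctorAdd'_hom_f a b _ rfl M _).trans
    (shiftFunctorAdd'_inv_f b a _ (add_comm b a) M x)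

/-- The isomorphism between a shifted cone and the cone of the shifted map. -/
def coneTwistIso {M N : DGMod R} (u : M ⟶ N) (s : ℤ × ℤ) :
    (cone u).twist s ≅ cone ((twistFunctor s).map u) :=
  mkIso (M := (cone u).twist s) (N := cone ((twistFunctor s).map u))
    LinearMap.id LinearMap.id
    (fun {p x} hx => by
      have hx1 : x.1 ∈ M.gr (p + s + (1, 0)) := hx.1
      have hx2 : x.2 ∈ N.gr (p + s) := hx.2
      refine ⟨?_, ?_⟩
      · change x.1 ∈ M.gr (p + 0 + (1, 0) + s)
        rwa [add_zero, add_right_comm]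
      · change x.2 ∈ N.gr (p + 0 + s)
        rwa [add_zero])
    (fun {p x} hx => by
      have hx1 : x.1 ∈ M.gr (p + (1, 0) + s) := hx.1
      have hx2 : x.2 ∈ N.gr (p + s) := hx.2
      refine ⟨?_, ?_⟩
      · change x.1 ∈ M.gr (p + 0 + s + (1, 0))
        rwa [add_zero, add_right_comm]
      · change x.2 ∈ N.gr (p + 0 + s)
        rwa [add_zero])
    (fun _ => rfl) (fun _ => rfl) (fun _ => rfl)

/-- Shifting a triangle by n multiplies its maps by (-1)^n = 1, so the shifted standard triangle of
u is the standard triangle of the shifted map. -/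
theorem shift_mem (n : ℤ) {T : Triangle (K R)} (hT : T ∈ distK R) :
    (Triangle.shiftFunctor (K R) n).obj T ∈ distK R := by
  obtain ⟨M, N, u, ⟨e⟩⟩ := hT
  refine distK_of_iso ((Triangle.shiftFunctor (K R) n).mapIso e) ?_
  refine distK_of_iso (((toK R).mapTriangleCommShiftIso n).symm.app (coneTriangle u)) ?_
  refine ⟨M⟦n⟧, N⟦n⟧, u⟦n⟧', ⟨(toK R).mapTriangle.mapIso
    (Triangle.isoMk ((Triangle.shiftFunctor (DGMod R) n).obj (coneTriangle u))
    (coneTriangle (u⟦n⟧')) (Iso.refl _) (Iso.refl _) (coneTwistIso u (n, 0)) ?_ ?_ ?_)⟩⟩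
  · change (n.negOnePow • (u⟦n⟧')) ≫ 𝟙 _ = 𝟙 _ ≫ (u⟦n⟧')
    rw [DGMod.units_smul]; rfl
  · change (n.negOnePow • ((coneTriangle u).mor₂⟦n⟧')) ≫ _ = 𝟙 _ ≫ _
    rw [DGMod.units_smul]; rfl
  · change (n.negOnePow • ((coneTriangle u).mor₃⟦n⟧') ≫
      (shiftFunctorComm (DGMod R) 1 n).hom.app M) ≫ (𝟙 (M⟦n⟧))⟦(1 : ℤ)⟧' = _
    rw [DGMod.units_smul]
    exact hom_ext fun x => shiftFunctorComm_hom_f 1 n M x.1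

/-- Three rotations amount to the shift [1]; two further rotations followed by [-1] therefore
recover the triangle. -/
theorem of_rotate_mem {T : Triangle (K R)} (hT : T.rotate ∈ distK R) : T ∈ distK R := by
  have h := shift_mem (-1) (distK_of_iso ((rotateRotateRotateIso (K R)).symm.app T)
    (rotate_mem (rotate_mem hT)))
  exact distK_of_iso ((Triangle.shiftFunctorZero (K R)).symm.app T ≪≫
    (Triangle.shiftFunctorAdd' (K R) 1 (-1) 0 rfl).app T) h

/-- The existence of morphisms completing a square is invariant under isomorphisms of triangles. -/
theorem completion_of_iso {C : Type*} [Category C] [HasShift C ℤ] {T₁ T₂ S₁ S₂ : Triangle C}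
    (e : T₁ ≅ S₁) (e' : T₂ ≅ S₂)
    (H : ∀ (a : S₁.obj₁ ⟶ S₂.obj₁) (b : S₁.obj₂ ⟶ S₂.obj₂), S₁.mor₁ ≫ b = a ≫ S₂.mor₁ →
      ∃ c : S₁.obj₃ ⟶ S₂.obj₃, S₁.mor₂ ≫ c = b ≫ S₂.mor₂ ∧
        S₁.mor₃ ≫ a⟦(1 : ℤ)⟧' = c ≫ S₂.mor₃)
    (a : T₁.obj₁ ⟶ T₂.obj₁) (b : T₁.obj₂ ⟶ T₂.obj₂) (comm : T₁.mor₁ ≫ b = a ≫ T₂.mor₁) :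
    ∃ c : T₁.obj₃ ⟶ T₂.obj₃, T₁.mor₂ ≫ c = b ≫ T₂.mor₂ ∧
      T₁.mor₃ ≫ a⟦(1 : ℤ)⟧' = c ≫ T₂.mor₃ := by
  obtain ⟨c, h1, h2⟩ := H (e.inv.hom₁ ≫ a ≫ e'.hom.hom₁) (e.inv.hom₂ ≫ b ≫ e'.hom.hom₂) (by
    rw [e.inv.comm₁_assoc, reassoc_of% comm, e'.hom.comm₁, Category.assoc, Category.assoc])
  refine ⟨e.hom.hom₃ ≫ c ≫ e'.inv.hom₃, ?_, ?_⟩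
  · rw [e.hom.comm₂_assoc, reassoc_of% h1, e'.inv.comm₂, Iso.hom_inv_id_triangle_hom₂_assoc,
      Iso.hom_inv_id_triangle_hom₂_assoc]
  · rw [Category.assoc, Category.assoc, ← e'.inv.comm₃, ← reassoc_of% h2, ← e.hom.comm₃_assoc]
    simp only [← Functor.map_comp, Category.assoc]
    rw [Iso.hom_inv_id_triangle_hom₁_assoc, Iso.hom_inv_id_triangle_hom₁, Category.comp_id]

/-- A square that commutes in the homotopy category commutes up to some homotopy of DG modules, and
this homotopy is the off-diagonal entry of a map of cones. -/
theorem cone_completion {M N M' N' : DGMod R} (u : M ⟶ N) (u' : M' ⟶ N')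
    (a : (toK R).obj M ⟶ (toK R).obj M') (b : (toK R).obj N ⟶ (toK R).obj N')
    (comm : (toK R).map u ≫ b = a ≫ (toK R).map u') :
    ∃ c : (toK R).obj (cone u) ⟶ (toK R).obj (cone u'),
      (toK R).map (coneInr u) ≫ c = b ≫ (toK R).map (coneInr u') ∧
      ((toK R).map (coneFst u) ≫ ((toK R).commShiftIso (1 : ℤ)).hom.app M) ≫ a⟦(1 : ℤ)⟧' =
        c ≫ (toK R).map (coneFst u') ≫ ((toK R).commShiftIso (1 : ℤ)).hom.app M' := by
  obtain ⟨α, rfl⟩ := (toK R).map_surjective a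
  obtain ⟨β, rfl⟩ := (toK R).map_surjective b
  rw [← Functor.map_comp, ← Functor.map_comp] at comm
  obtain ⟨h, hh, H⟩ := exists_homotopy comm
  refine ⟨(toK R).map (coneMap α β h hh H), ?_, ?_⟩
  · rw [← Functor.map_comp, ← Functor.map_comp]
    refine congrArg (toK R).map (hom_ext fun x => Prod.ext (map_zero α.f) ?_)
    change h 0 + β.f x = β.f x
    rw [map_zero, zero_add]
  · rw [Category.assoc, ← Functor.commShiftIso_hom_naturality, ← Category.assoc,
      ← Category.assoc]
    rfl

theorem complete_morphism (T₁ T₂ : Triangle (K R)) (h₁ : T₁ ∈ distK R) (h₂ : T₂ ∈ distK R)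
    (a : T₁.obj₁ ⟶ T₂.obj₁) (b : T₁.obj₂ ⟶ T₂.obj₂) (comm : T₁.mor₁ ≫ b = a ≫ T₂.mor₁) :
    ∃ c : T₁.obj₃ ⟶ T₂.obj₃, T₁.mor₂ ≫ c = b ≫ T₂.mor₂ ∧
      T₁.mor₃ ≫ a⟦(1 : ℤ)⟧' = c ≫ T₂.mor₃ := by
  obtain ⟨M, N, u, ⟨e⟩⟩ := h₁
  obtain ⟨M', N', u', ⟨e'⟩⟩ := h₂
  exact completion_of_iso e e' (cone_completion u u') a b comm

instance : Pretriangulated (K R) where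
  distinguishedTriangles := distK R
  isomorphic_distinguished _ h _ e := distK_of_iso e h
  contractible_distinguished := contractible_mem
  distinguished_cocone_triangle := exists_cocone
  rotate_distinguished_triangle _ := ⟨rotate_mem, of_rotate_mem⟩
  complete_distinguished_triangle_morphism := complete_morphism

theorem mem_distTriang_iff {T : Triangle (K R)} :
    T ∈ distTriang (K R) ↔ ∃ (M N : DGMod R) (u : M ⟶ N), Nonempty (T ≅ coneTriK u) := Iff.rfl

/-! ### The octahedral axiom -/

section Octahedron

variable {L M N : DGMod R} (u : L ⟶ M) (v : M ⟶ N)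

/-- The first map between cones in the octahedral axiom. -/
def octMap₁ : cone u ⟶ cone (u ≫ v) :=
  coneMap (𝟙 L) v 0 (fun _ => Submodule.zero_mem _) (fun x => by
    change v.f (u.f x) + v.f (u.f x) = N.d 0 + 0
    rw [DGMod.add_self, map_zero, add_zero])

/-- The second map between cones in the octahedral axiom. -/
def octMap₂ : cone (u ≫ v) ⟶ cone v :=
  coneMap u (𝟙 N) 0 (fun _ => Submodule.zero_mem _) (fun x => by
    change v.f (u.f x) + v.f (u.f x) = N.d 0 + 0
    rw [DGMod.add_self, map_zero, add_zero])

/-- The homotopy equivalence between the cone of `octMap₁` and the third cone in the octahedral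
axiom. -/
def octIso : (toK R).obj (cone v) ≅ (toK R).obj (cone (octMap₁ u v)) :=
  isoK (M := cone v) (N := cone (octMap₁ u v))
    -- The cone of `octMap₁` consists of copies of L, M, L, N, and the two copies of L cancel. The
    -- retraction given next is ((x, y), (x', z)) ↦ (y + u x', z), and the homotopy moves x' into
    -- the first copy of L.
    { f := ((LinearMap.inr R L M).comp (LinearMap.fst R M N)).prod
        ((LinearMap.inr R L N).comp (LinearMap.snd R M N))
      map_mem := fun {p x} hx => ⟨⟨Submodule.zero_mem _, hx.1⟩, ⟨Submodule.zero_mem _, hx.2⟩⟩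
      comm := by
        rintro ⟨y, z⟩
        refine Prod.ext (Prod.ext ?_ ?_) (Prod.ext ?_ ?_)
        · exact (map_zero L.d).symm
        · change M.d y = u.f 0 + M.d y
          rw [map_zero, zero_add]
        · change (0 : L) = 0 + L.d 0
          rw [map_zero, add_zero]
        · change v.f y + N.d z = (0 + v.f y) + (v.f (u.f 0) + N.d z)
          rw [map_zero, map_zero, zero_add, zero_add] }
    { f := ((LinearMap.snd R L M).comp (LinearMap.fst R (L × M) (L × N)) +
          u.f.comp ((LinearMap.fst R L N).comp (LinearMap.snd R (L × M) (L × N)))).prod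
        ((LinearMap.snd R L N).comp (LinearMap.snd R (L × M) (L × N)))
      map_mem := fun {p x} hx => ⟨Submodule.add_mem _ hx.1.2 (u.map_mem hx.2.1), hx.2.2⟩
      comm := by
        rintro ⟨⟨x, y⟩, ⟨x', z⟩⟩
        refine Prod.ext ?_ ?_
        · change (u.f x + M.d y) + u.f (x + L.d x') = M.d (y + u.f x')
          rw [map_add, map_add, u.comm]
          calc _ = (u.f x + u.f x) + (M.d y + M.d (u.f x')) := by abel
            _ = _ := by rw [DGMod.add_self, zero_add]
        · change (0 + v.f y) + (v.f (u.f x') + N.d z) = v.f (y + u.f x') + N.d z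
          rw [map_add, zero_add, add_assoc] }
    (congrArg (toK R).map (hom_ext (M := cone v) (N := cone v) fun x => by
      refine Prod.ext ?_ rfl
      change x.1 + u.f 0 = x.1
      rw [map_zero, add_zero]))
    (toK_map_eq (M := cone (octMap₁ u v)) (N := cone (octMap₁ u v))
      ((LinearMap.inl R (L × M) (L × N)).comp ((LinearMap.inl R L M).comp
        ((LinearMap.fst R L N).comp (LinearMap.snd R (L × M) (L × N)))))
      (fun {p x} hx => by
        refine ⟨⟨?_, Submodule.zero_mem _⟩, Submodule.zero_mem _⟩
        change x.2.1 ∈ L.gr (p + (-1, 0) + (1, 0) + (1, 0))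
        rw [add_assoc p, show ((-1, 0) : ℤ × ℤ) + (1, 0) = 0 from rfl, add_zero]
        exact hx.2.1)
      (by
        rintro ⟨⟨x, y⟩, ⟨x', z⟩⟩
        refine Prod.ext (Prod.ext ?_ ?_) (Prod.ext ?_ ?_)
        · change (0 : L) + x = L.d x' + (x + L.d x')
          rw [add_left_comm, DGMod.add_self, zero_add, add_zero]
        · change (y + u.f x') + y = (u.f x' + M.d 0) + 0
          rw [map_zero, add_zero, add_zero, add_right_comm, DGMod.add_self, zero_add]
        · change (0 : L) + x' = (x' + L.d 0) + 0
          rw [map_zero, add_zero, add_zero, zero_add]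
        · change z + z = ((0 + v.f 0) + (v.f (u.f 0) + N.d 0)) + 0
          simp only [DGMod.add_self, map_zero, add_zero]))

/-- The third triangle of the octahedral axiom. -/
theorem octahedron_mem : Triangle.mk ((toK R).map (octMap₁ u v)) ((toK R).map (octMap₂ u v))
    (((toK R).map (coneFst v) ≫ ((toK R).commShiftIso (1 : ℤ)).hom.app M) ≫
      ((toK R).map (coneInr u))⟦(1 : ℤ)⟧') ∈ distTriang (K R) := by
  refine ⟨_, _, octMap₁ u v, ⟨Triangle.isoMk _ _ (Iso.refl _) (Iso.refl _) (octIso u v)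
    ?_ ?_ ?_⟩⟩
  · exact (Category.comp_id _).trans (Category.id_comp _).symm
  -- As for the rotation, strict commutation holds only with the inverse equivalence.
  · refine (Iso.eq_comp_inv (octIso u v)).1 (congrArg (toK R).map
      (hom_ext (M := cone (u ≫ v)) (N := cone v) fun x => ?_))
    refine Prod.ext ?_ ?_
    · change u.f x.1 = 0 + u.f x.1
      rw [zero_add]
    · change 0 + x.2 = x.2
      rw [zero_add]
  · have h : (toK R).map (coneFst v) ≫ (toK R).map ((coneInr u)⟦(1 : ℤ)⟧') =
        (octIso u v).hom ≫ (toK R).map (coneFst (octMap₁ u v)) := rfl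
    have h' := (toK R).commShiftIso_hom_naturality (coneInr u) (1 : ℤ)
    change (((toK R).map (coneFst v) ≫ ((toK R).commShiftIso (1 : ℤ)).hom.app M) ≫
      ((toK R).map (coneInr u))⟦(1 : ℤ)⟧') ≫ (𝟙 ((toK R).obj (cone u)))⟦(1 : ℤ)⟧' = _
    rw [CategoryTheory.Functor.map_id, Category.comp_id, Category.assoc, ← h', ← Category.assoc, h]
    exact Category.assoc _ _ _

end Octahedron

/-- It is enough to complete one octahedron for each composable pair. With strict representatives u,
v and their standard cones, the required squares commute strictly, and only the last triangle needs
a homotopy equivalence. -/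
instance : IsTriangulated (K R) := by
  refine IsTriangulated.mk' fun X₁ X₂ X₃ f g => ?_
  obtain ⟨u, rfl⟩ := (toK R).map_surjective (X := X₁.as) (Y := X₂.as) f
  obtain ⟨v, rfl⟩ := (toK R).map_surjective (X := X₂.as) (Y := X₃.as) g
  refine ⟨_, _, _, _, _, _, _, _, Iso.refl _, Iso.refl _, Iso.refl _,
    (Category.comp_id _).trans (Category.id_comp _).symm,
    (Category.comp_id _).trans (Category.id_comp _).symm,
    _, _, coneTriK_mem u, _, _, coneTriK_mem v, _, _, coneTriK_mem (u ≫ v), ⟨?_⟩⟩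
  refine ⟨(toK R).map (octMap₁ u v), (toK R).map (octMap₂ u v), ?_, ?_, ?_, ?_,
    octahedron_mem u v⟩
  · exact congrArg (toK R).map (hom_ext (M := X₂.as) (N := cone (u ≫ v))
      fun x => Prod.ext rfl (zero_add (v.f x)))
  · exact (Category.assoc _ _ _).symm
  · exact congrArg (toK R).map (hom_ext (M := X₃.as) (N := cone v)
      fun x => Prod.ext (map_zero u.f) (zero_add x))
  · have h' := (toK R).commShiftIso_hom_naturality u (1 : ℤ)
    change ((toK R).map (coneFst (u ≫ v)) ≫ ((toK R).commShiftIso (1 : ℤ)).hom.app X₁.as) ≫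
      ((toK R).map u)⟦(1 : ℤ)⟧' = _
    rw [Category.assoc, ← h', ← Category.assoc]
    refine Eq.trans ?_ (Category.assoc _ _ _)
    rfl

end Homotopy

end UTCat

end

noncomputable section

namespace UTCat

open DGMod

/-! ### Tensor products of linear maps -/

namespace DGBimod

variable {R S : DGAlg} (N : DGBimod R S) {X Y Z : DGMod S}

/-- The map `N ⊗_S X ⟶ N ⊗_S Y` induced by a linear map. -/
def tensorL (f : X →ₗ[S] Y) : N.tensor X →ₗ[R] N.tensor Y :=
  (N.rel X).mapQ (N.rel Y)
    (TensorProduct.AlgebraTensorModule.map LinearMap.id (f.restrictScalars F2)) (by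
      rw [rel, Submodule.span_le]
      rintro _ ⟨n, s, x, rfl⟩
      refine Submodule.subset_span ⟨n, s, f x, ?_⟩
      simp)

/-- The class of `n ⊗ x`. -/
abbrev pure (n : N.carrier) (x : X) : N.tensor X := N.proj X (n ⊗ₜ[F2] x)

theorem tensorL_pure (f : X →ₗ[S] Y) (n : N.carrier) (x : X) :
    N.tensorL f (N.pure n x) = N.pure n (f x) := rfl

theorem d_pure (n : N.carrier) (x : X) :
    (N.tensor X).d (N.pure n x) = N.pure (N.d n) x + N.pure n (X.d x) := by
  change N.proj X (N.preD X (n ⊗ₜ x)) = _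
  rw [preD_tmul, map_add]
  rfl

theorem pure_smul (n : N.carrier) (s : S) (x : X) :
    N.pure n (s • x) = N.pure (MulOpposite.op s • n) x := (N.proj_rel X n s x).symm

theorem pure_add (n : N.carrier) (x y : X) : N.pure n (x + y) = N.pure n x + N.pure n y := by
  rw [pure, TensorProduct.tmul_add, map_add]
  rfl

theorem add_pure (n m : N.carrier) (x : X) : N.pure (n + m) x = N.pure n x + N.pure m x := by
  rw [pure, TensorProduct.add_tmul, map_add]
  rfl

theorem tensor_hom_ext {V : Type} [AddCommGroup V] [Module F2 V] {φ ψ : N.tensor X →ₗ[F2] V}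
    (h : ∀ n x, φ (N.pure n x) = ψ (N.pure n x)) (z : N.tensor X) : φ z = ψ z :=
  N.tensor_induction X φ ψ h z

theorem pure_mem {p q : ℤ × ℤ} {n : N.carrier} {x : X} (hn : n ∈ N.gr p) (hx : x ∈ X.gr q) :
    N.pure n x ∈ (N.tensor X).gr (p + q) :=
  ⟨n ⊗ₜ[F2] x, tensorGr_mem (θ := fun p q => p + q) hn hx, rfl⟩

theorem tensor_gr_le {p : ℤ × ℤ} {V : Submodule F2 (N.tensor X)}
    (h : ∀ i j, i + j = p → ∀ n ∈ N.gr i, ∀ x ∈ X.gr j, N.pure n x ∈ V) :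
    (N.tensor X).gr p ≤ V := by
  intro w hw
  obtain ⟨z, hz, e⟩ := hw
  suffices H : ∀ z ∈ N.preGr X p, N.proj X z ∈ V from e ▸ H z hz
  intro z hz
  refine Submodule.span_induction (p := fun z _ => N.proj X z ∈ V) ?_ V.zero_mem
    (fun x y _ _ hx hy => V.add_mem hx hy) (fun a x _ hx => V.smul_mem a hx) hz
  rintro _ ⟨i, j, hij, n, hn, x, hx, rfl⟩
  exact h i j hij n hn x hx

theorem tensorL_deg {f : X →ₗ[S] Y} {δ : ℤ × ℤ} (hf : HasDeg f δ) : HasDeg (N.tensorL f) δ := by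
  intro p z hz
  have : (N.tensor X).gr p ≤
      ((N.tensor Y).gr (p + δ)).comap ((N.tensorL f).restrictScalars F2) := by
    refine N.tensor_gr_le fun i j hij n hn x hx => ?_
    rw [← hij, add_assoc]
    exact N.pure_mem hn (hf hx)
  exact this hz

theorem tensorL_add (f g : X →ₗ[S] Y) : N.tensorL (f + g) = N.tensorL f + N.tensorL g := by
  ext z
  refine N.tensor_hom_ext (φ := (N.tensorL (f + g)).restrictScalars F2)
    (ψ := (N.tensorL f + N.tensorL g).restrictScalars F2) (fun n x => ?_) z
  exact N.pure_add n (f x) (g x)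

/-- The terms coming from the differential of N occur twice and cancel, so the commutator with the
differential is computed in the second factor. The case g = 0 is closedness; the general case is
what transports homotopies. -/
theorem tensorL_d {f g : X →ₗ[S] Y} (h : ∀ x, f (X.d x) + Y.d (f x) = g x) (z : N.tensor X) :
    N.tensorL f ((N.tensor X).d z) + (N.tensor Y).d (N.tensorL f z) = N.tensorL g z := by
  refine N.tensor_hom_ext (φ := ((N.tensorL f).restrictScalars F2).comp (N.tensor X).d +
    (N.tensor Y).d.comp ((N.tensorL f).restrictScalars F2))
    (ψ := (N.tensorL g).restrictScalars F2) (fun n x => ?_) z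
  change N.tensorL f ((N.tensor X).d (N.pure n x)) + (N.tensor Y).d (N.pure n (f x)) =
    N.pure n (g x)
  rw [d_pure, d_pure, map_add, tensorL_pure, tensorL_pure, ← h, pure_add]
  have h2 : ∀ a b c : N.tensor Y, a + b + (b + c) = a + c := fun a b c => by
    rw [add_assoc, ← add_assoc b, DGMod.add_self, zero_add]
  rw [add_comm (N.pure (N.d n) (f x))]
  exact h2 _ _ _

end DGBimod

/-! ### External tensor products of linear maps -/

section Chi

variable {X X' X'' Y Y' Y'' : DGMod A}

/-- The tensor product of two linear maps. -/
def chiL (f : X →ₗ[A] X') (g : Y →ₗ[A] Y') : chiObj X Y →ₗ[AA] chiObj X' Y' where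
  toFun := TensorProduct.map (f.restrictScalars F2) (g.restrictScalars F2)
  map_add' := map_add _
  map_smul' r z := by
    change TensorProduct.map _ _ (chiAct X Y r z) = chiAct X' Y' r (TensorProduct.map _ _ z)
    refine LinearMap.congr_fun (TensorProduct.ext' (g :=
      (TensorProduct.map (f.restrictScalars F2) (g.restrictScalars F2)).comp
        ((LinearMap.applyₗ (R := F2) z).comp (chiAct X Y).toLinearMap))
      (h := (LinearMap.applyₗ (R := F2) (TensorProduct.map (f.restrictScalars F2)
        (g.restrictScalars F2) z)).comp (chiAct X' Y').toLinearMap) fun a b => ?_) r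
    refine LinearMap.congr_fun (TensorProduct.ext' (g :=
      (TensorProduct.map (f.restrictScalars F2) (g.restrictScalars F2)).comp
        (chiAct X Y (a ⊗ₜ b)))
      (h := (chiAct X' Y' (a ⊗ₜ b)).comp (TensorProduct.map (f.restrictScalars F2)
        (g.restrictScalars F2))) fun x y => ?_) z
    simp only [LinearMap.comp_apply, TensorProduct.map_tmul, chiAct_tmul,
      LinearMap.coe_restrictScalars, map_smul]

/-- The element `x ⊗ y` of the external tensor product. -/
abbrev chiTmul (x : X) (y : Y) : chiObj X Y := (x ⊗ₜ[F2] y : X.carrier ⊗[F2] Y.carrier)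

theorem chi_hom_ext {V : Type} [AddCommGroup V] [Module F2 V] {φ ψ : chiObj X Y →ₗ[F2] V}
    (h : ∀ x y, φ (chiTmul x y) = ψ (chiTmul x y)) (z : chiObj X Y) : φ z = ψ z :=
  LinearMap.congr_fun (TensorProduct.ext' (g := (φ : X.carrier ⊗[F2] Y.carrier →ₗ[F2] V))
    (h := ψ) h) z

theorem chi_gr_le {p : ℤ × ℤ} {V : Submodule F2 (chiObj X Y)}
    (h : ∀ i j, twistDeg i j = p → ∀ x ∈ X.gr i, ∀ y ∈ parityGr Y j, chiTmul x y ∈ V) :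
    (chiObj X Y).gr p ≤ V := by
  intro z hz
  induction hz using Submodule.span_induction with
  | mem z hz =>
    obtain ⟨i, j, hij, x, hx, y, hy, rfl⟩ := hz
    exact h i j hij x hx y hy
  | zero => exact Submodule.zero_mem _
  | add x y _ _ hx hy => exact Submodule.add_mem _ hx hy
  | smul a x _ hx => exact Submodule.smul_mem _ _ hx

/-- Tensoring with a map of degree `δ` on the left shifts the degrees by a constant on the
elements of a fixed parity on the right. -/
theorem chiL_deg {f : X →ₗ[A] X'} {g : Y →ₗ[A] Y'} {δ δ' : ℤ × ℤ} {c : ℤ} (hf : HasDeg f δ)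
    (hg : HasDeg g δ') (hc : ∀ j, ∀ y ∈ parityGr Y j, y ≠ 0 → 2 * δ.2 * j.2 = c) :
    HasDeg (chiL f g) (δ + δ' + (c, 0)) := by
  intro p z hz
  have : (chiObj X Y).gr p ≤
      ((chiObj X' Y').gr (p + (δ + δ' + (c, 0)))).comap ((chiL f g).restrictScalars F2) := by
    refine chi_gr_le fun i j hij x hx y hy => ?_
    by_cases h0 : y = 0
    · subst h0
      have : chiTmul x (0 : Y) = 0 := TensorProduct.tmul_zero _ _
      rw [this]
      exact Submodule.zero_mem _
    have hc' := hc j y hy h0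
    have h1 : g y ∈ parityGr Y' (j.1 + δ', j.2) := ⟨hg hy.1, by
      have := congrArg g hy.2
      rwa [map_smul] at this⟩
    have h2 := chiGr_mem (hf hx) h1
    have e : twistDeg (i + δ) (j.1 + δ', j.2) = p + (δ + δ' + (c, 0)) := by
      rw [← hij, ← hc']
      ext <;> simp [twistDeg] <;> ring
    rw [e] at h2
    exact h2
  exact this hz

/-- The Leibniz rule for the commutator of f ⊗ g with the differential. -/
theorem chiL_d {f f' : X →ₗ[A] X'} {g g' : Y →ₗ[A] Y'} (hf : ∀ x, f (X.d x) + X'.d (f x) = f' x)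
    (hg : ∀ y, g (Y.d y) + Y'.d (g y) = g' y) (z : chiObj X Y) :
    chiL f g ((chiObj X Y).d z) + (chiObj X' Y').d (chiL f g z) =
      (chiL f' g + chiL f g') z := by
  refine chi_hom_ext (φ := ((chiL f g).restrictScalars F2).comp (chiObj X Y).d +
    (chiObj X' Y').d.comp ((chiL f g).restrictScalars F2))
    (ψ := (chiL f' g + chiL f g').restrictScalars F2) (fun x y => ?_) z
  change TensorProduct.map (f.restrictScalars F2) (g.restrictScalars F2)
      (X.d x ⊗ₜ[F2] y + x ⊗ₜ[F2] Y.d y) +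
    (X'.d (f x) ⊗ₜ[F2] g y + f x ⊗ₜ[F2] Y'.d (g y)) = f' x ⊗ₜ[F2] g y + f x ⊗ₜ[F2] g' y
  rw [map_add, TensorProduct.map_tmul, TensorProduct.map_tmul, ← hf, ← hg,
    TensorProduct.add_tmul, TensorProduct.tmul_add]
  simp only [LinearMap.coe_restrictScalars]
  abel

end Chi

/-! ### The bifunctor on linear maps -/

section Bilinear

variable {R : DGAlg} (N : DGBimod R AA) {X X' X'' Y Y' Y'' : DGMod A}

namespace DGBimod

/-- The DG module `N ⊗_{A ⊗ A} (X ⊗ Y)`. -/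
abbrev tens (X Y : DGMod A) : DGMod R := N.tensor (chiObj X Y)

/-- The class of `n ⊗ (x ⊗ y)`. -/
abbrev pure₂ (n : N.carrier) (x : X) (y : Y) : N.tens X Y := N.pure n (chiTmul x y)

/-- The map `N ⊗_{A ⊗ A} (X ⊗ Y) ⟶ N ⊗_{A ⊗ A} (X' ⊗ Y')` induced by two linear maps. -/
def tensL (f : X →ₗ[A] X') (g : Y →ₗ[A] Y') : N.tens X Y →ₗ[R] N.tens X' Y' :=
  N.tensorL (chiL f g)

theorem pure₂_add (n : N.carrier) (x : X) (y y' : Y) :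
    N.pure₂ n x (y + y') = N.pure₂ n x y + N.pure₂ n x y' :=
  (congrArg (N.pure n) (TensorProduct.tmul_add x y y')).trans (N.pure_add (X := chiObj X Y) n _ _)

theorem add_pure₂ (n : N.carrier) (x x' : X) (y : Y) :
    N.pure₂ n (x + x') y = N.pure₂ n x y + N.pure₂ n x' y :=
  (congrArg (N.pure n) (TensorProduct.add_tmul x x' y)).trans (N.pure_add (X := chiObj X Y) n _ _)

theorem zero_pure₂ (n : N.carrier) (y : Y) : N.pure₂ n (0 : X) y = 0 := by
  have h := N.add_pure₂ n (0 : X) 0 y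
  rw [add_zero] at h
  exact left_eq_add.1 h

theorem pure₂_zero (n : N.carrier) (x : X) : N.pure₂ n x (0 : Y) = 0 := by
  have h := N.pure₂_add n x (0 : Y) 0
  rw [add_zero] at h
  exact left_eq_add.1 h

theorem tens_hom_ext' {V : Type} [AddCommGroup V] [Module F2 V] {φ ψ : N.tens X Y →ₗ[F2] V}
    (h : ∀ n x y, φ (N.pure₂ n x y) = ψ (N.pure₂ n x y)) (z : N.tens X Y) : φ z = ψ z :=
  N.tensor_hom_ext (fun n w => by
    let mkn : chiObj X Y →ₗ[F2] N.tens X Y :=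
      (N.proj (chiObj X Y)).comp (TensorProduct.mk F2 N.carrier (chiObj X Y).carrier n)
    exact chi_hom_ext (φ := φ.comp mkn) (ψ := ψ.comp mkn) (fun x y => h n x y) w) z

theorem tens_hom_ext {V : DGMod R} {φ ψ : N.tens X Y →ₗ[R] V}
    (h : ∀ n x y, φ (N.pure₂ n x y) = ψ (N.pure₂ n x y)) : φ = ψ :=
  LinearMap.ext fun z => N.tens_hom_ext' (φ := φ.restrictScalars F2)
    (ψ := ψ.restrictScalars F2) h z

theorem tensL_comp (f : X →ₗ[A] X') (f' : X' →ₗ[A] X'') (g : Y →ₗ[A] Y') (g' : Y' →ₗ[A] Y'') :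
    (N.tensL f' g').comp (N.tensL f g) = N.tensL (f'.comp f) (g'.comp g) :=
  N.tens_hom_ext fun _ _ _ => rfl

theorem tensL_id : N.tensL (LinearMap.id : X →ₗ[A] X) (LinearMap.id : Y →ₗ[A] Y) =
    LinearMap.id := N.tens_hom_ext fun _ _ _ => rfl

theorem tensL_add_left (f f' : X →ₗ[A] X') (g : Y →ₗ[A] Y') :
    N.tensL (f + f') g = N.tensL f g + N.tensL f' g :=
  N.tens_hom_ext fun n x y => N.add_pure₂ n (f x) (f' x) (g y)

theorem tensL_add_right (f : X →ₗ[A] X') (g g' : Y →ₗ[A] Y') :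
    N.tensL f (g + g') = N.tensL f g + N.tensL f g' :=
  N.tens_hom_ext fun n x y => N.pure₂_add n (f x) (g y) (g' y)

theorem tensL_zero_left (g : Y →ₗ[A] Y') : N.tensL (0 : X →ₗ[A] X') g = 0 :=
  N.tens_hom_ext fun n _ y => N.zero_pure₂ n (g y)

theorem tensL_zero_right (f : X →ₗ[A] X') : N.tensL f (0 : Y →ₗ[A] Y') = 0 :=
  N.tens_hom_ext fun n x _ => N.pure₂_zero n (f x)

theorem tensL_deg {f : X →ₗ[A] X'} {g : Y →ₗ[A] Y'} {δ δ' : ℤ × ℤ} {c : ℤ} (hf : HasDeg f δ)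
    (hg : HasDeg g δ') (hc : ∀ j, ∀ y ∈ parityGr Y j, y ≠ 0 → 2 * δ.2 * j.2 = c) :
    HasDeg (N.tensL f g) (δ + δ' + (c, 0)) :=
  N.tensorL_deg (chiL_deg hf hg hc)

/-- The correction 2 deg_t(f) p(y) vanishes when f has t-degree 0. Homotopies, cohomological shifts
and the structure maps of cones are all of this kind, so the parity twist of the grading does not
affect them. -/
theorem tensL_deg' {f : X →ₗ[A] X'} {g : Y →ₗ[A] Y'} {a : ℤ} {δ' δ : ℤ × ℤ}
    (hf : HasDeg f (a, 0)) (hg : HasDeg g δ') (h : (a, 0) + δ' = δ) : HasDeg (N.tensL f g) δ := by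
  have : HasDeg (N.tensL f g) ((a, 0) + δ' + (0, 0)) :=
    N.tensL_deg (c := 0) hf hg (fun j y _ _ => by simp)
  have e : ((a, 0) : ℤ × ℤ) + δ' + (0, 0) = δ := by rw [← h]; exact add_zero _
  rwa [e] at this

/-- Everything DG about the bifunctor is contained in this rule: it gives closedness of tensor
products of closed maps, the transport of homotopies in either variable, and the differential on the
image of a cone. -/
theorem tensL_d {f f' : X →ₗ[A] X'} {g g' : Y →ₗ[A] Y'}
    (hf : ∀ x, f (X.d x) + X'.d (f x) = f' x) (hg : ∀ y, g (Y.d y) + Y'.d (g y) = g' y)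
    (z : N.tens X Y) :
    N.tensL f g ((N.tens X Y).d z) + (N.tens X' Y').d (N.tensL f g z) =
      N.tensL f' g z + N.tensL f g' z := by
  refine (N.tensorL_d (chiL_d hf hg) z).trans ?_
  rw [tensorL_add]
  rfl

end DGBimod

end Bilinear

end UTCat

end

noncomputable section

/-! ### Bifunctors commuting with shifts -/

namespace CategoryTheory

variable {C₁ C₂ D D' : Type*} [Category* C₁] [Category* C₂] [Category* D] [Category* D']
  {M : Type*} [AddCommMonoid M] [HasShift C₁ M] [HasShift C₂ M] [HasShift D M] [HasShift D' M]

section Postcomp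

variable (G : C₁ ⥤ C₂ ⥤ D) (F : D ⥤ D') [F.CommShift M]

theorem Functor.map_shiftComm_inv (X : D) (m n : M) :
    F.map (shiftComm X m n).inv ≫ (F.commShiftIso n).hom.app (X⟦m⟧) ≫
      ((F.commShiftIso m).hom.app X)⟦n⟧' =
    (F.commShiftIso m).hom.app (X⟦n⟧) ≫ ((F.commShiftIso n).hom.app X)⟦m⟧' ≫
      (shiftComm (F.obj X) m n).inv := by
  have := F.map_shiftFunctorComm_hom_app X n m
  have e : (shiftComm X m n).inv = (shiftFunctorComm D n m).hom.app X := by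
    rw [← shiftComm_symm]; rfl
  have e' : (shiftComm (F.obj X) m n).inv = (shiftFunctorComm D' n m).hom.app (F.obj X) := by
    rw [← shiftComm_symm]; rfl
  rw [e, e', this]
  simp only [Category.assoc, Iso.inv_hom_id_app_assoc]
  rw [← Functor.map_comp, Iso.inv_hom_id_app]
  erw [Functor.map_id]
  simp

/-- The hypotheses `hε` and `hε'` say that the signs act trivially, as they do in characteristic 2.
The identity is then the image under F of the one for G, glued to two naturality squares of the
shift isomorphisms of F and to the compatibility of F with the exchange of shifts. -/
theorem Functor.commShift₂_comm_postcomp (h : CommShift₂Setup D M) (h' : CommShift₂Setup D' M)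
    (hε : ∀ m n X, (h.ε m n).val.app X = 𝟙 X) (hε' : ∀ m n X, (h'.ε m n).val.app X = 𝟙 X)
    [G.CommShift₂ h] (X : C₁) (Y : C₂) (m n : M) :
    ((G.obj (X⟦m⟧) ⋙ F).commShiftIso n).hom.app Y ≫
      (((G.flip.obj Y ⋙ F).commShiftIso m).hom.app X)⟦n⟧' =
    ((G.flip.obj (Y⟦n⟧) ⋙ F).commShiftIso m).hom.app X ≫
      (((G.obj X ⋙ F).commShiftIso n).hom.app Y)⟦m⟧' ≫
      (shiftComm (F.obj ((G.obj X).obj Y)) m n).inv ≫ (h'.ε m n).val.app _ := by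
  have H := congrArg F.map (G.commShift₂_comm h X Y m n)
  rw [hε, Category.comp_id] at H
  simp only [Functor.map_comp] at H
  rw [commShiftIso_comp_hom_app, commShiftIso_comp_hom_app, commShiftIso_comp_hom_app,
    commShiftIso_comp_hom_app, Functor.map_comp, Functor.map_comp, hε', Category.comp_id]
  have h1 := F.commShiftIso_hom_naturality (((G.flip.obj Y).commShiftIso m).hom.app X) n
  have h2 := F.commShiftIso_hom_naturality (((G.obj X).commShiftIso n).hom.app Y) m
  have h3 := F.map_shiftComm_inv ((G.obj X).obj Y) m n
  simp only [Category.assoc]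
  refine Eq.trans (congrArg (F.map (((G.obj (X⟦m⟧)).commShiftIso n).hom.app Y) ≫ ·)
    ((reassoc_of% h1) _).symm) ?_
  refine Eq.trans ?_ (congrArg (F.map (((G.flip.obj (Y⟦n⟧)).commShiftIso m).hom.app X) ≫ ·)
    ((reassoc_of% h2) _))
  rw [← h3]
  exact (reassoc_of% H) _

/-- The composition of a bifunctor commuting with the shifts and of a functor commuting with the
shift. -/
abbrev Functor.CommShift₂.postcomp (h : CommShift₂Setup D M) (h' : CommShift₂Setup D' M)
    (hε : ∀ m n X, (h.ε m n).val.app X = 𝟙 X) (hε' : ∀ m n X, (h'.ε m n).val.app X = 𝟙 X)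
    [G.CommShift₂ h] : (G ⋙ (Functor.whiskeringRight C₂ D D').obj F).CommShift₂ h' where
  commShiftObj X := inferInstanceAs ((G.obj X ⋙ F).CommShift M)
  commShift_map f := inferInstanceAs (NatTrans.CommShift (Functor.whiskerRight (G.map f) F) M)
  commShiftFlipObj Y := inferInstanceAs ((G.flip.obj Y ⋙ F).CommShift M)
  commShift_flip_map g :=
    inferInstanceAs (NatTrans.CommShift (Functor.whiskerRight (G.flip.map g) F) M)
  comm X Y m n := Functor.commShift₂_comm_postcomp G F h h' hε hε' X Y m n

end Postcomp

section Quot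

set_option linter.unusedSectionVars false

theorem Quotient.lift_commShiftIso_hom_app (r : HomRel C₁) [r.IsCompatibleWithShift M]
    (F : C₁ ⥤ D) [F.CommShift M]
    (hF : ∀ (x y : C₁) (f₁ f₂ : x ⟶ y), r f₁ f₂ → F.map f₁ = F.map f₂) (X : C₁) (m : M) :
    ((Quotient.lift r F hF).commShiftIso m).hom.app ((Quotient.functor r).obj X) =
      (Quotient.lift r F hF).map (((Quotient.functor r).commShiftIso m).inv.app X) ≫
      (F.commShiftIso m).hom.app X := by
  rw [Quotient.liftCommShift_commShiftIso]
  exact Quotient.LiftCommShift.iso_hom_app ..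

variable (r₂ : HomRel C₂) [r₂.IsCompatibleWithShift M]

/-- Descending a bifunctor to a quotient of its second argument. -/
abbrev Quotient.lift₂ (G : C₁ ⥤ C₂ ⥤ D)
    (hG : ∀ X (x y : C₂) (f g : x ⟶ y), r₂ f g → (G.obj X).map f = (G.obj X).map g) :
    C₁ ⥤ Quotient r₂ ⥤ D where
  obj X := Quotient.lift r₂ (G.obj X) (hG X)
  map f := { app := fun Y => (G.map f).app Y.as
             naturality := by
              rintro ⟨Y⟩ ⟨Y'⟩ g
              obtain ⟨g, rfl⟩ := (Quotient.functor r₂).map_surjective (X := Y) (Y := Y') g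
              exact (G.map f).naturality g }
  map_id X := by ext Y; exact congrArg (fun t => t.app Y.as) (G.map_id X)
  map_comp f g := by ext Y; exact congrArg (fun t => t.app Y.as) (G.map_comp f g)

variable (G : C₁ ⥤ C₂ ⥤ D)
    (hG : ∀ X (x y : C₂) (f g : x ⟶ y), r₂ f g → (G.obj X).map f = (G.obj X).map g)

/-- On a representative Y, the shift isomorphism of the descended functor is the original one
preceded by the image of the comparison between the two shifts of Y. The claim follows from the one
upstairs and from naturality along this comparison. -/
theorem Quotient.lift_commShift_map [∀ X, (G.obj X).CommShift M] {X X' : C₁} (f : X ⟶ X')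
    [NatTrans.CommShift (G.map f) M] :
    NatTrans.CommShift (F₁ := Quotient.lift r₂ (G.obj X) (hG X))
      (F₂ := Quotient.lift r₂ (G.obj X') (hG X')) ((Quotient.lift₂ r₂ G hG).map f) M := ⟨fun m => by
    ext ⟨Y⟩
    have h1 := NatTrans.shift_app_comm (G.map f) m Y
    have h2 := ((Quotient.lift₂ r₂ G hG).map f).naturality
      (((Quotient.functor r₂).commShiftIso m).inv.app Y)
    have e1 := Quotient.lift_commShiftIso_hom_app r₂ (G.obj X) (hG X) Y m
    have e2 := Quotient.lift_commShiftIso_hom_app r₂ (G.obj X') (hG X') Y m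
    refine (congrArg (· ≫ ((G.map f).app Y)⟦m⟧') e1).trans ?_
    refine Eq.trans ?_ (congrArg
      (((Quotient.lift₂ r₂ G hG).map f).app (((Quotient.functor r₂).obj Y)⟦m⟧) ≫ ·) e2.symm)
    refine (Category.assoc _ _ _).trans ?_
    refine Eq.trans ?_ (Category.assoc _ _ _)
    refine (congrArg (_ ≫ ·) h1).trans ?_
    refine (Category.assoc _ _ _).symm.trans ?_
    exact congrArg (· ≫ ((G.obj X').commShiftIso m).hom.app Y) h2⟩

theorem Quotient.lift_commShift_flip_map (h : CommShift₂Setup D M) [G.CommShift₂ h]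
    {Y Y' : Quotient r₂} (g : Y ⟶ Y') :
    NatTrans.CommShift (F₁ := G.flip.obj Y.as) (F₂ := G.flip.obj Y'.as)
      ((Quotient.lift₂ r₂ G hG).flip.map g) M := by
  obtain ⟨Y⟩ := Y
  obtain ⟨Y'⟩ := Y'
  obtain ⟨g, rfl⟩ := (Quotient.functor r₂).map_surjective (X := Y) (Y := Y') g
  exact inferInstanceAs (NatTrans.CommShift (G.flip.map g) M)

/-- The shift of an object in the quotient is compared with the image of the shifted representative
through a nontrivial structural isomorphism. Since the shift isomorphisms in the first variable are
natural along it (`h3`), the identity reduces to the one for G. -/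
theorem Quotient.lift_commShift₂_comm (h : CommShift₂Setup D M) [G.CommShift₂ h]
    (hε : ∀ m n X, (h.ε m n).val.app X = 𝟙 X) (X : C₁) (Y : Quotient r₂) (m n : M) :
    ((Quotient.lift r₂ (G.obj (X⟦m⟧)) (hG _)).commShiftIso n).hom.app Y ≫
      (((G.flip.obj Y.as).commShiftIso m).hom.app X)⟦n⟧' =
    ((G.flip.obj (Y⟦n⟧).as).commShiftIso m).hom.app X ≫
      (((Quotient.lift r₂ (G.obj X) (hG X)).commShiftIso n).hom.app Y)⟦m⟧' ≫
      (shiftComm ((G.obj X).obj Y.as) m n).inv ≫ (h.ε m n).val.app _ := by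
  obtain ⟨Y⟩ := Y
  have H := G.commShift₂_comm h X Y m n
  rw [hε, Category.comp_id] at H ⊢
  have e1 := Quotient.lift_commShiftIso_hom_app r₂ (G.obj (X⟦m⟧)) (hG _) Y n
  have e2 := Quotient.lift_commShiftIso_hom_app r₂ (G.obj X) (hG X) Y n
  let g := ((Quotient.functor r₂).commShiftIso n).inv.app Y
  have := Quotient.lift_commShift_flip_map r₂ G hG h g
  have h3 := NatTrans.shift_app_comm (F₁ := G.flip.obj (((Quotient.functor r₂).obj Y)⟦n⟧).as)
    (F₂ := G.flip.obj (Y⟦n⟧)) ((Quotient.lift₂ r₂ G hG).flip.map g) m X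
  refine (congrArg (· ≫ (((G.flip.obj Y).commShiftIso m).hom.app X)⟦n⟧') e1).trans ?_
  refine Eq.trans ?_ (congrArg (fun t =>
    ((G.flip.obj (((Quotient.functor r₂).obj Y)⟦n⟧).as).commShiftIso m).hom.app X ≫ t⟦m⟧' ≫
      (shiftComm ((G.obj X).obj Y) m n).inv) e2.symm)
  rw [Functor.map_comp]
  refine (Category.assoc _ _ _).trans ((congrArg (_ ≫ ·) H).trans ?_)
  refine ((Category.assoc _ _ _).symm.trans (congrArg (· ≫ _) h3.symm)).trans ?_
  simp only [Category.assoc]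
  rfl

/-- A bifunctor commuting with the shifts still does so after descending to a quotient of its second
argument. -/
abbrev Functor.CommShift₂.lift₂ (h : CommShift₂Setup D M) [G.CommShift₂ h]
    (hε : ∀ m n X, (h.ε m n).val.app X = 𝟙 X) : (Quotient.lift₂ r₂ G hG).CommShift₂ h where
  commShiftObj X := inferInstanceAs ((Quotient.lift r₂ (G.obj X) (hG X)).CommShift M)
  commShift_map f := Quotient.lift_commShift_map r₂ G hG f
  commShiftFlipObj Y := inferInstanceAs ((G.flip.obj Y.as).CommShift M)
  commShift_flip_map g := Quotient.lift_commShift_flip_map r₂ G hG h g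
  comm X Y m n := Quotient.lift_commShift₂_comm r₂ G hG h hε X Y m n

end Quot

section Flip

/-- Exchanging the arguments of a bifunctor commuting with the shifts. -/
abbrev Functor.CommShift₂.flip (G : C₁ ⥤ C₂ ⥤ D) (h : CommShift₂Setup D M) [G.CommShift₂ h]
    (hε : ∀ m n X, (h.ε m n).val.app X = 𝟙 X) : G.flip.CommShift₂ h where
  commShiftObj Y := inferInstanceAs ((G.flip.obj Y).CommShift M)
  commShift_map g := inferInstanceAs (NatTrans.CommShift (G.flip.map g) M)
  commShiftFlipObj X := inferInstanceAs ((G.obj X).CommShift M)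
  commShift_flip_map f := inferInstanceAs (NatTrans.CommShift (G.map f) M)
  comm Y X n m := by
    have H := G.commShift₂_comm h X Y m n
    rw [hε, Category.comp_id] at H ⊢
    refine Eq.trans ?_ ((congrArg (· ≫ (shiftComm ((G.obj X).obj Y) n m).inv) H.symm).trans
      (Category.assoc _ _ _))
    simp only [Category.assoc]
    rw [← shiftComm_symm ((G.obj X).obj Y) m n, Iso.symm_inv, Iso.inv_hom_id]
    exact (congrArg (_ ≫ ·) (Category.comp_id _)).symm

end Flip

section Lift

variable (G : C₁ ⥤ C₂ ⥤ D) (Q : ObjectProperty D) [Q.IsStableUnderShift M]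
  (hQ : ∀ X Y, Q ((G.obj X).obj Y))

/-- Lifting a bifunctor to a full subcategory of its target. -/
abbrev ObjectProperty.lift₂ : C₁ ⥤ C₂ ⥤ Q.FullSubcategory where
  obj X := Q.lift (G.obj X) (hQ X)
  map f := { app := fun Y => ObjectProperty.homMk ((G.map f).app Y)
             naturality := fun Y Y' g => by
              ext; exact (G.map f).naturality g }
  map_id X := by ext Y; exact congrArg (fun t => t.app Y) (G.map_id X)
  map_comp f g := by ext Y; exact congrArg (fun t => t.app Y) (G.map_comp f g)

/-- This determines the shift isomorphism of a lifted functor after the faithful inclusion is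
applied, so identities in the full subcategory can be checked in the ambient category. -/
theorem ObjectProperty.ι_map_lift_commShiftIso (F : C₁ ⥤ D) [F.CommShift M]
    (hF : ∀ X, Q (F.obj X)) (m : M) (X : C₁) :
    Q.ι.map (((Q.lift F hF).commShiftIso m).hom.app X) ≫
      (Q.ι.commShiftIso m).hom.app ((Q.lift F hF).obj X) = (F.commShiftIso m).hom.app X := by
  have := NatTrans.shift_app_comm (Q.liftCompιIso F hF).hom m X
  rw [Functor.commShiftIso_comp_hom_app] at this
  refine Eq.trans ?_ (this.trans (Category.id_comp _))
  refine Eq.trans ?_ (congrArg (_ ≫ ·) ((shiftFunctor D m).map_id _).symm)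
  exact (Category.comp_id _).symm

theorem ObjectProperty.lift_commShift_map {F F' : C₁ ⥤ D} [F.CommShift M] [F'.CommShift M]
    (hF : ∀ X, Q (F.obj X)) (hF' : ∀ X, Q (F'.obj X)) (τ : F ⟶ F') [NatTrans.CommShift τ M]
    (τ' : Q.lift F hF ⟶ Q.lift F' hF') (hτ : ∀ X, Q.ι.map (τ'.app X) = τ.app X) :
    NatTrans.CommShift τ' M := ⟨fun m => by
  ext X : 2
  refine Q.ι.map_injective ?_
  rw [← cancel_mono ((Q.ι.commShiftIso m).hom.app _)]
  have h1 := Q.ι_map_lift_commShiftIso F hF m X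
  have h2 := Q.ι_map_lift_commShiftIso F' hF' m X
  have h3 := NatTrans.shift_app_comm τ m X
  rw [← hτ, ← hτ, ← h1, ← h2] at h3
  have h4 := Q.ι.commShiftIso_hom_naturality (τ'.app X) m
  simp only [NatTrans.comp_app, Functor.map_comp, Category.assoc] at h3 ⊢
  exact (congrArg (_ ≫ ·) h4).trans h3⟩

theorem ObjectProperty.lift_commShift₂_comm (h : CommShift₂Setup D M)
    (h' : CommShift₂Setup Q.FullSubcategory M)
    (hε : ∀ m n X, (h.ε m n).val.app X = 𝟙 X) (hε' : ∀ m n X, (h'.ε m n).val.app X = 𝟙 X)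
    [G.CommShift₂ h] (X : C₁) (Y : C₂) (m n : M) :
    ((Q.lift (G.obj (X⟦m⟧)) (hQ _)).commShiftIso n).hom.app Y ≫
      (((Q.lift (G.flip.obj Y) (fun X => hQ X Y)).commShiftIso m).hom.app X)⟦n⟧' =
    ((Q.lift (G.flip.obj (Y⟦n⟧)) (fun X => hQ X _)).commShiftIso m).hom.app X ≫
      (((Q.lift (G.obj X) (hQ X)).commShiftIso n).hom.app Y)⟦m⟧' ≫
      (shiftComm ((Q.lift (G.obj X) (hQ X)).obj Y) m n).inv ≫ (h'.ε m n).val.app _ := by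
  have H := G.commShift₂_comm h X Y m n
  rw [hε, Category.comp_id] at H
  rw [hε', Category.comp_id]
  refine Q.ι.map_injective ?_
  have e1 := Q.ι_map_lift_commShiftIso (G.obj (X⟦m⟧)) (hQ _) n Y
  have e2 := Q.ι_map_lift_commShiftIso (G.obj X) (hQ _) n Y
  have e3 := Q.ι_map_lift_commShiftIso (G.flip.obj Y) (fun X => hQ X Y) m X
  have e4 := Q.ι_map_lift_commShiftIso (G.flip.obj (Y⟦n⟧)) (fun X => hQ X _) m X
  have n1 := Q.ι.commShiftIso_hom_naturality
    (((Q.lift (G.flip.obj Y) (fun X => hQ X Y)).commShiftIso m).hom.app X) n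
  have n2 := Q.ι.commShiftIso_hom_naturality
    (((Q.lift (G.obj X) (hQ X)).commShiftIso n).hom.app Y) m
  have h3 := Q.ι.map_shiftComm_inv ((Q.lift (G.obj X) (hQ X)).obj Y) m n
  -- Both sides are composed with the isomorphisms by which the inclusion commutes with the two
  -- shifts; this brings them to the form of `H`.
  rw [← cancel_mono ((Q.ι.commShiftIso n).hom.app (((Q.lift (G.obj X) (hQ X)).obj Y)⟦m⟧)),
    ← cancel_mono (((Q.ι.commShiftIso m).hom.app ((Q.lift (G.obj X) (hQ X)).obj Y))⟦n⟧')]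
  rw [← e1, ← e2, ← e3, ← e4] at H
  simp only [Functor.map_comp, Category.assoc] at H ⊢
  refine (congrArg (_ ≫ ·) ((reassoc_of% n1) _)).trans (H.trans ?_)
  refine congrArg (_ ≫ ·) ?_
  refine Eq.trans ?_ (congrArg (_ ≫ ·) h3.symm)
  exact ((reassoc_of% n2) _).symm

/-- A bifunctor commuting with the shifts still does so after lifting it to a full subcategory of
its target. -/
abbrev Functor.CommShift₂.liftTarget (h : CommShift₂Setup D M)
    (h' : CommShift₂Setup Q.FullSubcategory M)
    (hε : ∀ m n X, (h.ε m n).val.app X = 𝟙 X) (hε' : ∀ m n X, (h'.ε m n).val.app X = 𝟙 X)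
    [G.CommShift₂ h] : (ObjectProperty.lift₂ G Q hQ).CommShift₂ h' where
  commShiftObj X := inferInstanceAs ((Q.lift (G.obj X) (hQ X)).CommShift M)
  commShift_map {X X'} f := Q.lift_commShift_map (hQ X) (hQ X') (G.map f) _ fun _ => rfl
  commShiftFlipObj Y := inferInstanceAs ((Q.lift (G.flip.obj Y) (fun X => hQ X Y)).CommShift M)
  commShift_flip_map {Y Y'} g := Q.lift_commShift_map (fun X => hQ X Y) (fun X => hQ X Y')
    (G.flip.map g) _ fun _ => rfl
  comm X Y m n := ObjectProperty.lift_commShift₂_comm G Q hQ h h' hε hε' X Y m n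

end Lift

end CategoryTheory
end

/-! ### The bifunctor on DG modules and its shifts -/

noncomputable section

namespace UTCat

/-- The condition that the two ways of exchanging a bifunctor with shifts in both of its arguments
agree. -/
def _root_.CategoryTheory.Functor.ShiftsCommute {C₁ C₂ D : Type*} [Category* C₁] [Category* C₂]
    [Category* D] [HasShift C₁ ℤ] [HasShift C₂ ℤ] [HasShift D ℤ] (G : C₁ ⥤ C₂ ⥤ D)
    [∀ X, (G.obj X).CommShift ℤ] [∀ Y, (G.flip.obj Y).CommShift ℤ] (X : C₁) (Y : C₂) (m n : ℤ) :
    Prop :=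
  ((G.obj (X⟦m⟧)).commShiftIso n).hom.app Y ≫ (((G.flip.obj Y).commShiftIso m).hom.app X)⟦n⟧' =
    ((G.flip.obj (Y⟦n⟧)).commShiftIso m).hom.app X ≫ (((G.obj X).commShiftIso n).hom.app Y)⟦m⟧' ≫
      (shiftComm ((G.obj X).obj Y) m n).inv

open DGMod

namespace DGMod

variable {R : DGAlg}

/-- The identity as a map of degree `s` from `M.twist s` to `M`. -/
def ofTwist (M : DGMod R) (s : ℤ × ℤ) : M.twist s →ₗ[R] M := LinearMap.id

/-- The identity as a map of degree `-s` from `M` to `M.twist s`. -/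
def toTwist (M : DGMod R) (s : ℤ × ℤ) : M →ₗ[R] M.twist s := LinearMap.id

theorem ofTwist_deg (M : DGMod R) (s : ℤ × ℤ) : HasDeg (M.ofTwist s) s := fun h => h

theorem toTwist_deg (M : DGMod R) (s : ℤ × ℤ) : HasDeg (M.toTwist s) (-s) := fun {p x} h => by
  change x ∈ M.gr (p + -s + s)
  rwa [neg_add_cancel_right]

theorem id_deg (M : DGMod R) : HasDeg (LinearMap.id : M →ₗ[R] M) 0 := fun {p x} h => by
  rwa [add_zero]

end DGMod

section Bilinear

variable {R : DGAlg} (N : DGBimod R AA) (X X' Y Y' : DGMod A)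

namespace DGBimod

variable {X X' Y Y'} in
theorem tensL_comm {f : X →ₗ[A] X'} {g : Y →ₗ[A] Y'} (hf : ∀ x, f (X.d x) = X'.d (f x))
    (hg : ∀ y, g (Y.d y) = Y'.d (g y)) (z : N.tens X Y) :
    N.tensL f g ((N.tens X Y).d z) = (N.tens X' Y').d (N.tensL f g z) := by
  have h := N.tensL_d (f := f) (g := g) (f' := 0) (g' := 0)
    (fun x => by rw [hf, DGMod.add_self]; rfl) (fun y => by rw [hg, DGMod.add_self]; rfl) z
  rw [tensL_zero_left, tensL_zero_right, LinearMap.zero_apply, add_zero] at h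
  rwa [← sub_eq_zero, DGMod.sub_eq_add]

variable {X X' Y Y'} in
theorem tensL_inv {f : X →ₗ[A] X'} {g : Y →ₗ[A] Y'} {f' : X' →ₗ[A] X} {g' : Y' →ₗ[A] Y}
    (hf : f'.comp f = LinearMap.id) (hg : g'.comp g = LinearMap.id) (z : N.tens X Y) :
    N.tensL f' g' (N.tensL f g z) = z := by
  have := LinearMap.congr_fun (N.tensL_comp f f' g g') z
  rw [hf, hg, tensL_id] at this
  exact this

/-- The comparison of `N ⊗ (X ⊗ Y[s])` and `(N ⊗ (X ⊗ Y))[s]`. -/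
def tensTwistRight (s : ℤ × ℤ) : N.tens X (Y.twist s) ≅ (N.tens X Y).twist s :=
  mkIso (N := (N.tens X Y).twist s) (N.tensL LinearMap.id (Y.ofTwist s))
    (N.tensL LinearMap.id (Y.toTwist s))
    (fun {p x} h => by
      have h1 : HasDeg (N.tensL (LinearMap.id : X →ₗ[A] X) (Y.ofTwist s)) s :=
        N.tensL_deg' (a := 0) X.id_deg (Y.ofTwist_deg s) (zero_add s)
      rw [add_zero]
      exact h1 h)
    (fun {p x} (h : x ∈ (N.tens X Y).gr (p + s)) => by
      have h1 : HasDeg (N.tensL (LinearMap.id : X →ₗ[A] X) (Y.toTwist s)) (-s) :=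
        N.tensL_deg' (a := 0) X.id_deg (Y.toTwist_deg s) (zero_add _)
      have := h1 h
      rwa [add_neg_cancel_right, ← add_zero p] at this)
    (fun x => N.tensL_comm (fun _ => rfl) (fun _ => rfl) x)
    (fun x => N.tensL_inv rfl rfl x) (fun x => N.tensL_inv rfl rfl x)

/-- The comparison of `N ⊗ (X[s] ⊗ Y)` and `(N ⊗ (X ⊗ Y))[t]`, for a degree `t` that depends on
the parity of `Y`. -/
def tensTwistLeft (s t : ℤ × ℤ) (c : ℤ)
    (h : ∀ j, ∀ y ∈ parityGr Y j, y ≠ 0 → 2 * s.2 * j.2 = c) (ht : t = s + (c, 0)) :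
    N.tens (X.twist s) Y ≅ (N.tens X Y).twist t :=
  mkIso (N := (N.tens X Y).twist t) (N.tensL (X.ofTwist s) LinearMap.id)
    (N.tensL (X.toTwist s) LinearMap.id)
    (fun {p x} h' => by
      have h1 : HasDeg (N.tensL (X.ofTwist s) (LinearMap.id : Y →ₗ[A] Y)) (s + 0 + (c, 0)) :=
        N.tensL_deg (X.ofTwist_deg s) Y.id_deg h
      rw [add_zero, ← ht] at h1
      rw [add_zero]
      exact h1 h')
    (fun {p x} (h' : x ∈ (N.tens X Y).gr (p + t)) => by
      have h1 : HasDeg (N.tensL (X.toTwist s) (LinearMap.id : Y →ₗ[A] Y)) (-s + 0 + (-c, 0)) :=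
        N.tensL_deg (X.toTwist_deg s) Y.id_deg fun j y hy h0 => by simp [← h j y hy h0]
      have := h1 h'
      rwa [show p + t + (-s + 0 + (-c, 0)) = p + 0 by rw [ht]; ext <;> simp <;> ring] at this)
    (fun x => N.tensL_comm (fun _ => rfl) (fun _ => rfl) x)
    (fun x => N.tensL_inv rfl rfl x) (fun x => N.tensL_inv rfl rfl x)

/-- The bifunctor `(X, Y) ↦ N ⊗ (X ⊗ Y)` on DG modules. -/
def bifunctor : DGMod A ⥤ DGMod A ⥤ DGMod R where
  obj X :=
    { obj := fun Y => N.tens X Y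
      map := fun v => N.tensorMap (chiMap (𝟙 X) v)
      map_id := fun Y => DGMod.hom_ext fun z => LinearMap.congr_fun (N.tensL_id (X := X)) z
      map_comp := fun v w => DGMod.hom_ext fun z =>
        (LinearMap.congr_fun (N.tensL_comp LinearMap.id LinearMap.id v.f w.f) z).symm }
  map u :=
    { app := fun Y => N.tensorMap (chiMap u (𝟙 Y))
      naturality := fun Y Y' v => DGMod.hom_ext fun z =>
        (LinearMap.congr_fun (N.tensL_comp LinearMap.id u.f v.f LinearMap.id) z).trans
          (LinearMap.congr_fun (N.tensL_comp u.f LinearMap.id LinearMap.id v.f) z).symm }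
  map_id X := by
    ext Y : 2
    exact DGMod.hom_ext fun z => LinearMap.congr_fun (N.tensL_id (X := X)) z
  map_comp u u' := by
    ext Y : 2
    exact DGMod.hom_ext fun z =>
      (LinearMap.congr_fun (N.tensL_comp u.f u'.f LinearMap.id LinearMap.id) z).symm

theorem hom_ext_pure {X Y : DGMod A} {V : DGMod R} {φ ψ : N.tens X Y ⟶ V}
    (h : ∀ n x y, φ.f (N.pure₂ n x y) = ψ.f (N.pure₂ n x y)) : φ = ψ :=
  DGMod.hom_ext fun z => LinearMap.congr_fun (N.tens_hom_ext h) z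

/-- The comparison map is the identity on the classes of n ⊗ x ⊗ y, which generate, so naturality
and coherence need only be checked there. -/
instance (X : DGMod A) : (N.bifunctor.obj X).CommShift ℤ where
  commShiftIso n := NatIso.ofComponents (fun Y => N.tensTwistRight X Y (n, 0)) (by
    intro Y Y' v
    exact N.hom_ext_pure fun _ _ _ => rfl)
  commShiftIso_zero := by
    ext Y : 3
    rw [Functor.CommShift.isoZero_hom_app]
    exact N.hom_ext_pure fun n x y => ((shiftFunctorZero_inv_f (N.tens X Y) _).trans
      (congrArg (N.pure₂ n x) (shiftFunctorZero_hom_f Y y))).symm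
  commShiftIso_add a b := by
    ext Y : 3
    rw [Functor.CommShift.isoAdd_hom_app]
    exact N.hom_ext_pure fun n x y => ((shiftFunctorAdd_inv_f a b (N.tens X Y) _).trans
      (congrArg (N.pure₂ n x) (shiftFunctorAdd_hom_f a b Y y))).symm

/-- The shift [n] has t-degree 0, so the parity correction c is 0 whatever the parities occurring in
Y, and no hypothesis on Y is needed. -/
instance (Y : DGMod A) : (N.bifunctor.flip.obj Y).CommShift ℤ where
  commShiftIso n := NatIso.ofComponents
    (fun X => N.tensTwistLeft X Y (n, 0) (n, 0) 0 (fun _ _ _ _ => by simp) (add_zero _).symm) (by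
    intro X X' v
    exact N.hom_ext_pure fun _ _ _ => rfl)
  commShiftIso_zero := by
    ext X : 3
    rw [Functor.CommShift.isoZero_hom_app]
    exact N.hom_ext_pure fun n x y => ((shiftFunctorZero_inv_f (N.tens X Y) _).trans
      (congrArg (fun x => N.pure₂ n x y) (shiftFunctorZero_hom_f X x))).symm
  commShiftIso_add a b := by
    ext X : 3
    rw [Functor.CommShift.isoAdd_hom_app]
    exact N.hom_ext_pure fun n x y => ((shiftFunctorAdd_inv_f a b (N.tens X Y) _).trans
      (congrArg (fun x => N.pure₂ n x y) (shiftFunctorAdd_hom_f a b X x))).symm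

theorem bifunctor_commShiftIso_f (n : ℤ) (k : N.carrier) (x : X) (y : Y.twist (n, 0)) :
    (((N.bifunctor.obj X).commShiftIso n).hom.app Y).f (N.pure₂ (Y := Y.twist (n, 0)) k x y) =
      N.pure₂ (Y := Y) k x y := rfl

theorem bifunctor_flip_commShiftIso_f (n : ℤ) (k : N.carrier) (x : X.twist (n, 0)) (y : Y) :
    (((N.bifunctor.flip.obj Y).commShiftIso n).hom.app X).f (N.pure₂ (X := X.twist (n, 0)) k x y) =
      N.pure₂ (X := X) k x y := rfl

theorem _root_.UTCat.DGMod.comp_apply {M M' M'' : DGMod R} (u : M ⟶ M') (v : M' ⟶ M'') (x : M) :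
    (u ≫ v).f x = v.f (u.f x) := rfl

theorem bifunctor_comm (X Y : DGMod A) (m n : ℤ) : N.bifunctor.ShiftsCommute X Y m n := by
  have h1 := N.bifunctor_commShiftIso_f (X⟦m⟧) Y n
  have h2 := N.bifunctor_flip_commShiftIso_f X Y m
  have h3 := N.bifunctor_flip_commShiftIso_f X (Y⟦n⟧) m
  have h4 := N.bifunctor_commShiftIso_f X Y n
  have h5 := DGMod.shiftFunctorComm_inv_f m n ((N.bifunctor.obj X).obj Y)
  unfold Functor.ShiftsCommute
  -- Only the values of the five isomorphisms on the classes of k ⊗ x ⊗ y matter from here on, and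
  -- there each of them is the identity.
  generalize ((N.bifunctor.obj (X⟦m⟧)).commShiftIso n).hom.app Y = α at h1 ⊢
  generalize ((N.bifunctor.flip.obj Y).commShiftIso m).hom.app X = β at h2 ⊢
  generalize ((N.bifunctor.flip.obj (Y⟦n⟧)).commShiftIso m).hom.app X = β' at h3 ⊢
  generalize ((N.bifunctor.obj X).commShiftIso n).hom.app Y = α' at h4 ⊢
  change ∀ z, (shiftComm ((N.bifunctor.obj X).obj Y) m n).inv.f z = z at h5
  generalize (shiftComm ((N.bifunctor.obj X).obj Y) m n).inv = γ at h5 ⊢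
  refine N.hom_ext_pure fun k x y => ?_
  refine (DGMod.comp_apply α _ _).trans ?_
  refine ((congrArg _ (h1 k x y)).trans (h2 k x y)).trans (Eq.symm ?_)
  refine (DGMod.comp_apply β' _ _).trans ?_
  refine (congrArg _ (h3 k x y)).trans ?_
  refine (DGMod.comp_apply _ γ _).trans ?_
  exact (h5 _).trans (h4 k x y)

end DGBimod
end Bilinear

end UTCat

end

/-! ### Descent of the bifunctor to the homotopy category -/

noncomputable section

namespace UTCat

open DGMod

/-- The sign is the power (-1)^(mn) in the units of the centre of the category, where -1 = 1 because
f + f = 0. -/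
theorem _root_.CategoryTheory.CommShift₂Setup.int_ε_app {D : Type*} [Category* D] [Preadditive D]
    [HasShift D ℤ] [∀ n : ℤ, (shiftFunctor D n).Additive]
    (hD : ∀ {X Y : D} (f : X ⟶ Y), f + f = 0) (m n : ℤ) (X : D) :
    ((CommShift₂Setup.int (D := D)).ε m n).val.app X = 𝟙 X := by
  have h : (-1 : (CatCenter D)ˣ) = 1 := by
    ext X
    simp only [Units.val_neg, Units.val_one]
    change -(𝟙 X) = 𝟙 X
    exact neg_eq_of_add_eq_zero_left (hD _)
  change ((((-1 : (CatCenter D)ˣ) ^ (m * n) : (CatCenter D)ˣ)) : CatCenter D).app X = _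
  rw [h, one_zpow]
  rfl

theorem DGMod.hom_add_self {R : DGAlg} {M M' : DGMod R} (u : M ⟶ M') : u + u = 0 :=
  hom_ext fun x => DGMod.add_self (M := M') (u.f x)

namespace DGBimod

variable {R : DGAlg} (N : DGBimod R AA)

instance : N.bifunctor.CommShift₂Int where
  commShift_map {X X'} u := ⟨fun n => by
    ext Y : 2
    exact N.hom_ext_pure fun _ _ _ => rfl⟩
  commShift_flip_map {Y Y'} v := ⟨fun n => by
    ext X : 2
    exact N.hom_ext_pure fun _ _ _ => rfl⟩
  comm X Y m n := by
    rw [CommShift₂Setup.int_ε_app DGMod.hom_add_self]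
    have := N.bifunctor_comm X Y m n
    unfold Functor.ShiftsCommute at this
    rw [this, Category.comp_id]

/-- The bifunctor `(X, Y) ↦ N ⊗ (X ⊗ Y)` from DG modules to the homotopy category. -/
abbrev toKBifunctor : DGMod A ⥤ DGMod A ⥤ K R :=
  N.bifunctor ⋙ (Functor.whiskeringRight _ _ _).obj (toK R)

instance : N.toKBifunctor.CommShift₂Int :=
  Functor.CommShift₂.postcomp _ _ _ _ (CommShift₂Setup.int_ε_app DGMod.hom_add_self)
    (CommShift₂Setup.int_ε_app toK_hom_add_self)

/-- If h is a homotopy from u to v, then 1 ⊗ h is one from 1 ⊗ u to 1 ⊗ v, by the Leibniz rule and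
the closedness of the identity. -/
theorem toKBifunctor_map_right (X : DGMod A) {Y Y' : DGMod A} {u v : Y ⟶ Y'}
    (h : homotopic A u v) : (N.toKBifunctor.obj X).map u = (N.toKBifunctor.obj X).map v := by
  obtain ⟨h, hh, e⟩ := h
  refine toK_map_eq (N.tensL LinearMap.id h)
    (N.tensL_deg' (a := 0) X.id_deg hh (zero_add _)) fun z => ?_
  have := N.tensL_d (f := LinearMap.id) (f' := 0) (g := h) (g' := u.f + v.f)
    (fun x : X => DGMod.add_self _) (fun y => by
      rw [add_comm, ← e, DGMod.sub_eq_add]; rfl) z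
  rw [tensL_zero_left, tensL_add_right] at this
  exact ((zero_add _).symm.trans this.symm).trans (add_comm _ _)

theorem toKBifunctor_map_left {X X' : DGMod A} {u v : X ⟶ X'} (h : homotopic A u v) :
    N.toKBifunctor.map u = N.toKBifunctor.map v := by
  obtain ⟨h, hh, e⟩ := h
  ext Y : 2
  refine toK_map_eq (N.tensL h LinearMap.id)
    (N.tensL_deg' (a := -1) hh Y.id_deg (add_zero _)) fun z => ?_
  have := N.tensL_d (f := h) (f' := u.f + v.f) (g := LinearMap.id) (g' := 0)
    (fun x => by rw [add_comm, ← e, DGMod.sub_eq_add]; rfl)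
    (fun x : Y => DGMod.add_self _) z
  rw [tensL_zero_right, tensL_add_left] at this
  exact ((add_zero _).symm.trans this.symm).trans (add_comm _ _)

/-- The bifunctor `(X, Y) ↦ N ⊗ (X ⊗ Y)` with its second argument in the homotopy category. -/
abbrev rightKBifunctor : DGMod A ⥤ K A ⥤ K R :=
  CategoryTheory.Quotient.lift₂ (homotopic A) N.toKBifunctor
    fun X _ _ _ _ h => N.toKBifunctor_map_right X h

instance : N.rightKBifunctor.CommShift₂Int :=
  Functor.CommShift₂.lift₂ _ _ _ _ (CommShift₂Setup.int_ε_app toK_hom_add_self)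

/-- The arguments descend to the quotient one at a time. As `Quotient.lift₂` treats the second
argument, they are exchanged before the second descent and exchanged back after it. -/
instance : N.rightKBifunctor.flip.CommShift₂Int :=
  Functor.CommShift₂.flip _ _ (CommShift₂Setup.int_ε_app toK_hom_add_self)

/-- The bifunctor `(X, Y) ↦ N ⊗ (X ⊗ Y)` on the homotopy category, with exchanged arguments. -/
abbrev flipKBifunctor : K A ⥤ K A ⥤ K R :=
  CategoryTheory.Quotient.lift₂ (homotopic A) N.rightKBifunctor.flip fun Y _ _ _ _ h =>
    congrArg (fun t => t.app Y.as) (N.toKBifunctor_map_left h)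

instance : N.flipKBifunctor.CommShift₂Int :=
  Functor.CommShift₂.lift₂ _ _ _ _ (CommShift₂Setup.int_ε_app toK_hom_add_self)

/-- The bifunctor `(X, Y) ↦ N ⊗ (X ⊗ Y)` on the homotopy category. -/
def bifunctorK : K A ⥤ K A ⥤ K R := N.flipKBifunctor.flip

instance : N.bifunctorK.CommShift₂Int :=
  Functor.CommShift₂.flip _ _ (CommShift₂Setup.int_ε_app toK_hom_add_self)

end DGBimod

end UTCat

end

noncomputable section

namespace UTCat

open DGMod

/-! ### DG functors and mapping cones -/

/-- The data of a DG functor: an additive functor on linear maps of arbitrary degrees compatible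
with degrees and differentials. -/
structure DGFun (S R : DGAlg) where
  obj : DGMod S → DGMod R
  map {M M' : DGMod S} : (M →ₗ[S] M') → (obj M →ₗ[R] obj M')
  map_id (M : DGMod S) : map (LinearMap.id : M →ₗ[S] M) = LinearMap.id
  map_comp {M M' M'' : DGMod S} (f : M →ₗ[S] M') (g : M' →ₗ[S] M'') :
    map (g.comp f) = (map g).comp (map f)
  map_add {M M' : DGMod S} (f g : M →ₗ[S] M') : map (f + g) = map f + map g
  map_deg {M M' : DGMod S} {f : M →ₗ[S] M'} {a : ℤ} : HasDeg f (a, 0) → HasDeg (map f) (a, 0)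
  map_d {M M' : DGMod S} {f f' : M →ₗ[S] M'} :
    (∀ x, f (M.d x) + M'.d (f x) = f' x) →
      ∀ z, map f ((obj M).d z) + (obj M').d (map f z) = map f' z

namespace DGFun

variable {S R : DGAlg} (Φ : DGFun S R) {M M' M'' : DGMod S}

theorem map_zero : Φ.map (0 : M →ₗ[S] M') = 0 := by
  have := Φ.map_add (0 : M →ₗ[S] M') 0
  rw [add_zero] at this
  exact left_eq_add.1 this

theorem comp_apply (f : M →ₗ[S] M') (g : M' →ₗ[S] M'') (z : Φ.obj M) :
    Φ.map g (Φ.map f z) = Φ.map (g.comp f) z := by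
  rw [map_comp]; rfl

theorem eq_of_add {V : DGMod R} {a b c : V} (h : a + b = c) : a = c + b := by
  rw [← h, add_assoc, DGMod.add_self, add_zero]

/-- The first projection of a cone. -/
abbrev fst (u : M ⟶ M') : cone u →ₗ[S] M := LinearMap.fst S _ _
/-- The second projection of a cone. -/
abbrev snd (u : M ⟶ M') : cone u →ₗ[S] M' := LinearMap.snd S _ _
/-- The inclusion of the first summand of a cone. -/
abbrev inl (u : M ⟶ M') : M →ₗ[S] cone u := LinearMap.inl S _ _
/-- The inclusion of the second summand of a cone. -/
abbrev inr (u : M ⟶ M') : M' →ₗ[S] cone u := LinearMap.inr S _ _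

/-- The DG functor `Φ` commutes with cones. -/
def coneIso (u : M ⟶ M') (v : Φ.obj M ⟶ Φ.obj M') (hv : v.f = Φ.map u.f) :
    Φ.obj (cone u) ≅ cone v :=
  -- A cone is the direct sum of M[1] and M' through the two inclusions and projections. They are
  -- linear maps of degree (±1, 0) or 0, so an additive functor on linear maps of all degrees
  -- preserves the decomposition.
  mkIso (N := cone v) ((Φ.map (fst u)).prod (Φ.map (snd u)) : _ →ₗ[R] (Φ.obj M × Φ.obj M'))
    ((Φ.map (inl u)).comp (LinearMap.fst R (Φ.obj M) (Φ.obj M')) +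
      (Φ.map (inr u)).comp (LinearMap.snd R (Φ.obj M) (Φ.obj M')))
    (fun {p x} h => by
      have h1 : HasDeg (Φ.map (fst u)) (1, 0) :=
        Φ.map_deg fun {p x} (h : x ∈ (cone u).gr p) => h.1
      have h2 : HasDeg (Φ.map (snd u)) (0, 0) := Φ.map_deg fun {p x} h => by
        change x.2 ∈ M'.gr (p + 0)
        rw [add_zero]; exact h.2
      refine ⟨?_, h2 h⟩
      change _ ∈ (Φ.obj M).gr (p + 0 + (1, 0))
      rw [add_zero]
      exact h1 h)
    (fun {p x} h => by
      have h1 : HasDeg (Φ.map (inl u)) (-1, 0) := Φ.map_deg fun {p x} h => by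
        refine ⟨?_, Submodule.zero_mem _⟩
        change x ∈ M.gr (p + (-1, 0) + (1, 0))
        rwa [add_assoc, show ((-1, 0) : ℤ × ℤ) + (1, 0) = 0 from rfl, add_zero]
      have h2 : HasDeg (Φ.map (inr u)) (0, 0) := Φ.map_deg fun {p x} h => by
        refine ⟨Submodule.zero_mem _, ?_⟩
        change x ∈ M'.gr (p + 0)
        rwa [add_zero]
      have h3 := h1 h.1
      rw [add_assoc] at h3
      exact Submodule.add_mem _ h3 (h2 h.2))
    (fun x => by
      have h1 := Φ.map_d (f := fst u) (f' := 0) (fun x => DGMod.add_self _) x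
      -- The second projection is not closed: its commutator with the differential is u composed
      -- with the first projection. This relation determines the off-diagonal part of the
      -- differential of the image.
      have h2 := Φ.map_d (f := snd u) (f' := u.f.comp (fst u)) (fun x => by
        change u.f x.1 + M'.d x.2 + M'.d x.2 = u.f x.1
        rw [add_assoc, DGMod.add_self, add_zero]) x
      refine Prod.ext ?_ ?_
      · refine (eq_of_add h1).trans ?_
        rw [map_zero]
        exact zero_add _
      · refine (eq_of_add h2).trans ?_
        rw [map_comp, ← hv]
        rfl)
    (fun x => by
      change Φ.map (inl u) (Φ.map (fst u) x) + Φ.map (inr u) (Φ.map (snd u) x) = x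
      rw [comp_apply, comp_apply, ← LinearMap.add_apply, ← map_add]
      refine (congrArg (fun t => Φ.map t x) ?_).trans (LinearMap.congr_fun (Φ.map_id (cone u)) x)
      exact LinearMap.ext fun x => Prod.ext (add_zero x.1) (zero_add x.2))
    (fun x => by
      change (Φ.map (fst u) (Φ.map (inl u) x.1 + Φ.map (inr u) x.2),
        Φ.map (snd u) (Φ.map (inl u) x.1 + Φ.map (inr u) x.2)) = x
      rw [_root_.map_add, _root_.map_add, comp_apply, comp_apply, comp_apply, comp_apply]
      have e1 : (fst u).comp (inl u) = LinearMap.id := rfl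
      have e2 : (fst u).comp (inr u) = 0 := rfl
      have e3 : (snd u).comp (inl u) = 0 := rfl
      have e4 : (snd u).comp (inr u) = LinearMap.id := rfl
      rw [e1, e2, e3, e4, map_zero, map_zero, map_id, map_id]
      refine Prod.ext ?_ ?_
      · exact add_zero _
      · exact zero_add _)

/-- The image under a DG functor of a standard triangle is a standard triangle. -/
def coneTriangleIso (u : M ⟶ M') (v : Φ.obj M ⟶ Φ.obj M') (i : Φ.obj M' ⟶ Φ.obj (cone u))
    (q : Φ.obj (cone u) ⟶ (Φ.obj M)⟦(1 : ℤ)⟧) (hv : v.f = Φ.map u.f) (hi : i.f = Φ.map (inr u))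
    (hq : ∀ z, q.f z = Φ.map (fst u) z) : Triangle.mk v i q ≅ coneTriangle v :=
  Triangle.isoMk (Triangle.mk v i q) (coneTriangle v) (Iso.refl _) (Iso.refl _)
    (Φ.coneIso u v hv) ((Category.comp_id _).trans (Category.id_comp _).symm)
    (by
      refine Eq.trans ?_ (Category.id_comp _).symm
      refine DGMod.hom_ext (M := Φ.obj M') (N := cone v) fun z => ?_
      change (Φ.map (fst u) (i.f z), Φ.map (snd u) (i.f z)) = ((0 : Φ.obj M), z)
      have e2 : (fst u).comp (inr u) = 0 := rfl
      have e4 : (snd u).comp (inr u) = LinearMap.id := rfl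
      rw [hi, comp_apply, comp_apply, e2, e4, map_zero, map_id]
      rfl)
    (by
      have h : (shiftFunctor (DGMod R) (1 : ℤ)).map (𝟙 (Φ.obj M)) = 𝟙 _ :=
        (shiftFunctor _ _).map_id _
      refine (congrArg (q ≫ ·) h).trans ?_
      refine (Category.comp_id _).trans ?_
      exact DGMod.hom_ext (M := Φ.obj (cone u)) (N := (Φ.obj M)⟦(1 : ℤ)⟧) fun z => hq z)

end DGFun

/-- Every distinguished triangle of the homotopy category is isomorphic to the image of a standard
one, so exactness only has to be checked on standard triangles of DG modules. -/
theorem lift_isTriangulated {S R : DGAlg} (F : DGMod S ⥤ DGMod R) [F.CommShift ℤ]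
    (hF : ∀ (x y : DGMod S) (f₁ f₂ : x ⟶ y), homotopic S f₁ f₂ →
      (F ⋙ toK R).map f₁ = (F ⋙ toK R).map f₂)
    (h : ∀ {M M' : DGMod S} (u : M ⟶ M'),
      Nonempty (F.mapTriangle.obj (coneTriangle u) ≅ coneTriangle (F.map u))) :
    (CategoryTheory.Quotient.lift (homotopic S) (F ⋙ toK R) hF).IsTriangulated where
  map_distinguished T hT := by
    obtain ⟨M, M', u, ⟨e⟩⟩ := mem_distTriang_iff.1 hT
    obtain ⟨e'⟩ := h u
    let L := CategoryTheory.Quotient.lift (homotopic S) (F ⋙ toK R) hF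
    refine mem_distTriang_iff.2 ⟨_, _, F.map u, ⟨L.mapTriangle.mapIso e ≪≫ ?_⟩⟩
    refine ((toK S).mapTriangleCompIso L).symm.app (coneTriangle u) ≪≫ ?_
    refine (Functor.mapTriangleIso (CategoryTheory.Quotient.lift.isLift (homotopic S) (F ⋙ toK R) hF)).app _ ≪≫ ?_
    exact (F.mapTriangleCompIso (toK R)).app (coneTriangle u) ≪≫ (toK R).mapTriangle.mapIso e'

namespace DGBimod

variable {R : DGAlg} (N : DGBimod R AA)

/-- The DG functor `N ⊗ (X ⊗ -)`. -/
def rightDGFun (X : DGMod A) : DGFun A R where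
  obj Y := N.tens X Y
  map f := N.tensL LinearMap.id f
  map_id _ := N.tensL_id
  map_comp f g := (N.tensL_comp LinearMap.id LinearMap.id f g).symm
  map_add f g := N.tensL_add_right _ f g
  map_deg h := N.tensL_deg' (a := 0) X.id_deg h (zero_add _)
  map_d h z := by
    have := N.tensL_d (f := LinearMap.id) (f' := 0) (fun x : X => DGMod.add_self _) h z
    rw [tensL_zero_left] at this
    exact this.trans (zero_add _)

/-- The DG functor `N ⊗ (- ⊗ Y)`. -/
def leftDGFun (Y : DGMod A) : DGFun A R where
  obj X := N.tens X Y
  map f := N.tensL f LinearMap.id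
  map_id _ := N.tensL_id
  map_comp f g := (N.tensL_comp f g LinearMap.id LinearMap.id).symm
  map_add f g := N.tensL_add_left f g _
  map_deg h := N.tensL_deg' h Y.id_deg (add_zero _)
  map_d h z := by
    have := N.tensL_d (g := LinearMap.id) (g' := 0) h (fun x : Y => DGMod.add_self _) z
    rw [tensL_zero_right] at this
    exact this.trans (add_zero _)

theorem bifunctor_obj_cone (X : DGMod A) {Y Y' : DGMod A} (u : Y ⟶ Y') :
    Nonempty ((N.bifunctor.obj X).mapTriangle.obj (coneTriangle u) ≅
      coneTriangle ((N.bifunctor.obj X).map u)) :=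
  ⟨(N.rightDGFun X).coneTriangleIso u ((N.bifunctor.obj X).map u)
    ((N.bifunctor.obj X).map (coneInr u))
    ((N.bifunctor.obj X).map (coneFst u) ≫ ((N.bifunctor.obj X).commShiftIso (1 : ℤ)).hom.app Y)
    rfl rfl fun z => LinearMap.congr_fun (N.tensL_comp LinearMap.id LinearMap.id
      (coneFst u).f (Y.ofTwist (1, 0))) z⟩

theorem bifunctor_flip_obj_cone (Y : DGMod A) {X X' : DGMod A} (u : X ⟶ X') :
    Nonempty ((N.bifunctor.flip.obj Y).mapTriangle.obj (coneTriangle u) ≅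
      coneTriangle ((N.bifunctor.flip.obj Y).map u)) :=
  ⟨(N.leftDGFun Y).coneTriangleIso u ((N.bifunctor.flip.obj Y).map u)
    ((N.bifunctor.flip.obj Y).map (coneInr u))
    ((N.bifunctor.flip.obj Y).map (coneFst u) ≫
      ((N.bifunctor.flip.obj Y).commShiftIso (1 : ℤ)).hom.app X)
    rfl rfl fun z => LinearMap.congr_fun (N.tensL_comp (coneFst u).f (X.ofTwist (1, 0))
      LinearMap.id LinearMap.id) z⟩

instance (X : K A) : (N.bifunctorK.obj X).IsTriangulated :=
  lift_isTriangulated (N.bifunctor.obj X.as)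
    (fun _ _ _ _ h => N.toKBifunctor_map_right X.as h) (N.bifunctor_obj_cone X.as)

instance (Y : K A) : (N.bifunctorK.flip.obj Y).IsTriangulated :=
  lift_isTriangulated (N.bifunctor.flip.obj Y.as)
    (fun _ _ _ _ h => congrArg (fun t => t.app Y.as) (N.toKBifunctor_map_left h))
    (N.bifunctor_flip_obj_cone Y.as)

end DGBimod

end UTCat

end

noncomputable section

namespace UTCat

open DGMod

/-! ### The subcategory generated by a family of DG modules -/

section Generated

variable {R : DGAlg} {ι : Type} (P : ι → DGMod R)

/-- The third vertex need not be generated itself. It is homotopy equivalent to the cone of a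
representative of the first map, and closure up to isomorphism in the homotopy category is all that
is required. -/
theorem generatedK_closed₃ : (generatedK P).IsTriangulatedClosed₃ where
  ext₃' T hT h₁ h₂ := by
    let f : T.obj₁.as ⟶ T.obj₂.as := ((toK R).map_surjective (X := T.obj₁.as) (Y := T.obj₂.as) T.mor₁).choose
    have hf : (toK R).map f = T.mor₁ :=
      ((toK R).map_surjective (X := T.obj₁.as) (Y := T.obj₂.as) T.mor₁).choose_spec
    have hT' := mem_distTriang_iff.2 ⟨_, _, f, ⟨Iso.refl (coneTriK f)⟩⟩
    refine ⟨(toK R).obj (cone f), Generated.cone f h₁ h₂, ⟨?_⟩⟩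
    exact Triangle.π₃.mapIso (isoTriangleOfIso₁₂ T (coneTriK f) hT hT' (Iso.refl _) (Iso.refl _)
      ((Category.comp_id _).trans (hf.symm.trans (Category.id_comp _).symm)))

instance generatedK_isTriangulated : (generatedK P).IsTriangulated where
  exists_zero := ⟨(toK R).obj (DGMod.zero R), by
    rw [IsZero.iff_id_eq_zero]
    exact congrArg (toK R).map (DGMod.hom_ext fun x => rfl), Generated.zero⟩
  toIsTriangulatedClosed₂ := by
    have := generatedK_closed₃ P
    exact ObjectProperty.IsTriangulatedClosed₂.of_isTriangulatedClosed₃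

theorem mem_distTriang_hp_iff (T : Triangle (HPOf P)) : T ∈ distTriang (HPOf P) ↔
    ∃ (M M' : DGMod R) (u : M ⟶ M'), Nonempty ((generatedK P).ι.mapTriangle.obj T ≅
      (toK R).mapTriangle.obj (coneTriangle u)) := Iff.rfl

end Generated

namespace DGBimod

variable {ι : Type} {P : ι → DGMod A} (N : DGBimod A AA)
  (h : ∀ X Y, Generated P X → Generated P Y → Generated P (N.tens X Y))

/-- The bifunctor `(X, Y) ↦ N ⊗ (X ⊗ Y)` on the homotopy category, restricted to a generated
subcategory. -/
def resBifunctor : HPOf P ⥤ HPOf P ⥤ K A :=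
  ((generatedK P).ι ⋙ N.bifunctorK) ⋙ (Functor.whiskeringLeft _ _ _).obj (generatedK P).ι

/-- The bifunctor `(X, Y) ↦ N ⊗ (X ⊗ Y)` on a generated subcategory. -/
def hpBifunctor : HPOf P ⥤ HPOf P ⥤ HPOf P :=
  ObjectProperty.lift₂ (N.resBifunctor (P := P)) (generatedK P)
    fun X Y => h X.obj.as Y.obj.as X.property Y.property

instance : (N.resBifunctor (P := P)).CommShift₂Int :=
  inferInstanceAs ((((generatedK P).ι ⋙ N.bifunctorK) ⋙
    (Functor.whiskeringLeft _ _ _).obj (generatedK P).ι)).CommShift₂Int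

theorem hp_hom_add_self {R : DGAlg} {ι : Type} {P : ι → DGMod R} {X Y : HPOf P} (f : X ⟶ Y) :
    f + f = 0 := (generatedK P).ι.map_injective (toK_hom_add_self _)

instance : (N.hpBifunctor h).CommShift₂Int :=
  Functor.CommShift₂.liftTarget _ _ _ _ _ (CommShift₂Setup.int_ε_app toK_hom_add_self)
    (CommShift₂Setup.int_ε_app hp_hom_add_self)

theorem hpBifunctor_isTriangulated (X : HPOf P) : ((N.hpBifunctor h).obj X).IsTriangulated := by
  have hh : ∀ Y, generatedK P (((generatedK P).ι ⋙ N.bifunctorK.obj X.obj).obj Y) :=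
    fun Y => h X.obj.as Y.obj.as X.property Y.property
  exact inferInstanceAs
    ((generatedK P).lift ((generatedK P).ι ⋙ N.bifunctorK.obj X.obj) hh).IsTriangulated

theorem hpBifunctor_flip_isTriangulated (Y : HPOf P) :
    ((N.hpBifunctor h).flip.obj Y).IsTriangulated := by
  have hh : ∀ X, generatedK P (((generatedK P).ι ⋙ N.bifunctorK.flip.obj Y.obj).obj X) :=
    fun X => h X.obj.as Y.obj.as X.property Y.property
  exact inferInstanceAs
    ((generatedK P).lift ((generatedK P).ι ⋙ N.bifunctorK.flip.obj Y.obj) hh).IsTriangulated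

end DGBimod

/-- The comparison between the bifunctors on DG modules and on the homotopy category. -/
def hpBifunctorIso (h : ∀ X Y, Generated P X → Generated P Y → Generated P (N.tens X Y)) :
    HP.Q.prod HP.Q ⋙ Functor.uncurry.obj (N.hpBifunctor h) ⋙ HP.incl ≅
      dgp.ι.prod dgp.ι ⋙ MDG ⋙ toK A :=
  NatIso.ofComponents (fun X => Iso.refl ((toK A).obj (N.tens X.1.obj X.2.obj))) (by
    rintro ⟨X, Y⟩ ⟨X', Y'⟩ ⟨u, v⟩
    refine (Category.comp_id _).trans (Eq.trans ?_ (Category.id_comp _).symm)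
    refine ((toK A).map_comp _ _).symm.trans ?_
    refine congrArg (toK A).map ?_
    refine DGMod.hom_ext (M := N.tens X.obj Y.obj) (N := N.tens X'.obj Y'.obj) fun z => ?_
    exact LinearMap.congr_fun (N.tensL_comp u.hom.f LinearMap.id LinearMap.id v.hom.f) z)

end UTCat

end

/-! ### Graded dimensions and Euler characteristics -/

noncomputable section

namespace UTCat

namespace DGMod

/-- The elements of degree `p` in `e(γ) X`. -/
def comp (X : DGMod A) (γ : Vtx) (p : ℤ × ℤ) : Submodule F2 X where
  carrier := {x | x ∈ X.gr p ∧ A.e γ • x = x}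
  add_mem' hx hy := ⟨Submodule.add_mem _ hx.1 hy.1, by rw [smul_add, hx.2, hy.2]⟩
  zero_mem' := ⟨Submodule.zero_mem _, smul_zero _⟩
  smul_mem' r x hx := ⟨Submodule.smul_mem _ r hx.1, by rw [smul_comm, hx.2]⟩

theorem map_mem_comp {X Y : DGMod A} {f : X →ₗ[A] Y} {δ : ℤ × ℤ} (hf : HasDeg f δ) {γ p} {x : X}
    (hx : x ∈ X.comp γ p) : f x ∈ Y.comp γ (p + δ) :=
  ⟨hf hx.1, by rw [← map_smul, hx.2]⟩

theorem d_mem_comp {X : DGMod A} {γ p} {x : X} (hx : x ∈ X.comp γ p) :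
    X.d x ∈ X.comp γ (p + (1, 0)) :=
  ⟨X.d_mem hx.1, by
    have := X.d_smul (A.e γ) x
    rw [A.d_eq, zero_smul, zero_add, hx.2] at this
    exact this.symm⟩

theorem finite_gr_support (X : DGMod A) [Module.Finite F2 X] : {p | X.gr p ≠ ⊥}.Finite :=
  WellFoundedGT.finite_ne_bot_of_iSupIndep X.internal.submodule_iSupIndep

/-- A `finsum` with infinite support is 0 by convention, so finiteness is needed for the sums below
to be additive. -/
theorem finite_support_of_le (X : DGMod A) [hX : Module.Finite F2 X]
    {V : ℤ × ℤ → Submodule F2 X} (hV : ∀ p, V p ≤ X.gr p) {W : Type*} [AddCommGroup W]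
    (w : ℤ × ℤ → W) : (Function.support fun p => Module.finrank F2 (V p) • w p).Finite := by
  refine X.finite_gr_support.subset fun p hp h => hp ?_
  have : V p = ⊥ := le_bot_iff.1 (h ▸ hV p)
  change Module.finrank F2 (V p) • w p = 0
  rw [this, finrank_bot, zero_smul]

theorem comp_le (X : DGMod A) (γ : Vtx) (p : ℤ × ℤ) : X.comp γ p ≤ X.gr p := fun _ h => h.1

section EulerChar

variable {W : Type*} [AddCommGroup W] (w : ℤ × ℤ → W)

/-- The Euler characteristic of `e(γ) X` with weight `w p` in degree `p`. -/
def eulerChar (γ : Vtx) (X : DGMod A) : W :=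
  ∑ᶠ p, Module.finrank F2 (X.comp γ p) • w p

theorem eulerChar_twist (γ : Vtx) (X : DGMod A) (s : ℤ × ℤ) :
    eulerChar w γ (X.twist s) = eulerChar (fun p => w (p - s)) γ X := by
  refine finsum_eq_of_bijective (fun p => p + s) (Equiv.addRight s).bijective fun p => ?_
  change _ = Module.finrank F2 (X.comp γ (p + s)) • w (p + s - s)
  rw [add_sub_cancel_right]
  rfl

theorem eulerChar_map {W' : Type*} [AddCommGroup W'] (g : W →+ W') (γ : Vtx) (X : DGMod A)
    [Module.Finite F2 X] :
    eulerChar (fun p => g (w p)) γ X = g (eulerChar w γ X) := by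
  rw [eulerChar, eulerChar, g.map_finsum (X.finite_support_of_le (X.comp_le γ) w)]
  simp

theorem finrank_comp_cone {X Y : DGMod A} [Module.Finite F2 X] [Module.Finite F2 Y] (u : X ⟶ Y)
    (γ : Vtx) (p : ℤ × ℤ) : Module.finrank F2 ((cone u).comp γ p) =
      Module.finrank F2 (X.comp γ (p + (1, 0))) + Module.finrank F2 (Y.comp γ p) := by
  rw [← Module.finrank_prod]
  refine LinearEquiv.finrank_eq (LinearEquiv.ofLinearMap
    (LinearMap.prod
      (LinearMap.restrict (LinearMap.fst F2 X Y) (p := (cone u).comp γ p) fun x hx =>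
        ⟨hx.1.1, congrArg Prod.fst hx.2⟩)
      (LinearMap.restrict (LinearMap.snd F2 X Y) (p := (cone u).comp γ p) fun x hx =>
        ⟨hx.1.2, congrArg Prod.snd hx.2⟩))
    (LinearMap.codRestrict ((cone u).comp γ p)
      ((X.comp γ (p + (1, 0))).subtype.prodMap (Y.comp γ p).subtype) fun x =>
        ⟨⟨x.1.2.1, x.2.2.1⟩, Prod.ext x.1.2.2 x.2.2.2⟩) ?_ ?_)
  · rfl
  · rfl

theorem eulerChar_cone {X Y : DGMod A} [Module.Finite F2 X] [Module.Finite F2 Y] (u : X ⟶ Y)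
    (γ : Vtx) : eulerChar w γ (cone u) =
      eulerChar (fun p => w (p - (1, 0))) γ X + eulerChar w γ Y := by
  rw [← eulerChar_twist, eulerChar, eulerChar, eulerChar]
  have hX : Module.Finite F2 (X.twist (1, 0)) := ‹Module.Finite F2 X›
  rw [← finsum_add_distrib ((X.twist (1, 0)).finite_support_of_le (comp_le _ γ) w)
    (Y.finite_support_of_le (Y.comp_le γ) w)]
  refine finsum_congr fun p => ?_
  rw [finrank_comp_cone, add_smul]
  rfl

theorem eulerChar_iso {X Y : DGMod A} (e : X ≅ Y) (γ : Vtx) :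
    eulerChar w γ X = eulerChar w γ Y := by
  refine finsum_congr fun p => ?_
  congr 1
  refine LinearEquiv.finrank_eq (LinearEquiv.ofLinearMap
    (LinearMap.restrict (e.hom.f.restrictScalars F2) (p := X.comp γ p) (q := Y.comp γ p)
      fun x hx => ⟨e.hom.map_mem hx.1, (e.hom.f.map_smul _ _).symm.trans (congrArg _ hx.2)⟩)
    (LinearMap.restrict (e.inv.f.restrictScalars F2) (p := Y.comp γ p) (q := X.comp γ p)
      fun x hx => ⟨e.inv.map_mem hx.1, (e.inv.f.map_smul _ _).symm.trans (congrArg _ hx.2)⟩)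
    ?_ ?_)
  · exact LinearMap.ext fun x => Subtype.ext (LinearMap.congr_fun (congrArg Hom.f e.inv_hom_id) x.1)
  · exact LinearMap.ext fun x => Subtype.ext (LinearMap.congr_fun (congrArg Hom.f e.hom_inv_id) x.1)

/-- The cycles of degree `p` in `e(γ) X`. -/
def cycles (X : DGMod A) (γ : Vtx) (p : ℤ × ℤ) : Submodule F2 X :=
  X.comp γ p ⊓ LinearMap.ker X.d

/-- A contraction turns every cycle y into the boundary of h y. Rank and nullity of the differential
on degree p are therefore the dimensions of the cycles in degrees p + (1, 0) and p. -/
theorem finrank_comp_of_contraction {X : DGMod A} [Module.Finite F2 X] {h : X →ₗ[A] X}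
    (hh : HasDeg h (-1, 0)) (e : ∀ x, x = X.d (h x) + h (X.d x)) (γ : Vtx) (p : ℤ × ℤ) :
    Module.finrank F2 (X.comp γ p) =
      Module.finrank F2 (X.cycles γ p) + Module.finrank F2 (X.cycles γ (p + (1, 0))) := by
  let δ : X.comp γ p →ₗ[F2] X := X.d.comp (X.comp γ p).subtype
  have h1 := LinearMap.finrank_range_add_finrank_ker δ
  have h2 : LinearMap.range δ = X.cycles γ (p + (1, 0)) := by
    ext y
    constructor
    · rintro ⟨x, rfl⟩
      exact ⟨d_mem_comp x.2, X.d_d _⟩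
    · rintro ⟨hy, hy'⟩
      have h3 := map_mem_comp hh hy
      rw [add_assoc, show ((1, 0) + (-1, 0) : ℤ × ℤ) = 0 by simp, add_zero] at h3
      refine ⟨⟨h y, h3⟩, ?_⟩
      have h4 := e y
      rw [show X.d y = 0 from hy', map_zero, add_zero] at h4
      exact h4.symm
  have h3 : Module.finrank F2 (LinearMap.ker δ) = Module.finrank F2 (X.cycles γ p) := by
    have : LinearMap.ker δ = (X.cycles γ p).comap (X.comp γ p).subtype := by
      ext x
      exact ⟨fun hx => ⟨x.2, hx⟩, fun hx => hx.2⟩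
    rw [this]
    exact (Submodule.comapSubtypeEquivOfLe inf_le_left).finrank_eq
  rw [h2, h3] at h1
  rw [← h1, add_comm]

/-- The dimension in each degree is a sum of two consecutive dimensions of cycles, and the weight
changes sign from one degree to the next, so the two resulting sums cancel after reindexing. -/
theorem eulerChar_eq_zero (hw : ∀ p, w (p + (1, 0)) = -w p) {X : DGMod A} [Module.Finite F2 X]
    {h : X →ₗ[A] X} (hh : HasDeg h (-1, 0)) (e : ∀ x, x = X.d (h x) + h (X.d x)) (γ : Vtx) :
    eulerChar w γ X = 0 := by
  have hc : ∀ p, X.cycles γ p ≤ X.gr p := fun p => inf_le_left.trans (X.comp_le γ p)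
  have h1 := X.finite_support_of_le hc w
  have h2 : ∑ᶠ p, Module.finrank F2 (X.cycles γ (p + (1, 0))) • w p =
      ∑ᶠ p, -(Module.finrank F2 (X.cycles γ p) • w p) := by
    refine finsum_eq_of_bijective (fun p => p + (1, 0)) (Equiv.addRight (1, 0)).bijective ?_
    intro p
    rw [hw, smul_neg, neg_neg]
  have h3 : (Function.support fun p =>
      Module.finrank F2 (X.cycles γ (p + (1, 0))) • w p).Finite :=
    (X.twist (1, 0)).finite_support_of_le (V := fun p => X.cycles γ (p + (1, 0)))
      (fun p => hc _) w (hX := ‹Module.Finite F2 X›)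
  rw [eulerChar]
  simp only [finrank_comp_of_contraction hh e, add_smul]
  rw [finsum_add_distrib h1 h3, h2, finsum_neg_distrib, add_neg_cancel]

end EulerChar

end DGMod
end UTCat

end

/-! ### The path basis of A and the graded dimensions of P(γ) -/

noncomputable section

namespace UTCat

/-- The paths in the quiver of `A`, which index a basis of `A`. -/
inductive Path
  | e (v : Vtx) | rIEF | rEFI | loop
  deriving DecidableEq

namespace Path

instance : Fintype Path :=
  ⟨{.e .F, .e .I, .e .EF, .e .E, .rIEF, .rEFI, .loop}, fun b => by
    rcases b with v | _ | _ | _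
    · cases v <;> decide
    all_goals decide⟩

/-- The vertex `γ` with `e(γ) b = b`. -/
def src : Path → Vtx
  | e v => v
  | rIEF => .I
  | rEFI => .EF
  | loop => .EF

/-- The vertex `γ` with `b e(γ) = b`. -/
def tgt : Path → Vtx
  | e v => v
  | rIEF => .EF
  | rEFI => .I
  | loop => .EF

/-- The degree of a path. -/
def deg : Path → ℤ × ℤ
  | e _ => 0
  | rIEF => 0
  | rEFI => (1, 1)
  | loop => (1, 1)

/-- The element of `A` defined by a path. -/
def elem : Path → A
  | e v => A.e v
  | rIEF => A.rIEF
  | rEFI => A.rEFI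
  | loop => A.rEFI * A.rIEF

theorem elem_mem (b : Path) : b.elem ∈ A.gr b.deg := by
  cases b
  · exact A.e_mem _
  · exact A.rIEF_mem
  · exact A.rEFI_mem
  · exact A.loop_mem

theorem e_src_mul (b : Path) : A.e b.src * b.elem = b.elem := by
  cases b <;> simp [src, elem]

theorem mul_e_tgt (b : Path) : b.elem * A.e b.tgt = b.elem := by
  cases b <;> simp [tgt, elem, mul_assoc]

theorem e_mul_elem (v : Vtx) (b : Path) : A.e v * b.elem = if v = b.src then b.elem else 0 := by
  rw [← e_src_mul, ← mul_assoc, show A.e v * A.e b.src = _ from AAlg.e_mul_e v b.src]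
  split_ifs with h
  · subst h; rfl
  · exact zero_mul _

theorem elem_mul_e (v : Vtx) (b : Path) : b.elem * A.e v = if b.tgt = v then b.elem else 0 := by
  rw [← mul_e_tgt, mul_assoc, show A.e b.tgt * A.e v = _ from AAlg.e_mul_e b.tgt v]
  split_ifs with h
  · subst h; rfl
  · exact mul_zero _

/-- Consequently e(v)P(γ) is at most one-dimensional in each degree. -/
theorem ext_of_src_tgt_deg {b c : Path} (h1 : b.src = c.src) (h2 : b.tgt = c.tgt)
    (h3 : b.deg = c.deg) : b = c := by
  revert b c
  decide

/-- The elements whose left multiplication preserves the span of the paths form a subalgebra. It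
contains the generators, hence is everything, and the span contains 1 = ∑ e(v). -/
theorem span_elem : Submodule.span F2 (Set.range elem) = ⊤ := by
  let V := Submodule.span F2 (Set.range elem)
  have hV : ∀ b : Path, b.elem ∈ V := fun b => Submodule.subset_span ⟨b, rfl⟩
  let S : Subalgebra F2 A :=
    { carrier := {a | ∀ v ∈ V, a * v ∈ V}
      mul_mem' := fun ha hb v hv => by rw [mul_assoc]; exact ha _ (hb v hv)
      add_mem' := fun ha hb v hv => by rw [add_mul]; exact V.add_mem (ha v hv) (hb v hv)
      algebraMap_mem' := fun r v hv => by
        rw [← Algebra.smul_def]; exact V.smul_mem r hv }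
  have hS : ∀ a : A, (∀ b : Path, a * b.elem ∈ V) → a ∈ S := by
    intro a h v hv
    have : V ≤ V.comap (LinearMap.mulLeft F2 a) := Submodule.span_le.2 (by
      rintro _ ⟨b, rfl⟩
      exact h b)
    exact this hv
  have h0 : ∀ x : AGen, A.gen x ∈ S := by
    intro x
    refine hS _ fun b => ?_
    rcases x with v | _ | _
    · change A.e v * b.elem ∈ V
      rw [e_mul_elem]
      split_ifs
      · exact hV b
      · exact V.zero_mem
    · change A.rIEF * b.elem ∈ V
      rw [show A.rIEF * b.elem = A.rIEF * (A.e .EF * b.elem) by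
        rw [← mul_assoc, A.rIEF_mul_e], e_mul_elem]
      split_ifs with h
      · rcases b with v | _ | _ | _
        · obtain rfl : Vtx.EF = v := h
          rw [show A.rIEF * (Path.e .EF).elem = A.rIEF from A.rIEF_mul_e]
          exact hV .rIEF
        · simp [src] at h
        · rw [show A.rIEF * Path.rEFI.elem = 0 from A.rIEF_mul_rEFI]
          exact V.zero_mem
        · rw [show A.rIEF * Path.loop.elem = 0 from A.rIEF_mul_rEFI_mul _]
          exact V.zero_mem
      · rw [mul_zero]; exact V.zero_mem
    · change A.rEFI * b.elem ∈ V
      rw [show A.rEFI * b.elem = A.rEFI * (A.e .I * b.elem) by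
        rw [← mul_assoc, A.rEFI_mul_e], e_mul_elem]
      split_ifs with h
      · rcases b with v | _ | _ | _
        · obtain rfl : Vtx.I = v := h
          rw [show A.rEFI * (Path.e .I).elem = A.rEFI from A.rEFI_mul_e]
          exact hV .rEFI
        · exact hV .loop
        · simp [src] at h
        · simp [src] at h
      · rw [mul_zero]; exact V.zero_mem
  rw [eq_top_iff]
  intro a _
  have h1 : (1 : A) ∈ V := by
    rw [← A.sum_e]
    exact V.sum_mem fun v _ => hV (.e v)
  have := A.mem_subalgebra S h0 a 1 h1
  rwa [mul_one] at this

/-- A faithful representation of `A`. -/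
def matrixRep : A →ₐ[F2] Matrix (Fin 5) (Fin 5) F2 :=
  -- This is left multiplication on P(F) ⊕ P(EF) ⊕ P(E) in the basis e(F), e(EF), ρ, ρ'ρ, e(E).
  AAlg.lift (fun x => match x with
    | .e .F => Matrix.diagonal ![1, 0, 0, 0, 0]
    | .e .EF => Matrix.diagonal ![0, 1, 0, 1, 0]
    | .e .I => Matrix.diagonal ![0, 0, 1, 0, 0]
    | .e .E => Matrix.diagonal ![0, 0, 0, 0, 1]
    | .rIEF => Matrix.single 2 1 1
    | .rEFI => Matrix.single 3 2 1)
    (by intro v; cases v <;> decide +kernel) (by intro v w; cases v <;> cases w <;> decide +kernel)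
    (by decide +kernel)
    (by decide +kernel) (by decide +kernel) (by decide +kernel) (by decide +kernel)
    (by decide +kernel)

theorem matrixRep_gen (x : AGen) : matrixRep (A.gen x) = match x with
    | .e .F => Matrix.diagonal ![1, 0, 0, 0, 0]
    | .e .EF => Matrix.diagonal ![0, 1, 0, 1, 0]
    | .e .I => Matrix.diagonal ![0, 0, 1, 0, 0]
    | .e .E => Matrix.diagonal ![0, 0, 0, 0, 1]
    | .rIEF => Matrix.single 2 1 1
    | .rEFI => Matrix.single 3 2 1 := AAlg.lift_gen ..

/-- Since the paths are separated by their ends and degrees, nonvanishing is enough for the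
dimension count and linear independence need not be proved separately. -/
theorem elem_ne_zero (b : Path) : b.elem ≠ 0 := by
  intro h
  have h1 := congrArg matrixRep h
  rw [map_zero] at h1
  rcases b with v | _ | _ | _
  · have h2 := (matrixRep_gen (.e v)).symm.trans h1
    cases v <;> revert h2 <;> decide +kernel
  · have h2 := (matrixRep_gen .rIEF).symm.trans h1
    revert h2; decide +kernel
  · have h2 := (matrixRep_gen .rEFI).symm.trans h1
    revert h2; decide +kernel
  · have h2 := (map_mul matrixRep (A.gen .rEFI) (A.gen .rIEF)).symm.trans h1
    rw [matrixRep_gen, matrixRep_gen] at h2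
    revert h2; decide +kernel

/-- Cutting by e(v) on the left and e(w) on the right and then taking the component of degree p
fixes x, while it sends each path either to itself or to 0. -/
theorem mem_span_of_homogeneous {v w : Vtx} {p : ℤ × ℤ} {x : A} (hp : x ∈ A.gr p)
    (hv : A.e v * x = x) (hw : x * A.e w = x) :
    x ∈ Submodule.span F2 (elem '' {b | b.src = v ∧ b.tgt = w ∧ b.deg = p}) := by
  obtain ⟨D, hD⟩ := exists_coact (M := A.carrier) A.internal
  let π : A.carrier →ₗ[F2] A.carrier := (Finsupp.lapply p) ∘ₗ D ∘ₗ LinearMap.mulLeft F2 (A.e v) ∘ₗ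
    LinearMap.mulRight F2 (A.e w)
  have h1 : π x = x := by
    change D (A.e v * (x * A.e w)) p = x
    rw [hw, hv, hD p x hp, Finsupp.single_eq_same]
  have h2 : (⊤ : Submodule F2 A) ≤
      (Submodule.span F2 (elem '' {b | b.src = v ∧ b.tgt = w ∧ b.deg = p})).comap π := by
    rw [← span_elem, Submodule.span_le]
    rintro _ ⟨b, rfl⟩
    change D (A.e v * (b.elem * A.e w)) p ∈ Submodule.span F2
      (elem '' {b | b.src = v ∧ b.tgt = w ∧ b.deg = p})
    rw [elem_mul_e]
    split_ifs with hb
    · rw [e_mul_elem]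
      split_ifs with hb'
      · rw [hD _ _ b.elem_mem, Finsupp.single_apply]
        split_ifs with hb''
        · exact Submodule.subset_span ⟨b, ⟨hb'.symm, hb, hb''⟩, rfl⟩
        · exact Submodule.zero_mem _
      · rw [map_zero]; exact Submodule.zero_mem _
    · rw [mul_zero, map_zero]; exact Submodule.zero_mem _
  rw [← h1]
  exact h2 Submodule.mem_top

end Path

theorem P_mul_e {γ : Vtx} (x : P γ) : (x.1 : A) * A.e γ = x.1 := by
  obtain ⟨a, ha⟩ := Submodule.mem_span_singleton.1 x.2
  rw [← ha]
  change a * A.e γ * A.e γ = a * A.e γ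
  rw [mul_assoc, A.e_mul_self]

theorem mem_P {γ : Vtx} {x : A} (h : x * A.e γ = x) : x ∈ Submodule.span A.carrier {A.e γ} :=
  Submodule.mem_span_singleton.2 ⟨x, h⟩

instance : Module.Finite F2 A :=
  Module.finite_def.2 (Submodule.fg_def.2 ⟨_, Set.finite_range Path.elem, Path.span_elem⟩)

instance (γ : Vtx) : Module.Finite F2 (P γ) :=
  Module.Finite.of_injective ((Submodule.span A.carrier {A.e γ}).subtype.restrictScalars F2)
    Subtype.val_injective

/-- The space is spanned by the paths with the given ends and degree. There is at most one of them
and it is nonzero, so the dimension is the number of such paths. -/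
theorem finrank_comp_P (v γ : Vtx) (p : ℤ × ℤ) : Module.finrank F2 ((P γ).comp v p) =
    (Finset.univ.filter fun b : Path => b.src = v ∧ b.tgt = γ ∧ b.deg = p).card := by
  let V := Submodule.span F2 (Path.elem '' {b | b.src = v ∧ b.tgt = γ ∧ b.deg = p})
  have h1 : ((P γ).comp v p).map ((Submodule.span A.carrier {A.e γ}).subtype.restrictScalars F2) =
      V := by
    apply le_antisymm
    · rintro _ ⟨x, hx, rfl⟩
      exact Path.mem_span_of_homogeneous hx.1 (congrArg Subtype.val hx.2) (P_mul_e x)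
    · refine Submodule.span_le.2 ?_
      rintro _ ⟨b, ⟨rfl, rfl, rfl⟩, rfl⟩
      exact ⟨⟨b.elem, mem_P b.mul_e_tgt⟩, ⟨b.elem_mem, Subtype.ext b.e_src_mul⟩, rfl⟩
  have h2 : Module.finrank F2 ((P γ).comp v p) = Module.finrank F2 V := by
    rw [← h1]
    exact (LinearEquiv.finrank_eq (Submodule.equivMapOfInjective _ Subtype.val_injective _))
  rw [h2]
  by_cases h : ∃ b : Path, b.src = v ∧ b.tgt = γ ∧ b.deg = p
  · obtain ⟨b, rfl, rfl, rfl⟩ := h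
    have h3 : ∀ c : Path, (c.src = b.src ∧ c.tgt = b.tgt ∧ c.deg = b.deg) ↔ c = b :=
      fun c => ⟨fun h => Path.ext_of_src_tgt_deg h.1 h.2.1 h.2.2, fun h => by simp [h]⟩
    have h4 : V = Submodule.span F2 {b.elem} := by
      rw [← Set.image_singleton]
      exact congrArg (fun s => Submodule.span F2 (Path.elem '' s)) (Set.ext h3)
    rw [h4, finrank_span_singleton b.elem_ne_zero]
    simp only [h3, Finset.filter_eq', Finset.mem_univ, if_true, Finset.card_singleton]
  · push Not at h
    have h3 : {b : Path | b.src = v ∧ b.tgt = γ ∧ b.deg = p} = ∅ :=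
      Set.eq_empty_of_forall_notMem fun b hb => h b hb.1 hb.2.1 hb.2.2
    have h4 : V = ⊥ := by
      simp only [V, h3, Set.image_empty, Submodule.span_empty]
    rw [h4, finrank_bot, eq_comm, Finset.card_eq_zero,
      Finset.filter_eq_empty_iff]
    exact fun b _ hb => h b hb.1 hb.2.1 hb.2.2

theorem eulerChar_P {W : Type*} [AddCommGroup W] (w : ℤ × ℤ → W) (v γ : Vtx) :
    DGMod.eulerChar w v (P γ) = ∑ b : Path, if b.src = v ∧ b.tgt = γ then w b.deg else 0 := by
  have h1 : ∀ p, Module.finrank F2 ((P γ).comp v p) • w p =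
      ∑ b : Path, if b.src = v ∧ b.tgt = γ ∧ b.deg = p then w p else 0 := by
    intro p
    rw [finrank_comp_P, ← Finset.sum_filter, Finset.sum_const]
  rw [DGMod.eulerChar, finsum_congr h1, finsum_sum_comm]
  · refine Finset.sum_congr rfl fun b _ => ?_
    rw [finsum_eq_single _ b.deg]
    · simp
    · intro p hp
      rw [if_neg fun h => hp h.2.2.symm]
  · intro b _
    refine (Set.finite_singleton b.deg).subset fun p hp => ?_
    by_contra h
    exact hp (if_neg fun h' => h h'.2.2.symm)

namespace DGMod

theorem finite_of_generated {X : DGMod A} (h : Generated P X) : Module.Finite F2 X := by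
  induction h with
  | zero => exact inferInstanceAs (Module.Finite F2 PUnit)
  | basic i => infer_instance
  | twist M s _ h => exact h
  | @cone M N u _ _ h h' => exact inferInstanceAs (Module.Finite F2 (M × N))
  | @iso M N e _ h =>
    exact Module.Finite.of_surjective (e.hom.f.restrictScalars F2) fun y =>
      ⟨e.inv.f y, LinearMap.congr_fun (congrArg Hom.f e.inv_hom_id) y⟩

/-- The cone of a homotopy equivalence is contractible, so its Euler characteristic vanishes; by
additivity it is also the difference of those of Y and X. -/
theorem eulerChar_eq_of_isoK {W : Type*} [AddCommGroup W] (w : ℤ × ℤ → W)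
    (hw : ∀ p, w (p + (1, 0)) = -w p) {X Y : DGMod A} [Module.Finite F2 X] [Module.Finite F2 Y]
    (e : (toK A).obj X ≅ (toK A).obj Y) (γ : Vtx) : eulerChar w γ X = eulerChar w γ Y := by
  obtain ⟨u, hu⟩ := (toK A).map_surjective e.hom
  have hu' : IsIso ((toK A).map u) := hu ▸ inferInstance
  have h0 : IsZero (coneTriK u).obj₃ :=
    (coneTriK u).isZero₃_of_isIso₁ (mem_distTriang_iff.2 ⟨X, Y, u, ⟨Iso.refl _⟩⟩) hu'
  have h1 : (toK A).map (𝟙 (cone u)) = (toK A).map 0 := h0.eq_of_src _ _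
  obtain ⟨h, hh, e'⟩ := exists_homotopy h1
  have hf : Module.Finite F2 (cone u) := inferInstanceAs (Module.Finite F2 (X × Y))
  have h2 := eulerChar_cone w u γ
  rw [eulerChar_eq_zero w hw (h := h) hh (fun x => by simpa using e' x)] at h2
  have h3 : (fun p => w (p - (1, 0))) = fun p => (negAddMonoidHom : W →+ W) (w p) := by
    funext p
    have := hw (p - (1, 0))
    rw [sub_add_cancel] at this
    rw [this, negAddMonoidHom_apply, neg_neg]
  rw [h3, eulerChar_map w negAddMonoidHom, negAddMonoidHom_apply, neg_add_eq_sub, eq_comm,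
    sub_eq_zero] at h2
  exact h2.symm

end DGMod
end UTCat

end

noncomputable section

namespace UTCat

open DGMod

/-! ### The ring `U_T` -/

/-- The ring `U_T`, as a type whose ring structure is not unfolded by unification. -/
def U : Type := UT

namespace U

/-- The ring structure of `U_T`. -/
def ring : Ring U := RingQuot.instRing URel

instance : Ring U := ring

/-- The identity of `U_T`. -/
def equiv : U ≃+* UT where
  toEquiv := Equiv.refl UT
  map_mul' _ _ := rfl
  map_add' _ _ := rfl

attribute [irreducible] ring

/-- The quotient map onto `U_T`. -/
def mk : FreeAlgebra ℤ UGen →+* U :=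
  (equiv.symm : UT →+* U).comp (RingQuot.mkRingHom URel)

theorem mk_surjective : Function.Surjective mk :=
  equiv.symm.surjective.comp (RingQuot.mkRingHom_surjective URel)

/-- The generators of `U_T`. -/
def gen (x : UGen) : U := mk (FreeAlgebra.ι ℤ x)

/-- The generator `T` of `U_T`. -/
def T : U := gen .T

/-- The element of `U_T` named by a vertex. -/
def ofVtx : Vtx → U
  | .F => gen .F
  | .I => 1
  | .EF => gen .E * gen .F
  | .E => gen .E

theorem equiv_ofVtx (γ : Vtx) : equiv (ofVtx γ) = UT.ofVtx γ := by
  cases γ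
  · rfl
  · exact map_one equiv
  · exact map_mul equiv (gen .E) (gen .F)
  · rfl

theorem mk_eq {x y : FreeAlgebra ℤ UGen} (h : URel x y) : mk x = mk y :=
  congrArg equiv.symm (RingQuot.mkRingHom_rel h)

theorem E_mul_E : gen .E * gen .E = 0 := by
  have := mk_eq URel.E_E
  rwa [map_mul, map_zero] at this
theorem F_mul_F : gen .F * gen .F = 0 := by
  have := mk_eq URel.F_F
  rwa [map_mul, map_zero] at this
theorem F_mul_E : gen .F * gen .E = 1 - T - gen .E * gen .F := by
  have := mk_eq URel.E_F
  rw [map_add, map_mul, map_mul, map_sub, map_one] at this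
  exact eq_sub_of_add_eq' this
theorem E_mul_T : gen .E * T = T * gen .E := by
  have := mk_eq URel.E_T
  rwa [map_mul, map_mul] at this
theorem F_mul_T : gen .F * T = T * gen .F := by
  have := mk_eq URel.F_T
  rwa [map_mul, map_mul] at this
theorem T_mul_Tinv : T * gen .Tinv = 1 := by
  have := mk_eq URel.T_Tinv
  rwa [map_mul, map_one] at this
theorem Tinv_mul_T : gen .Tinv * T = 1 := by
  have := mk_eq URel.Tinv_T
  rwa [map_mul, map_one] at this

theorem mem_subring (S : Subring U) (h : ∀ x, gen x ∈ S) (a : U) : a ∈ S := by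
  obtain ⟨a, rfl⟩ := mk_surjective a
  induction a with
  | grade0 r =>
    rw [eq_intCast]
    rw [map_intCast]; exact intCast_mem S r
  | grade1 x => exact h x
  | mul x y hx hy => rw [map_mul]; exact S.mul_mem hx hy
  | add x y hx hy => rw [map_add]; exact S.add_mem hx hy

/-- `T` as a unit. -/
def unitT : Uˣ := ⟨T, gen .Tinv, T_mul_Tinv, Tinv_mul_T⟩

theorem commute_unitT (a : U) : Commute (unitT : U) a := by
  have := mem_subring (Subring.centralizer {T}) (fun x => by
    rw [Subring.mem_centralizer_iff]
    rintro _ rfl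
    cases x
    · exact E_mul_T.symm
    · exact F_mul_T.symm
    · rfl
    · exact T_mul_Tinv.trans Tinv_mul_T.symm) a
  exact Subring.mem_centralizer_iff.1 this T rfl

/-- The weight `(-1) ^ i * T ^ (-j)` of the degree `(i, j)`. -/
def wt (p : ℤ × ℤ) : Uˣ := (-1) ^ p.1 * unitT ^ (-p.2)

theorem commute_wt (p : ℤ × ℤ) (a : U) : Commute (wt p : U) a := by
  rw [wt, Units.val_mul]
  exact Commute.mul_left (Commute.units_zpow_left (Commute.neg_one_left a) _)
    ((commute_unitT a).units_zpow_left _)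

theorem wt_add (p q : ℤ × ℤ) : wt (p + q) = wt p * wt q := by
  have h : Commute ((-1 : Uˣ) ^ q.1) (unitT ^ (-p.2)) :=
    (Commute.neg_one_left _).zpow_left _
  simp only [wt, Prod.fst_add, Prod.snd_add, neg_add, zpow_add]
  rw [mul_assoc, mul_assoc, ← mul_assoc (_ ^ q.1), h.eq, mul_assoc]

@[simp] theorem wt_zero : wt 0 = 1 := by simp [wt]

theorem wt_add_one (p : ℤ × ℤ) : (wt (p + (1, 0)) : U) = -wt p := by
  rw [wt_add, show wt (1, 0) = -1 by simp [wt]]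
  simp

theorem wt_one_zero : (wt (1, 0) : U) = -1 := by simp [wt]

/-- The generator of P(γ){1} has t-degree -1; the negative exponent in `wt` is what makes the shift
{1} act by T. -/
theorem wt_zero_neg_one : (wt (0, -1) : U) = T := by simp [wt, unitT]

/-- This is why the term 2 deg_t(x) p(y) in the grading leaves no trace in K_0. -/
theorem wt_add_even (c : ℤ) (p : ℤ × ℤ) (h : Even c) : wt (p + (c, 0)) = wt p := by
  rw [wt_add, show wt (c, 0) = 1 by
    obtain ⟨k, rfl⟩ := h
    rw [← two_mul, wt, zpow_mul, zpow_two]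
    simp, mul_one]

end U

/-! ### The class of a DG module -/

/-- The coefficients by which the dimensions of `e(γ) X` contribute to the class of `X`. -/
def classCoeff : Vtx → U
  | .F => U.gen .F
  -- Put q = `U.wt (1, 1)`. At the vertices I and EF, the module P(I) has graded dimensions 1 and q,
  -- and P(EF) has 1 and 1 + q. The coefficients at I and EF are the solution of c_I + q c_EF = 1
  -- and c_I + (1 + q) c_EF = EF, a system of determinant 1.
  | .I => 1 + U.wt (1, 1) - U.wt (1, 1) * (U.gen .E * U.gen .F)
  | .EF => U.gen .E * U.gen .F - 1
  | .E => U.gen .E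

/-- The class of a DG `A`-module in `U_T`. -/
def eulerClass (X : DGMod A) : U :=
  ∑ v, DGMod.eulerChar (fun p => (U.wt p : U)) v X * classCoeff v

theorem eulerClass_twist (X : DGMod A) [Module.Finite F2 X] (s : ℤ × ℤ) :
    eulerClass (X.twist s) = U.wt (-s) * eulerClass X := by
  rw [eulerClass, eulerClass, Finset.mul_sum]
  refine Finset.sum_congr rfl fun v _ => ?_
  rw [DGMod.eulerChar_twist, ← mul_assoc]
  have h : (fun p => (U.wt (p - s) : U)) =
      fun p => AddMonoidHom.mulLeft (U.wt (-s) : U) (U.wt p : U) := by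
    funext p
    rw [sub_eq_add_neg, add_comm, U.wt_add]
    rfl
  rw [h, DGMod.eulerChar_map (fun p => (U.wt p : U))]
  rfl

theorem eulerClass_cone {X Y : DGMod A} [Module.Finite F2 X] [Module.Finite F2 Y] (u : X ⟶ Y) :
    eulerClass (DGMod.cone u) = eulerClass Y - eulerClass X := by
  have h := eulerClass_twist X (1, 0)
  rw [show -((1, 0) : ℤ × ℤ) = 0 + (1, 0) + (-2, 0) by simp, U.wt_add_even _ _ (by decide),
    U.wt_add_one, U.wt_zero, Units.val_one, neg_one_mul] at h
  rw [sub_eq_neg_add, ← h, eulerClass, eulerClass, eulerClass, ← Finset.sum_add_distrib]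
  refine Finset.sum_congr rfl fun v _ => ?_
  rw [DGMod.eulerChar_cone, DGMod.eulerChar_twist, add_mul]

theorem eulerClass_iso {X Y : DGMod A} (e : X ≅ Y) : eulerClass X = eulerClass Y :=
  Finset.sum_congr rfl fun v _ => by rw [DGMod.eulerChar_iso _ e]

theorem eulerClass_isoK {X Y : DGMod A} [Module.Finite F2 X] [Module.Finite F2 Y]
    (e : (toK A).obj X ≅ (toK A).obj Y) : eulerClass X = eulerClass Y :=
  Finset.sum_congr rfl fun v _ => by
    rw [DGMod.eulerChar_eq_of_isoK _ U.wt_add_one e]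

theorem eulerClass_zero : eulerClass (DGMod.zero A) = 0 := by
  refine Finset.sum_eq_zero fun v _ => ?_
  rw [DGMod.eulerChar, finsum_eq_zero_of_forall_eq_zero, zero_mul]
  intro p
  have : Subsingleton ((DGMod.zero A).comp v p) :=
    ⟨fun x y => Subtype.ext (show (x.1 : PUnit) = y.1 from rfl)⟩
  rw [Module.finrank_zero_of_subsingleton, zero_smul]

theorem Vtx.sum_univ {W : Type*} [AddCommMonoid W] (f : Vtx → W) :
    ∑ v, f v = f .F + (f .I + (f .EF + f .E)) := by
  change ∑ v ∈ {Vtx.F, Vtx.I, Vtx.EF, Vtx.E}, f v = _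
  simp

theorem Path.sum_univ {W : Type*} [AddCommMonoid W] (f : Path → W) :
    ∑ b, f b = f (e .F) + (f (e .I) + (f (e .EF) + (f (e .E) + (f rIEF + (f rEFI + f loop))))) := by
  change ∑ b ∈ {Path.e .F, Path.e .I, Path.e .EF, Path.e .E, Path.rIEF, Path.rEFI, Path.loop}, f b
    = _
  simp

/-- The coefficients `classCoeff` were chosen to satisfy exactly these four equations. -/
theorem eulerClass_P (γ : Vtx) : eulerClass (P γ) = U.ofVtx γ := by
  simp only [eulerClass, eulerChar_P, Vtx.sum_univ, Path.sum_univ]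
  cases γ <;> simp [Path.src, Path.tgt, Path.deg, classCoeff, U.ofVtx] <;> noncomm_ring

/-- The third vertex is only homotopy equivalent to a cone, so this rests on homotopy invariance,
and hence on the finite dimensionality of generated modules. -/
theorem eulerClass_triangle {Δ : Triangle HP} (h : Δ ∈ distTriang HP) :
    eulerClass Δ.obj₂.obj.as =
      eulerClass Δ.obj₁.obj.as + eulerClass Δ.obj₃.obj.as := by
  obtain ⟨X, Y, u, ⟨e⟩⟩ := h
  have h1 := DGMod.finite_of_generated Δ.obj₁.property
  have h2 := DGMod.finite_of_generated Δ.obj₂.property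
  have h3 := DGMod.finite_of_generated Δ.obj₃.property
  let Δ' := HP.incl.mapTriangle.obj Δ
  have hΔ' : Δ' ∈ distTriang (K A) := ⟨X, Y, u, ⟨e⟩⟩
  obtain ⟨f, hf⟩ := (toK A).map_surjective (X := Δ.obj₁.obj.as) (Y := Δ.obj₂.obj.as) Δ'.mor₁
  have h4 : Δ' ≅ coneTriK f :=
    isoTriangleOfIso₁₂ Δ' (coneTriK f) hΔ' (mem_distTriang_iff.2 ⟨_, _, f, ⟨Iso.refl _⟩⟩)
      (Iso.refl _) (Iso.refl _) ((Category.comp_id _).trans (hf.symm.trans (Category.id_comp _).symm))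
  have h5 : Module.Finite F2 (DGMod.cone f) :=
    inferInstanceAs (Module.Finite F2 (Δ.obj₁.obj.as × Δ.obj₂.obj.as))
  have h6 : eulerClass Δ.obj₃.obj.as = eulerClass (DGMod.cone f) :=
    eulerClass_isoK (Triangle.π₃.mapIso h4)
  rw [h6, eulerClass_cone, add_sub_cancel]
end UTCat

end

noncomputable section

namespace UTCat

open DGMod

namespace DGMod

/-- A morphism commutes with taking homogeneous components, so an injective one detects degrees.
Hence the inverse of a bijective morphism automatically has degree 0. -/
theorem mem_gr_of_injective {R : DGAlg} {M M' : DGMod R} (u : M ⟶ M')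
    (h : Function.Injective u.f) {p : ℤ × ℤ} {x : M} (hx : u.f x ∈ M'.gr p) : x ∈ M.gr p := by
  obtain ⟨D, hD⟩ := exists_coact M.internal
  obtain ⟨D', hD'⟩ := exists_coact M'.internal
  have ht := M.internal.submodule_iSup_eq_top
  have h1 : (⨆ i, M.gr i) ≤ LinearMap.eqLocus
      ((Finsupp.lapply p).comp (D'.comp (u.f.restrictScalars F2)))
      ((u.f.restrictScalars F2).comp ((Finsupp.lapply p).comp D)) := by
    refine iSup_le fun j y hy => ?_
    rw [LinearMap.mem_eqLocus]
    simp only [LinearMap.comp_apply, LinearMap.restrictScalars_apply, hD j y hy,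
      hD' j _ (u.map_mem hy), Finsupp.lapply_apply, Finsupp.single_apply]
    split_ifs <;> simp
  have h2 : D' (u.f x) p = u.f (D x p) := h1 (ht ▸ Submodule.mem_top : x ∈ _)
  rw [hD' p _ hx, Finsupp.single_eq_same] at h2
  rw [h h2]
  exact coact_mem ht hD x p

/-- A bijective morphism of DG modules is an isomorphism. -/
def isoOfBijective {R : DGAlg} {M M' : DGMod R} (u : M ⟶ M') (h : Function.Bijective u.f) :
    M ≅ M' :=
  mkIso u.f (LinearEquiv.ofBijective u.f h).symm.toLinearMap
    (fun {p x} hx => by rw [add_zero]; exact u.map_mem hx)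
    (fun {p x} hx => by
      rw [add_zero]
      refine mem_gr_of_injective u h.1 ?_
      have e : u.f ((LinearEquiv.ofBijective u.f h).symm x) = x :=
        (LinearEquiv.ofBijective u.f h).apply_symm_apply x
      exact e.symm ▸ hx)
    u.comm (fun x => (LinearEquiv.ofBijective u.f h).symm_apply_apply x)
    (fun x => (LinearEquiv.ofBijective u.f h).apply_symm_apply x)

end DGMod

/-! ### The summands of the bimodule `N` -/

namespace NMod

/-- The submodule of `N` generated by a set of generators. -/
def subCarrier (S : Set Gen) : Submodule A carrier where
  carrier := {v | ∀ g ∉ S, v.1 g = 0}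
  add_mem' {v w} hv hw g hg := by
    change v.1 g + w.1 g = 0
    rw [hv g hg, hw g hg, add_zero]
  zero_mem' _ _ := rfl
  smul_mem' r v hv g hg := by
    change r * v.1 g = 0
    rw [hv g hg, mul_zero]

/-- A set of generators whose span is stable under the differential. -/
def Closed (S : Set Gen) : Prop := ∀ g ∈ S, ∀ g', dGen g g' ≠ 0 → g' ∈ S

theorem d_apply (v : carrier) (g' : Gen) : (d v).1 g' = ∑ g, v.1 g * dGen g g' :=
  act_apply dGen v.1 g'

theorem d_mem_sub {S : Set Gen} (hS : Closed S) {v : carrier} (hv : v ∈ subCarrier S) :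
    d v ∈ subCarrier S := by
  intro g' hg'
  rw [d_apply]
  refine Finset.sum_eq_zero fun g _ => ?_
  by_cases h : dGen g g' = 0
  · rw [h, mul_zero]
  · rw [hv g fun hg => hg' (hS g hg g' h), zero_mul]

open Classical in
/-- The truncation of a combination of generators. -/
def truncate (S : Set Gen) (v : carrier) : carrier :=
  ⟨fun g => if g ∈ S then v.1 g else 0, fun g => by
    change (if g ∈ S then v.1 g else 0) * A.e g.typ = if g ∈ S then v.1 g else 0
    split_ifs
    · exact v.2 g
    · exact zero_mul _⟩

open Classical in
theorem truncate_mem (S : Set Gen) (v : carrier) : truncate S v ∈ subCarrier S :=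
  fun _ hg => if_neg hg

open Classical in
theorem truncate_of_mem {S : Set Gen} {v : carrier} (hv : v ∈ subCarrier S) :
    truncate S v = v := Subtype.ext <| funext fun g => by
  by_cases hg : g ∈ S
  · exact if_pos hg
  · exact (if_neg hg).trans (hv g hg).symm

open Classical in
/-- The truncation as a linear map. -/
def truncateL (S : Set Gen) : carrier →ₗ[A] carrier where
  toFun := truncate S
  map_add' v w := Subtype.ext <| funext fun g => by
    change (if g ∈ S then v.1 g + w.1 g else 0) =
      (if g ∈ S then v.1 g else 0) + (if g ∈ S then w.1 g else 0)
    split_ifs <;> simp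
  map_smul' r v := Subtype.ext <| funext fun g => by
    change (if g ∈ S then r * v.1 g else 0) = r * (if g ∈ S then v.1 g else 0)
    split_ifs <;> simp

open Classical in
theorem truncate_gr (S : Set Gen) {p : ℤ × ℤ} {v : carrier} (hv : v ∈ gr p) :
    truncate S v ∈ gr p := mem_gr.2 fun g => by
  change (if g ∈ S then v.1 g else 0) ∈ _
  split_ifs
  · exact mem_gr.1 hv g
  · exact Submodule.zero_mem _

/-- The DG submodule of `N` generated by a set of generators. -/
def sub (S : Set Gen) (hS : Closed S) : DGMod A where
  carrier := subCarrier S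
  gr p := (gr p).comap ((subCarrier S).subtype.restrictScalars F2)
  internal := by
    refine isInternal_sub internal_gr _ Subtype.val_injective ?_
    intro D hD v p
    have h := coact_comm internal_gr.submodule_iSup_eq_top hD ((truncateL S).restrictScalars F2)
      (fun p v hv => truncate_gr S hv) v.1 p
    rw [show (truncateL S).restrictScalars F2 v.1 = v.1 from truncate_of_mem v.2] at h
    exact ⟨⟨truncate S (D v.1 p), truncate_mem _ _⟩, h.symm⟩
  smul_mem hr hv := N.smul_mem hr hv
  d := LinearMap.restrict (d.restrictScalars F2)
    (p := (subCarrier S).restrictScalars F2) (q := (subCarrier S).restrictScalars F2)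
    fun v hv => d_mem_sub hS hv
  d_mem hv := N.d_mem hv
  d_d v := Subtype.ext (N.d_d v.1)
  d_smul r v := Subtype.ext (N.d_smul r v.1)

/-- The map `a ↦ a m_g` from `P(γ)` to `N`, for a generator `m_g` of type `γ`. -/
def singleL (g : Gen) : P g.typ →ₗ[A] carrier :=
  LinearMap.codRestrict carrier
    ((LinearMap.single A (fun _ : Gen => A.carrier) g).comp
      (Submodule.span A.carrier {A.e g.typ}).subtype) fun x g' => by
    change Pi.single (M := fun _ => A.carrier) g (x.1 : A.carrier) g' * A.e g'.typ =
      Pi.single (M := fun _ => A.carrier) g (x.1 : A.carrier) g'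
    by_cases h : g' = g
    · subst h
      rw [Pi.single_eq_same]
      exact P_mul_e x
    · rw [Pi.single_eq_of_ne h, zero_mul]

theorem singleL_same (g : Gen) (x : P g.typ) : (singleL g x).1 g = x.1 :=
  Pi.single_eq_same (M := fun _ => A.carrier) g (x.1 : A.carrier)

theorem singleL_of_ne (g : Gen) (x : P g.typ) {g' : Gen} (h : g' ≠ g) :
    (singleL g x).1 g' = 0 :=
  Pi.single_eq_of_ne (M := fun _ => A.carrier) h (x.1 : A.carrier)

theorem d_singleL (g : Gen) (x : P g.typ) (g' : Gen) :
    (d (singleL g x)).1 g' = (x.1 : A.carrier) * dGen g g' :=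
  congrFun (act_single dGen g (x.1 : A.carrier)) g'

theorem singleL_mem {g : Gen} {x : P g.typ} {p : ℤ × ℤ} (h : (x.1 : A.carrier) ∈ A.gr (p - g.deg)) :
    singleL g x ∈ gr p :=
  mem_gr.2 fun g' => single_mem h g'

section Insert

variable {S : Set Gen} (g : Gen) (hg : ∀ g', dGen g g' ≠ 0 → g' ∈ S)

/-- The differential of a generator, as a linear map between the summands of a filtration. -/
def attachL : P g.typ →ₗ[A] subCarrier S :=
  LinearMap.codRestrict (subCarrier S) (d.comp (singleL g)) fun x g' hg' => by
    refine (d_singleL g x g').trans ?_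
    by_cases h : dGen g g' = 0
    · rw [h, mul_zero]
    · exact absurd (hg g' h) hg'

/-- The differential of a generator, as a morphism between the summands of a filtration. -/
def attach (hS : Closed S) : (P g.typ).twist (-g.deg + (-1, 0)) ⟶ sub S hS where
  f := attachL g hg
  -- The twist puts the generator of the source in degree deg m_g + (1, 0), the degree of d m_g; the
  -- shift [1] in the cone then brings it to deg m_g.
  map_mem := fun {p x} hx => by
    have h1 : (x.1 : A.carrier) ∈ A.gr (p + (-g.deg + (-1, 0))) := hx
    have h2 : singleL g x ∈ gr (p + (-1, 0)) := singleL_mem (by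
      rwa [show p + (-1, 0) - g.deg = p + (-g.deg + (-1, 0)) by abel])
    have h3 : d (singleL g x) ∈ gr (p + (-1, 0) + (1, 0)) := N.d_mem h2
    rw [add_assoc, show ((-1, 0) + (1, 0) : ℤ × ℤ) = 0 by simp, add_zero] at h3
    exact h3
  comm := fun x => by
    have h : (attachL g hg) 0 = 0 := map_zero _
    refine h.trans (Subtype.ext ?_)
    exact (d_sq (singleL g x)).symm

/-- The decomposition of a summand of `N` after adding a generator. -/
def extendL : (P g.typ × subCarrier S) →ₗ[A] subCarrier (insert g S) :=
  LinearMap.codRestrict (subCarrier (insert g S))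
    ((singleL g).comp (LinearMap.fst A (P g.typ) (subCarrier S)) +
      (subCarrier S).subtype.comp (LinearMap.snd A (P g.typ) (subCarrier S))) fun x g' hg' => by
    have h1 : g' ∉ S := fun h => hg' (Set.mem_insert_of_mem _ h)
    have h2 : g' ≠ g := fun h => hg' (h ▸ Set.mem_insert _ _)
    change (singleL g x.1).1 g' + x.2.1.1 g' = 0
    rw [x.2.2 g' h1, singleL_of_ne g x.1 h2, add_zero]

variable {g}

theorem extendL_bijective (hgS : g ∉ S) : Function.Bijective (extendL g (S := S)) := by
  constructor
  · intro x y hxy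
    have h1 : ∀ g', (singleL g x.1).1 g' + x.2.1.1 g' = (singleL g y.1).1 g' + y.2.1.1 g' :=
      fun g' => congrFun (congrArg (fun v => v.1.1) hxy) g'
    have h2 : x.1 = y.1 := by
      have := h1 g
      rw [x.2.2 g hgS, y.2.2 g hgS, add_zero, add_zero, singleL_same, singleL_same] at this
      exact Subtype.ext this
    refine Prod.ext h2 (Subtype.ext (Subtype.ext (funext fun g' => ?_)))
    have := h1 g'
    rw [h2] at this
    exact add_left_cancel this
  · intro v
    obtain ⟨x, hx⟩ : ∃ x : P g.typ, (x.1 : A.carrier) = v.1.1 g :=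
      ⟨⟨v.1.1 g, mem_P (v.1.2 g)⟩, rfl⟩
    refine ⟨(x, ⟨truncate S v.1, truncate_mem _ _⟩), ?_⟩
    refine Subtype.ext (Subtype.ext (funext fun g' => ?_))
    change (singleL g x).1 g' + (truncate S v.1).1 g' = v.1.1 g'
    by_cases h : g' = g
    · subst h
      rw [truncate_mem S v.1 g' hgS, singleL_same, hx, add_zero]
    · rw [singleL_of_ne g _ h, zero_add]
      by_cases h' : g' ∈ S
      · exact if_pos h'
      · exact (if_neg h').trans (v.2 g' fun h'' => h''.elim h h').symm

/-- Adding a generator amounts to taking a cone. -/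
def attachIso (hgS : g ∉ S) (hS : Closed S) (hS' : Closed (insert g S)) :
    cone (attach g hg hS) ≅ sub (insert g S) hS' :=
  isoOfBijective (M := cone (attach g hg hS)) (M' := sub (insert g S) hS')
    { f := extendL g
      map_mem := fun {p x} hx => by
        have h1 : (x.1.1 : A.carrier) ∈ A.gr (p + (1, 0) + (-g.deg + (-1, 0))) := hx.1
        rw [show p + (1, 0) + (-g.deg + (-1, 0)) = p - g.deg + ((1, 0) + (-1, 0)) by abel,
          show ((1, 0) + (-1, 0) : ℤ × ℤ) = 0 by simp, add_zero] at h1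
        exact Submodule.add_mem (gr p) (singleL_mem h1) hx.2
      comm := fun x => Subtype.ext <| by
        have h : singleL g (0 : P g.typ) = 0 := map_zero _
        change singleL g (0 : P g.typ) + (d (singleL g x.1) + d x.2.1) =
          d (singleL g x.1 + x.2.1)
        rw [h, zero_add, map_add] }
    (extendL_bijective hgS)

end Insert

/-- The position of a generator in a filtration stable under the differential. -/
def rank : Gen → ℕ
  | .F_E₁ => 2
  | .F_E₂ => 1
  | _ => 0

theorem rank_lt {g g' : Gen} (h : dGen g g' ≠ 0) : rank g' < rank g := by
  cases g <;> first
    | exact absurd rfl h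
    | (simp only [dGen, ne_eq, Pi.single_apply, ite_eq_right_iff, Classical.not_imp] at h
       rw [h.1]
       decide)

/-- The differential of a generator involves only generators of smaller rank. Adding the generators
by increasing rank therefore attaches each copy of P(γ) to a DG submodule already built, by a cone;
in the class the shift of the cone cancels its sign, and the contribution is `wt (deg m_g)` times γ.
-/
theorem sub_generated (S : Finset Gen) (hS : Closed (S : Set Gen)) :
    Generated P (sub S hS) ∧
      eulerClass (sub S hS) = ∑ g ∈ S, (U.wt g.deg : U) * U.ofVtx g.typ := by
  -- The generator removed has maximal rank, so it occurs in no differential of the others and the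
  -- remaining set is still closed.
  induction S using Finset.induction_on_max_value rank with
  | empty =>
    have e : DGMod.zero A ≅ sub ((∅ : Finset Gen) : Set Gen) hS :=
      isoOfBijective 0 ⟨fun _ _ _ => rfl, fun v => ⟨PUnit.unit, Subtype.ext (Subtype.ext
        (funext fun g => (v.2 g (by simp)).symm))⟩⟩
    exact ⟨Generated.iso e Generated.zero, by
      rw [← eulerClass_iso e, eulerClass_zero, Finset.sum_empty]⟩
  | insert g S hgS hmax ih =>
    have hg : ∀ g', dGen g g' ≠ 0 → g' ∈ (S : Set Gen) := fun g' h => by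
      have h1 := hS g (by simp) g' h
      have h2 := rank_lt h
      simp only [Finset.coe_insert, Set.mem_insert_iff] at h1
      rcases h1 with rfl | h1
      · exact absurd h2 (lt_irrefl _)
      · exact h1
    have hS₀ : Closed (S : Set Gen) := fun g₁ hg₁ g' h => by
      have h1 := hS g₁ (by simp [Finset.mem_coe.1 hg₁]) g' h
      have h2 := (rank_lt h).trans_le (hmax g₁ hg₁)
      simp only [Finset.coe_insert, Set.mem_insert_iff] at h1
      rcases h1 with rfl | h1
      · exact absurd h2 (lt_irrefl _)
      · exact h1
    obtain ⟨ih1, ih2⟩ := ih hS₀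
    have hS' : Closed (insert g (S : Set Gen)) := by rwa [← Finset.coe_insert]
    have e : cone (attach g hg hS₀) ≅ sub ((insert g S : Finset Gen) : Set Gen) hS :=
      attachIso hg hgS hS₀ hS' ≪≫ eqToIso (by congr 1; exact (Finset.coe_insert g S).symm)
    have hP := Generated.twist (P g.typ) (-g.deg + (-1, 0)) (Generated.basic g.typ)
    refine ⟨Generated.iso e (Generated.cone _ hP ih1), ?_⟩
    have hf1 := finite_of_generated hP
    have hf2 := finite_of_generated ih1
    rw [← eulerClass_iso e, eulerClass_cone, ih2, eulerClass_twist, eulerClass_P,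
      Finset.sum_insert hgS, show -(-g.deg + (-1, 0)) = g.deg + (1, 0) by ext <;> simp [add_comm],
      U.wt_add_one, neg_mul, sub_neg_eq_add, add_comm]

end NMod
end UTCat

end

noncomputable section

namespace UTCat

open DGMod

/-! ### Tensor products of projective modules -/

section ProjProj

open NMod

/-- The product of two idempotents. -/
def idemTmul (γ₁ γ₂ : Vtx) : AA := (A.e γ₁ ⊗ₜ[F2] A.e γ₂ : A.carrier ⊗[F2] A.carrier)

variable (γ₁ γ₂ : Vtx)

/-- The inclusion of `P(γ)` in `A`. -/
def inclA (γ : Vtx) : (P γ).carrier →ₗ[F2] A.carrier :=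
  (Submodule.span A.carrier {A.e γ}).subtype.restrictScalars F2

/-- The inclusion of `P(γ₁) ⊗ P(γ₂)` in `A ⊗ A`. -/
def inclAA : (P γ₁).carrier ⊗[F2] (P γ₂).carrier →ₗ[F2] AA.carrier :=
  (TensorProduct.map (inclA γ₁) (inclA γ₂) :
    (P γ₁).carrier ⊗[F2] (P γ₂).carrier →ₗ[F2] A.carrier ⊗[F2] A.carrier)

theorem inclAA_smul (s : AA) (x : chiObj (P γ₁) (P γ₂)) :
    inclAA γ₁ γ₂ (s • x : chiObj (P γ₁) (P γ₂)) = s * inclAA γ₁ γ₂ x := by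
  let i : (P γ₁).carrier ⊗[F2] (P γ₂).carrier →ₗ[F2] A.carrier ⊗[F2] A.carrier := inclAA γ₁ γ₂
  change A.carrier ⊗[F2] A.carrier at s
  change (P γ₁).carrier ⊗[F2] (P γ₂).carrier at x
  change i (chiAct (P γ₁) (P γ₂) s x) = s * i x
  induction s with
  | zero => rw [map_zero, LinearMap.zero_apply, map_zero, zero_mul]
  | add s t hs ht => rw [map_add, LinearMap.add_apply, map_add, hs, ht, add_mul]
  | tmul a b =>
    induction x with
    | zero => rw [map_zero, map_zero, mul_zero]
    | add x y hx hy => rw [map_add, map_add, hx, hy, map_add, mul_add]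
    | tmul x y =>
      rw [chiAct_tmul]
      exact (Algebra.TensorProduct.tmul_mul_tmul a x.1 b y.1).symm

/-- The right action as a bilinear map. -/
def actBilin : NMod.carrier →ₗ[F2] (P γ₁).carrier ⊗[F2] (P γ₂).carrier →ₗ[F2] NMod.carrier :=
  LinearMap.mk₂ F2 (fun n x => (repN (inclAA γ₁ γ₂ x)).unop n)
    (fun n n' x => map_add _ n n')
    (fun c n x => ((repN (inclAA γ₁ γ₂ x)).unop.restrictScalars F2).map_smul c n)
    (fun n x x' => by rw [map_add, map_add]; rfl)
    (fun c n x => by rw [map_smul, map_smul]; rfl)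

/-- The right action as a map out of the tensor product. -/
def actTens : N.tens (P γ₁) (P γ₂) →ₗ[F2] NMod.carrier :=
  N.lift (chiObj (P γ₁) (P γ₂)) (TensorProduct.lift (actBilin γ₁ γ₂)) (fun n s x => by
    have h : repN (inclAA γ₁ γ₂ (s • x : chiObj (P γ₁) (P γ₂))) =
        repN s * repN (inclAA γ₁ γ₂ x) := by
      rw [inclAA_smul, map_mul]
    exact (LinearMap.congr_fun (congrArg MulOpposite.unop h) n).symm)

/-- The generator of `P(γ)`. -/
def genP (γ : Vtx) : P γ := ⟨A.e γ, Submodule.mem_span_singleton_self _⟩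

/-- The generators of the summand `N(γ₁, γ₂)` of `N`. -/
def gens : Finset Gen := Finset.univ.filter fun g => g.left = γ₁ ∧ g.right = γ₂

theorem mem_gens {g : Gen} : g ∈ (gens γ₁ γ₂ : Set Gen) ↔ g.left = γ₁ ∧ g.right = γ₂ := by
  simp [gens]

theorem gens_closed : Closed (gens γ₁ γ₂ : Set Gen) := by
  intro g hg g' h
  rw [mem_gens] at hg ⊢
  cases g <;> first
    | exact absurd rfl h
    | (simp only [dGen, ne_eq, Pi.single_apply, ite_eq_right_iff, Classical.not_imp] at h
       rw [h.1]
       exact hg)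

theorem repL_e_apply (γ : Vtx) (v : NMod.carrier) (g : Gen) :
    ((repL (A.e γ)).unop v).1 g = if g.left = γ then v.1 g else 0 := by
  have h : repL (A.e γ) = _ := repL_gen (.e γ)
  rw [h]
  refine (act_apply _ v.1 g).trans ?_
  rw [Finset.sum_eq_single g]
  · simp only [mulL]
    split_ifs <;> simp
  · intro g' _ hg'
    simp only [mulL]
    split_ifs
    · exact (congrArg (v.1 g' * ·) (Pi.single_eq_of_ne (M := fun _ => A.carrier) hg'.symm 1)).trans
        (mul_zero _)
    · exact mul_zero _
  · simp

theorem repR_e_apply (γ : Vtx) (v : NMod.carrier) (g : Gen) :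
    ((repR (A.e γ)).unop v).1 g = if g.right = γ then v.1 g else 0 := by
  have h : repR (A.e γ) = _ := repR_gen (.e γ)
  rw [h]
  refine (act_apply _ v.1 g).trans ?_
  rw [Finset.sum_eq_single g]
  · simp only [mulR]
    split_ifs <;> simp
  · intro g' _ hg'
    simp only [mulR]
    split_ifs
    · exact (congrArg (v.1 g' * ·) (Pi.single_eq_of_ne (M := fun _ => A.carrier) hg'.symm 1)).trans
        (mul_zero _)
    · exact mul_zero _
  · simp

theorem repN_idem_apply (v : NMod.carrier) (g : Gen) :
    ((repN (idemTmul γ₁ γ₂)).unop v).1 g = if g.left = γ₁ ∧ g.right = γ₂ then v.1 g else 0 := by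
  rw [idemTmul, repN_tmul]
  refine (repR_e_apply γ₂ ((repL (A.e γ₁)).unop v) g).trans ?_
  rw [repL_e_apply]
  split_ifs <;> simp_all

/-- The map `n ↦ n ⊗ (e(γ₁) ⊗ e(γ₂))`. -/
def pureGen : NMod.carrier →ₗ[A] N.tens (P γ₁) (P γ₂) where
  toFun n := N.pure₂ n (genP γ₁) (genP γ₂)
  map_add' n n' := N.add_pure (X := chiObj (P γ₁) (P γ₂)) n n' _
  map_smul' _ _ := rfl

/-- The idempotent e(γ₁) ⊗ e(γ₂) fixes the generator of P(γ₁) ⊗ P(γ₂), so it can be moved across the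
tensor product. -/
theorem pureGen_idem (n : NMod.carrier) :
    pureGen γ₁ γ₂ ((repN (idemTmul γ₁ γ₂)).unop n) = pureGen γ₁ γ₂ n := by
  refine (N.pure_smul (X := chiObj (P γ₁) (P γ₂)) n (idemTmul γ₁ γ₂) _).symm.trans ?_
  refine congrArg (N.pure (X := chiObj (P γ₁) (P γ₂)) n) ?_
  exact congrArg₂ (fun (x : P γ₁) (y : P γ₂) => chiTmul x y)
    (Subtype.ext (A.e_mul_self γ₁)) (Subtype.ext (A.e_mul_self γ₂))

/-- Since x = x e(γ₁) and y = y e(γ₂), the class of n ⊗ (x ⊗ y) equals that of n (x ⊗ y) ⊗ (e(γ₁) ⊗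
e(γ₂)). -/
theorem pureGen_actTens (z : N.tens (P γ₁) (P γ₂)) : pureGen γ₁ γ₂ (actTens γ₁ γ₂ z) = z := by
  refine N.tens_hom_ext' (φ := ((pureGen γ₁ γ₂).restrictScalars F2).comp (actTens γ₁ γ₂))
    (ψ := LinearMap.id) (fun n x y => ?_) z
  refine (N.pure_smul (X := chiObj (P γ₁) (P γ₂)) n
    (x.1 ⊗ₜ[F2] y.1 : A.carrier ⊗[F2] A.carrier) _).symm.trans ?_
  refine congrArg (N.pure (X := chiObj (P γ₁) (P γ₂)) n) ?_
  exact congrArg₂ (fun (x : P γ₁) (y : P γ₂) => chiTmul x y)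
    (Subtype.ext (P_mul_e x)) (Subtype.ext (P_mul_e y))

theorem genP_mem (γ : Vtx) : genP γ ∈ (P γ).gr 0 := A.e_mem γ

theorem genP_mem_parityGr (γ : Vtx) : genP γ ∈ parityGr (P γ) (0, γ.parity) :=
  ⟨genP_mem γ, Subtype.ext (by
    refine (A.cent_mul_e γ.parity γ).trans ?_
    rw [if_pos rfl]
    rfl)⟩

/-- The morphism from the summand `N(γ₁, γ₂)` to the tensor product. -/
def summandHom : sub (gens γ₁ γ₂ : Set Gen) (gens_closed γ₁ γ₂) ⟶ N.tens (P γ₁) (P γ₂) where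
  f := (pureGen γ₁ γ₂).comp (subCarrier (gens γ₁ γ₂ : Set Gen)).subtype
  map_mem {p v} hv := by
    have h0 : chiTmul (genP γ₁) (genP γ₂) ∈ (chiObj (P γ₁) (P γ₂)).gr (twistDeg 0 (0, γ₂.parity)) :=
      chiGr_mem (genP_mem γ₁) (genP_mem_parityGr γ₂)
    have h1 := N.pure_mem (n := v.1) hv h0
    rwa [show twistDeg 0 (0, γ₂.parity) = 0 by simp [twistDeg], add_zero] at h1
  comm v := by
    refine ((N.d_pure (X := chiObj (P γ₁) (P γ₂)) v.1 _).trans ?_).symm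
    have h : (chiObj (P γ₁) (P γ₂)).d (chiTmul (genP γ₁) (genP γ₂)) = 0 := by
      refine (chiD_tmul _ _ _ _).trans ?_
      rw [show (P γ₁).d (genP γ₁) = 0 from rfl, show (P γ₂).d (genP γ₂) = 0 from rfl]
      rw [TensorProduct.zero_tmul, TensorProduct.tmul_zero, add_zero]
      rfl
    rw [h]
    have h2 : N.pure (X := chiObj (P γ₁) (P γ₂)) v.1 0 = 0 :=
      (congrArg (N.proj (chiObj (P γ₁) (P γ₂))) (TensorProduct.tmul_zero _ v.1)).trans (map_zero _)
    rw [h2, add_zero]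
    rfl

/-- The inverse sends n ⊗ (x ⊗ y) to n (x ⊗ y), cut down by the idempotent to the generators of
N(γ₁, γ₂). -/
theorem summandHom_bijective : Function.Bijective (summandHom γ₁ γ₂).f := by
  constructor
  · intro v w h
    have h1 : ∀ v : subCarrier (gens γ₁ γ₂ : Set Gen),
        actTens γ₁ γ₂ (pureGen γ₁ γ₂ v.1) = v.1 := fun v => by
      change (repN (idemTmul γ₁ γ₂)).unop v.1 = v.1
      refine Subtype.ext (funext fun g => ?_)
      rw [repN_idem_apply]
      split_ifs with hg
      · rfl
      · exact (v.2 g fun h => hg ((mem_gens γ₁ γ₂).1 h)).symm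
    exact Subtype.ext ((h1 v).symm.trans ((congrArg (actTens γ₁ γ₂) h).trans (h1 w)))
  · intro z
    refine ⟨⟨(repN (idemTmul γ₁ γ₂)).unop (actTens γ₁ γ₂ z), fun g hg => ?_⟩, ?_⟩
    · rw [repN_idem_apply, if_neg fun h => hg ((mem_gens γ₁ γ₂).2 h)]
    · exact (pureGen_idem γ₁ γ₂ _).trans (pureGen_actTens γ₁ γ₂ z)

/-- The tensor product of `P(γ₁)` and `P(γ₂)` is the summand `N(γ₁, γ₂)`. -/
def summandIso : sub (gens γ₁ γ₂ : Set Gen) (gens_closed γ₁ γ₂) ≅ N.tens (P γ₁) (P γ₂) :=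
  isoOfBijective (summandHom γ₁ γ₂) (summandHom_bijective γ₁ γ₂)

/-- The bimodule N categorifies the multiplication table of F, 1, EF, E. The only rule needed to
straighten products is FE = 1 - T - EF, besides E² = F² = 0 and the centrality of T: for instance
F·EF = F - TF and EF·E = E - TE match the pairs of generators with degree difference (-1, -1) and
(1, -1). -/
theorem sum_gens : ∑ g ∈ gens γ₁ γ₂, (U.wt g.deg : U) * U.ofVtx g.typ =
    U.ofVtx γ₁ * U.ofVtx γ₂ := by
  have h1 : (U.wt (-1, -1) : U) = -U.T := by
    rw [show ((-1, -1) : ℤ × ℤ) = (0, -1) + (1, 0) + (-2, 0) by simp,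
      U.wt_add_even _ _ (by decide), U.wt_add_one, U.wt_zero_neg_one]
  have h2 : (U.wt (1, -1) : U) = -U.T := by
    rw [show ((1, -1) : ℤ × ℤ) = (0, -1) + (1, 0) by simp, U.wt_add_one, U.wt_zero_neg_one]
  have hE : U.gen .E * U.gen .E = 0 := U.E_mul_E
  have hF : U.gen .F * U.gen .F = 0 := U.F_mul_F
  have hFE := U.F_mul_E
  have hFT := U.F_mul_T
  have hET := U.E_mul_T
  have hEE : ∀ x, U.gen .E * (U.gen .E * x) = 0 := fun x => by rw [← mul_assoc, hE, zero_mul]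
  have hFEx : ∀ x, U.gen .F * (U.gen .E * x) =
      x - U.T * x - U.gen .E * (U.gen .F * x) := fun x => by
    rw [← mul_assoc, hFE, sub_mul, sub_mul, one_mul, mul_assoc]
  have hETx : ∀ x, U.gen .E * (U.T * x) = U.T * (U.gen .E * x) := fun x => by
    rw [← mul_assoc, hET, mul_assoc]
  have key : ∀ S : Finset Gen, gens γ₁ γ₂ = S → ∑ g ∈ S, (U.wt g.deg : U) * U.ofVtx g.typ =
    U.ofVtx γ₁ * U.ofVtx γ₂ → ∑ g ∈ gens γ₁ γ₂, (U.wt g.deg : U) * U.ofVtx g.typ =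
    U.ofVtx γ₁ * U.ofVtx γ₂ := fun S hS h => hS ▸ h
  cases γ₁ <;> cases γ₂
  · exact key ∅ (by decide) (by simp [U.ofVtx, hF])
  · exact key {.F_I} (by decide) (by simp [U.ofVtx, Gen.deg, Gen.typ])
  · refine key {.F_EF, .F_EF'} (by decide) ?_
    simp [U.ofVtx, Gen.deg, Gen.typ, h1, hFEx, hF, sub_eq_add_neg]
  -- The three terms of N(F, E) contribute 1, -EF and -T, in this order.
  · refine key {.F_E₁, .F_E₂, .F_E₃} (by decide) ?_
    simp [U.ofVtx, Gen.deg, Gen.typ, h2, hFE, U.wt_one_zero]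
    abel
  · exact key {.I_F} (by decide) (by simp [U.ofVtx, Gen.deg, Gen.typ])
  · exact key {.I_I} (by decide) (by simp [U.ofVtx, Gen.deg, Gen.typ])
  · exact key {.I_EF} (by decide) (by simp [U.ofVtx, Gen.deg, Gen.typ])
  · exact key {.I_E} (by decide) (by simp [U.ofVtx, Gen.deg, Gen.typ])
  · exact key ∅ (by decide) (by simp [U.ofVtx, hF, mul_assoc])
  · exact key {.EF_I} (by decide) (by simp [U.ofVtx, Gen.deg, Gen.typ])
  · refine key {.EF_EF, .EF_EF'} (by decide) ?_
    simp [U.ofVtx, Gen.deg, Gen.typ, h1, hFEx, hF, mul_assoc, mul_add, hETx, sub_eq_add_neg]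
  · refine key {.EF_E, .EF_E'} (by decide) ?_
    simp [U.ofVtx, Gen.deg, Gen.typ, h2, hFE, mul_assoc, mul_add, hET, hEE, sub_eq_add_neg]
  · exact key {.E_F} (by decide) (by simp [U.ofVtx, Gen.deg, Gen.typ])
  · exact key {.E_I} (by decide) (by simp [U.ofVtx, Gen.deg, Gen.typ])
  · exact key ∅ (by decide) (by simp [U.ofVtx, hEE])
  · exact key ∅ (by decide) (by simp [U.ofVtx, hE])

theorem tens_P_P : Generated P (N.tens (P γ₁) (P γ₂)) ∧
    eulerClass (N.tens (P γ₁) (P γ₂)) = U.ofVtx γ₁ * U.ofVtx γ₂ := by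
  obtain ⟨h1, h2⟩ := sub_generated (gens γ₁ γ₂) (gens_closed γ₁ γ₂)
  exact ⟨Generated.iso (summandIso γ₁ γ₂) h1, by
    rw [← eulerClass_iso (summandIso γ₁ γ₂), h2, sum_gens]⟩

end ProjProj
end UTCat

end

noncomputable section

namespace UTCat

open DGMod

/-! ### Classes of tensor products -/

namespace DGFun

variable {R S : DGAlg} (Φ : DGFun S R)

/-- The action of a DG functor on morphisms. -/
def mapHom {M M' : DGMod S} (u : M ⟶ M') : Φ.obj M ⟶ Φ.obj M' where
  f := Φ.map u.f
  map_mem {p x} hx := by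
    have : HasDeg (Φ.map u.f) (0, 0) := Φ.map_deg fun {p x} hx => by
      change _ ∈ M'.gr (p + 0)
      rw [add_zero]
      exact u.map_mem hx
    have h := this hx
    change _ ∈ (Φ.obj M').gr (p + 0) at h
    rwa [add_zero] at h
  comm x := by
    have h := Φ.map_d (f := u.f) (f' := 0) (fun x => by
      rw [u.comm, DGMod.add_self]; rfl) x
    rw [Φ.map_zero] at h
    exact (eq_of_add h).trans (zero_add _)

theorem mapHom_comp_eq_id {M M' : DGMod S} (u : M ⟶ M') (v : M' ⟶ M) (h : u ≫ v = 𝟙 M) :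
    Φ.mapHom u ≫ Φ.mapHom v = 𝟙 (Φ.obj M) :=
  DGMod.Hom.ext <| (Φ.map_comp u.f v.f).symm.trans <|
    (congrArg (fun w : M ⟶ M => Φ.map w.f) h).trans (Φ.map_id M)

/-- The action of a DG functor on isomorphisms. -/
def mapIso {M M' : DGMod S} (e : M ≅ M') : Φ.obj M ≅ Φ.obj M' where
  hom := Φ.mapHom e.hom
  inv := Φ.mapHom e.inv
  hom_inv_id := Φ.mapHom_comp_eq_id _ _ e.hom_inv_id
  inv_hom_id := Φ.mapHom_comp_eq_id _ _ e.inv_hom_id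

/-- A DG functor preserves zero. -/
def zeroIso : DGMod.zero R ≅ Φ.obj (DGMod.zero S) :=
  isoOfBijective 0 ⟨fun _ _ _ => rfl, fun z => ⟨PUnit.unit, by
    have h : (LinearMap.id : DGMod.zero S →ₗ[S] DGMod.zero S) = 0 := rfl
    have h1 := Φ.map_id (DGMod.zero S)
    rw [h, Φ.map_zero] at h1
    exact LinearMap.congr_fun h1 z⟩⟩

/-- Dévissage over the construction of X. The hypothesis `ht` lets the functor replace a shift by
another one of the same weight, as happens in the left variable of the bifunctor. -/
theorem generated_and_eulerClass (Φ : DGFun A A) (g : U →+ U)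
    (hg : ∀ p a, g (U.wt p * a) = U.wt p * g a)
    (ht : ∀ M s, Generated P M → ∃ t, U.wt (-t) = U.wt (-s) ∧
      Nonempty (Φ.obj (M.twist s) ≅ (Φ.obj M).twist t))
    (hP : ∀ γ, Generated P (Φ.obj (P γ)) ∧ eulerClass (Φ.obj (P γ)) = g (U.ofVtx γ))
    {X : DGMod A} (hX : Generated P X) :
    Generated P (Φ.obj X) ∧ eulerClass (Φ.obj X) = g (eulerClass X) := by
  induction hX with
  | zero =>
    refine ⟨Generated.iso Φ.zeroIso Generated.zero, ?_⟩
    rw [← eulerClass_iso Φ.zeroIso, eulerClass_zero, g.map_zero]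
  | basic γ => rw [eulerClass_P]; exact hP γ
  | twist M s hM ih =>
    obtain ⟨t, h, ⟨e⟩⟩ := ht M s hM
    have h1 := finite_of_generated hM
    have h2 := finite_of_generated ih.1
    refine ⟨Generated.iso e.symm (Generated.twist _ t ih.1), ?_⟩
    rw [eulerClass_iso e, eulerClass_twist, eulerClass_twist, h, hg, ih.2]
  | @cone M M' u hM hM' ih ih' =>
    have h1 := finite_of_generated hM
    have h2 := finite_of_generated hM'
    have h3 := finite_of_generated ih.1
    have h4 := finite_of_generated ih'.1
    have e := Φ.coneIso u (Φ.mapHom u) rfl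
    refine ⟨Generated.iso e.symm (Generated.cone _ ih.1 ih'.1), ?_⟩
    rw [eulerClass_iso e, eulerClass_cone, eulerClass_cone, ih.2, ih'.2, map_sub]
  | iso e _ ih =>
    refine ⟨Generated.iso (Φ.mapIso e) ih.1, ?_⟩
    rw [← eulerClass_iso (Φ.mapIso e), ih.2, eulerClass_iso e]

end DGFun

/-- The parity idempotents are central, so they act on P(γ) = A e(γ) through their product with
e(γ). -/
theorem parity_of_mem_parityGr_P {γ : Vtx} {j : (ℤ × ℤ) × ℤ} {y : P γ}
    (hy : y ∈ parityGr (P γ) j) (h : y ≠ 0) : j.2 = γ.parity := by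
  by_contra hj
  refine h (Subtype.ext ?_)
  have h1 : A.cent j.2 * (y.1 : A.carrier) = y.1 := congrArg Subtype.val hy.2
  change (y.1 : A.carrier) = 0
  rw [← h1, A.cent_comm, ← P_mul_e y, mul_assoc, A.e_mul_cent, if_neg (Ne.symm hj), mul_zero]

/-- The right factor is reduced to some P(γ) first. A shift {b} of the left factor becomes a uniform
shift of the tensor product only when the right factor has a single parity, so the order of the two
dévissages matters. -/
theorem tens_generated_and_eulerClass {X Y : DGMod A} (hX : Generated P X) (hY : Generated P Y) :
    Generated P (N.tens X Y) ∧ eulerClass (N.tens X Y) = eulerClass X * eulerClass Y := by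
  refine (N.rightDGFun X).generated_and_eulerClass (AddMonoidHom.mulLeft (eulerClass X))
    (fun p a => ?_) (fun M s _ => ⟨s, rfl, ⟨N.tensTwistRight X M s⟩⟩) (fun γ => ?_) hY
  · change eulerClass X * (U.wt p * a) = U.wt p * (eulerClass X * a)
    rw [← mul_assoc, ← (U.commute_wt p _).eq, mul_assoc]
  · refine (N.leftDGFun (P γ)).generated_and_eulerClass (AddMonoidHom.mulRight (U.ofVtx γ))
      (fun p a => mul_assoc _ _ _) (fun M s _ => ?_) (fun γ' => tens_P_P γ' γ) hX
    -- The extra shift comes from the term 2 deg_t(x) p(y) of the grading; being even, it has weight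
    -- 1.
    refine ⟨s + (2 * s.2 * γ.parity, 0), ?_, ⟨N.tensTwistLeft M (P γ) s _ _ (fun j y hy h => by
      rw [parity_of_mem_parityGr_P hy h]) rfl⟩⟩
    rw [neg_add, show -((2 * s.2 * γ.parity, 0) : ℤ × ℤ) = (2 * (-(s.2 * γ.parity)), 0) by
      ext <;> simp; ring, U.wt_add_even _ _ (even_two_mul _)]

theorem tens_generated (X Y : DGMod A) (hX : Generated P X) (hY : Generated P Y) :
    Generated P (N.tens X Y) := (tens_generated_and_eulerClass hX hY).1
end UTCat

end

noncomputable section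

namespace UTCat

open DGMod

/-! ### Grothendieck groups -/

namespace K0

section General

open scoped ZeroObject

variable {C : Type 1} [Category.{0} C] [HasZeroObject C] [HasShift C ℤ] [Preadditive C]
  [∀ n : ℤ, (shiftFunctor C n).Additive] [Pretriangulated C]

theorem mk_triangle {Δ : Triangle C} (h : Δ ∈ distTriang C) :
    mk Δ.obj₂ = mk Δ.obj₁ + mk Δ.obj₃ := by
  have : (QuotientAddGroup.mk (FreeAbelianGroup.of Δ.obj₂ -
      (FreeAbelianGroup.of Δ.obj₁ + FreeAbelianGroup.of Δ.obj₃)) : K0 C) = 0 :=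
    (QuotientAddGroup.eq_zero_iff _).2 (AddSubgroup.subset_closure ⟨Δ, h, rfl⟩)
  exact sub_eq_zero.1 this

/-- The map out of the Grothendieck group defined by a function additive on distinguished
triangles. -/
def lift {G : Type*} [AddCommGroup G] (f : C → G)
    (hf : ∀ Δ ∈ distTriang C, f Δ.obj₂ = f Δ.obj₁ + f Δ.obj₃) : K0 C →+ G :=
  QuotientAddGroup.lift _ (FreeAbelianGroup.lift f) (by
    rw [AddSubgroup.closure_le]
    rintro _ ⟨Δ, h, rfl⟩
    change FreeAbelianGroup.lift f _ = 0
    rw [map_sub, map_add]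
    simp only [FreeAbelianGroup.lift_apply_of]
    rw [hf Δ h, sub_self])

@[simp]
theorem lift_mk {G : Type*} [AddCommGroup G] (f : C → G)
    (hf : ∀ Δ ∈ distTriang C, f Δ.obj₂ = f Δ.obj₁ + f Δ.obj₃) (X : C) :
    lift f hf (mk X) = f X := FreeAbelianGroup.lift_apply_of _ _

theorem mem_of_mk_mem {S : AddSubgroup (K0 C)} (h : ∀ X : C, mk X ∈ S) (x : K0 C) : x ∈ S := by
  obtain ⟨x, rfl⟩ := QuotientAddGroup.mk_surjective x
  induction x using FreeAbelianGroup.induction_on with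
  | zero => exact S.zero_mem
  | of X => exact h X
  | neg X hX => exact S.neg_mem hX
  | add x y hx hy => exact S.add_mem hx hy

theorem hom_ext {G : Type*} [AddCommGroup G] {f g : K0 C →+ G} (h : ∀ X, f (mk X) = g (mk X)) :
    f = g :=
  AddMonoidHom.ext fun x => mem_of_mk_mem (S := AddMonoidHom.eqLocus f g) h x

theorem mk_zero {Z : C} (hZ : IsZero Z) : mk Z = 0 := by
  -- With Z itself as the third vertex of the contractible triangle, the relation reads [Z] = [Z] +
  -- [Z].
  have h := mk_triangle (isomorphic_distinguished _ (contractible_distinguished Z)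
    (Triangle.mk (𝟙 Z) (0 : Z ⟶ Z) 0) (Triangle.isoMk _ _ (Iso.refl _) (Iso.refl _)
      (hZ.iso (isZero_zero C))
      (hZ.eq_of_src _ _) (hZ.eq_of_src _ _) (hZ.eq_of_src _ _)))
  exact left_eq_add.1 h

/-- An isomorphism fits into a distinguished triangle X ⟶ Y ⟶ 0. -/
theorem mk_iso {X Y : C} (e : X ≅ Y) : mk X = mk Y := by
  have h := mk_triangle (isomorphic_distinguished _ (contractible_distinguished X)
    (Triangle.mk e.hom (0 : Y ⟶ 0) 0) (Triangle.isoMk _ _ (Iso.refl _) e.symm (Iso.refl _)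
      (e.hom_inv_id.trans (Category.id_comp _).symm) ((isZero_zero C).eq_of_tgt _ _)
      ((isZero_zero C).eq_of_src _ _)))
  rw [show mk Y = mk X + mk (0 : C) from h, mk_zero (isZero_zero C), add_zero]

variable {D : Type 1} [Category.{0} D] [HasZeroObject D] [HasShift D ℤ] [Preadditive D]
  [∀ n : ℤ, (shiftFunctor D n).Additive] [Pretriangulated D]

theorem mk_map_triangle (F : C ⥤ D) [F.CommShift ℤ] [F.IsTriangulated] {Δ : Triangle C}
    (h : Δ ∈ distTriang C) :
    mk (F.obj Δ.obj₂) = mk (F.obj Δ.obj₁) + mk (F.obj Δ.obj₃) :=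
  mk_triangle (F.map_distinguished Δ h)

/-- The biadditive map on Grothendieck groups induced by a bifunctor exact in each variable. -/
def map₂ (F : C ⥤ C ⥤ C) [F.CommShift₂Int] (h : ∀ X, (F.obj X).IsTriangulated)
    (h' : ∀ Y, (F.flip.obj Y).IsTriangulated) : K0 C →+ K0 C →+ K0 C :=
  lift (fun X => lift (fun Y => mk ((F.obj X).obj Y)) fun _ hΔ => mk_map_triangle (F.obj X) hΔ)
    fun _ hΔ => hom_ext fun Y => by
      simp only [lift_mk, AddMonoidHom.add_apply]
      exact mk_map_triangle (F.flip.obj Y) hΔ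

@[simp]
theorem map₂_mk (F : C ⥤ C ⥤ C) [F.CommShift₂Int] (h : ∀ X, (F.obj X).IsTriangulated)
    (h' : ∀ Y, (F.flip.obj Y).IsTriangulated) (X Y : C) :
    map₂ F h h' (mk X) (mk Y) = mk ((F.obj X).obj Y) := by
  simp [map₂]

end General

end K0

/-- The object of `HP(A)` defined by a DG module. -/
abbrev HP.ofGenerated {M : DGMod A} (h : Generated P M) : HP := ⟨⟨M⟩, h⟩

namespace K0

theorem mk_ofGenerated_iso {M M' : DGMod A} (e : M ≅ M') (h : Generated P M)
    (h' : Generated P M') : mk (HP.ofGenerated h) = mk (HP.ofGenerated h') :=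
  mk_iso ((generatedK P).isoMk ((toK A).mapIso e))

theorem mk_ofGenerated_zero : mk (HP.ofGenerated Generated.zero) = 0 :=
  mk_zero <| (IsZero.iff_id_eq_zero _).2 <| (generatedK P).ι.map_injective <|
    congrArg (toK A).map (DGMod.hom_ext (M := DGMod.zero A) (N := DGMod.zero A) fun _ => rfl)

/-- Distinguished triangles of HP(A) are detected in the homotopy category of all DG modules, where
the third vertex on u is isomorphic to the cone of u. -/
theorem mk_ofGenerated_cone {M M' : DGMod A} (u : M ⟶ M') (h : Generated P M)
    (h' : Generated P M') : mk (HP.ofGenerated (Generated.cone u h h')) =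
      mk (HP.ofGenerated h') - mk (HP.ofGenerated h) := by
  let u' : HP.ofGenerated h ⟶ HP.ofGenerated h' := ObjectProperty.homMk ((toK A).map u)
  obtain ⟨Z, g, k, hΔ⟩ := distinguished_cocone_triangle u'
  have h1 := HP.incl.map_distinguished _ hΔ
  have e : HP.incl.mapTriangle.obj (Triangle.mk u' g k) ≅ coneTriK u :=
    isoTriangleOfIso₁₂ _ _ h1 (mem_distTriang_iff.2 ⟨_, _, u, ⟨Iso.refl _⟩⟩)
      (Iso.refl _) (Iso.refl _) ((Category.comp_id _).trans (Category.id_comp _).symm)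
  have h2 : mk Z = mk (HP.ofGenerated (Generated.cone u h h')) :=
    mk_iso ((generatedK P).isoMk (Triangle.π₃.mapIso e))
  have h3 : mk (HP.ofGenerated h') = mk (HP.ofGenerated h) + mk Z := mk_triangle hΔ
  rw [← h2, h3, add_sub_cancel_left]

/-- The shift M[1] is the cone of M ⟶ 0. -/
theorem mk_ofGenerated_twist_one {M : DGMod A} (h : Generated P M) :
    mk (HP.ofGenerated (h.twist _ (1, 0))) = -mk (HP.ofGenerated h) := by
  have e : cone (0 : M ⟶ DGMod.zero A) ≅ M.twist (1, 0) :=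
    mkIso (M := cone (0 : M ⟶ DGMod.zero A)) (N := M.twist (1, 0))
      (LinearMap.fst A M (DGMod.zero A)) (LinearMap.inl A M (DGMod.zero A))
      (fun {p x} hx => by rw [add_zero]; exact hx.1)
      (fun {p x} hx => by rw [add_zero]; exact ⟨hx, Submodule.zero_mem _⟩)
      (fun _ => rfl) (fun _ => rfl) (fun _ => rfl)
  rw [← mk_ofGenerated_iso e (Generated.cone _ h Generated.zero),
    mk_ofGenerated_cone _ h Generated.zero,
    mk_ofGenerated_zero, zero_sub]

/-- Membership in a subgroup is insensitive to the sign (-1)^n by which [n] acts, so the sign need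
not be recorded. -/
theorem mk_ofGenerated_twist_int {M : DGMod A} (h : Generated P M) (n : ℤ)
    {S : AddSubgroup (K0 HP)} (hS : mk (HP.ofGenerated h) ∈ S) :
    mk (HP.ofGenerated (h.twist _ (n, 0))) ∈ S := by
  induction n with
  | zero =>
    rwa [mk_ofGenerated_iso (M.twistZero _ rfl) _ h]
  | succ n ih =>
    rw [mk_ofGenerated_iso (M.twistAdd ((n : ℤ) + 1, 0) (n, 0) (1, 0) rfl) _
      ((h.twist _ (n, 0)).twist _ (1, 0)), mk_ofGenerated_twist_one (h.twist _ (n, 0))]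
    exact S.neg_mem ih
  | pred n ih =>
    rw [mk_ofGenerated_iso (M.twistAdd (-(n : ℤ), 0) (-(n : ℤ) - 1, 0) (1, 0) (by simp)) _
      ((h.twist _ (-(n : ℤ) - 1, 0)).twist _ (1, 0)),
      mk_ofGenerated_twist_one (h.twist _ (-(n : ℤ) - 1, 0))] at ih
    exact neg_mem_iff.1 ih

/-- K_0 is generated by the classes of the P(γ){b}. The statement covers all shifts of M at once, so
that the induction passes through the shift constructor. -/
theorem mk_ofGenerated_mem {S : AddSubgroup (K0 HP)}
    (hS : ∀ γ b, mk (HP.ofGenerated ((Generated.basic (P := P) γ).twist _ (0, b))) ∈ S)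
    {M : DGMod A} (h : Generated P M) (s : ℤ × ℤ) : mk (HP.ofGenerated (h.twist _ s)) ∈ S := by
  induction h generalizing s with
  | zero =>
    have e : (DGMod.zero A).twist s ≅ DGMod.zero A :=
      mkIso (M := (DGMod.zero A).twist s) (N := DGMod.zero A) LinearMap.id LinearMap.id
        (fun h => h) (fun h => h) (fun _ => rfl) (fun _ => rfl) (fun _ => rfl)
    rw [mk_ofGenerated_iso e _ Generated.zero, mk_ofGenerated_zero]
    exact S.zero_mem
  | basic γ =>
    rw [mk_ofGenerated_iso ((P γ).twistAdd s (0, s.2) (s.1, 0) (by simp)) _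
      (((Generated.basic γ).twist _ (0, s.2)).twist _ (s.1, 0))]
    exact mk_ofGenerated_twist_int _ _ (hS γ s.2)
  | twist M t h ih =>
    rw [← mk_ofGenerated_iso (M.twistAdd (t + s) t s rfl) (h.twist _ (t + s))]
    exact ih _
  | @cone M M' u h h' ih ih' =>
    have hM : Generated P ((twistFunctor s).obj M) := h.twist _ s
    have hM' : Generated P ((twistFunctor s).obj M') := h'.twist _ s
    have h1 := mk_ofGenerated_iso (coneTwistIso u s) ((Generated.cone u h h').twist _ s)
      (Generated.cone _ hM hM')
    exact h1 ▸ mk_ofGenerated_cone _ hM hM' ▸ S.sub_mem (ih' s) (ih s)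
  | @iso M M' e h ih =>
    have hM : Generated P ((twistFunctor s).obj M) := h.twist _ s
    have hM' : Generated P ((twistFunctor s).obj M') := (h.iso e).twist _ s
    exact mk_ofGenerated_iso ((twistFunctor s).mapIso e) hM hM' ▸ ih s

end K0
end UTCat

end

noncomputable section

namespace UTCat

open DGMod

/-! ### The isomorphism with `U_T` -/

namespace K0

/-- The class of an object, as a map out of the Grothendieck group. -/
def eulerHom : K0 HP →+ U := lift (fun X => eulerClass X.obj.as) fun _ h => eulerClass_triangle h

@[simp]
theorem eulerHom_mk (X : HP) : eulerHom (mk X) = eulerClass X.obj.as := lift_mk _ _ X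

end K0

namespace U

open LaurentPolynomial

/-- The values of the matrix representation on the generators. -/
def repGen : UGen → Matrix (Fin 2) (Fin 2) ℤ[T;T⁻¹]
  -- With these matrices EF and FE are 1 - T times the two diagonal matrix units, so that EF + FE =
  -- 1 - T.
  | .E => !![0, 1; 0, 0]
  | .F => !![0, 0; 1 - LaurentPolynomial.T 1, 0]
  | .T => Matrix.scalar (Fin 2) (LaurentPolynomial.T 1)
  | .Tinv => Matrix.scalar (Fin 2) (LaurentPolynomial.T (-1))

/-- A faithful representation of `U_T` by matrices over the ring of Laurent polynomials. -/
def rep : U →+* Matrix (Fin 2) (Fin 2) ℤ[T;T⁻¹] :=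
  (RingQuot.lift (r := URel) ⟨(FreeAlgebra.lift ℤ repGen : _ →+* _), by
    intro x y h
    have hs : ∀ f : ℤ[T;T⁻¹], Matrix.scalar (Fin 2) f = !![f, 0; 0, f] := fun f => by
      ext i j
      fin_cases i <;> fin_cases j <;> rfl
    have h1 : (LaurentPolynomial.T 1 * LaurentPolynomial.T (-1) : ℤ[T;T⁻¹]) = 1 := by
      rw [← LaurentPolynomial.T_add, add_neg_cancel, LaurentPolynomial.T_zero]
    have h2 : (LaurentPolynomial.T (-1) * LaurentPolynomial.T 1 : ℤ[T;T⁻¹]) = 1 := by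
      rw [← LaurentPolynomial.T_add, neg_add_cancel, LaurentPolynomial.T_zero]
    cases h <;> simp only [RingHom.coe_coe, map_mul, map_add, map_sub, map_one, map_zero,
      FreeAlgebra.lift_ι_apply, repGen, hs, Matrix.mul_fin_two, Matrix.one_fin_two] <;>
      ext i j <;> fin_cases i <;> fin_cases j <;> simp [h1, h2]⟩).comp
    (equiv : U →+* UT)

theorem rep_gen (x : UGen) : rep (gen x) = repGen x :=
  (RingQuot.lift_mkRingHom_apply _ _ _).trans (FreeAlgebra.lift_ι_apply _ _)

theorem rep_unitT_zpow (b : ℤ) :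
    rep ((unitT ^ b : Uˣ) : U) = Matrix.scalar (Fin 2) (LaurentPolynomial.T b) := by
  induction b with
  | zero => simp
  | succ n ih =>
    rw [zpow_add_one, Units.val_mul, map_mul, ih, LaurentPolynomial.T_add, map_mul]
    exact congrArg _ (rep_gen .T)
  | pred n ih =>
    rw [zpow_sub_one, Units.val_mul, map_mul, ih, sub_eq_add_neg, LaurentPolynomial.T_add, map_mul]
    exact congrArg _ (rep_gen .Tinv)

theorem wt_zero_left (b : ℤ) : wt (0, -b) = unitT ^ b := by simp [wt]

end U

namespace K0

open LaurentPolynomial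

/-- The classes of the modules `P(γ){b}`. -/
def projClass (γ : Vtx) (b : ℤ) : K0 HP :=
  mk (HP.ofGenerated ((Generated.basic (P := P) γ).twist _ (0, b)))

/-- The additive map sending `T ^ b` to the class of `P(γ){b}`. -/
def ofLaurent (γ : Vtx) : ℤ[T;T⁻¹] →+ K0 HP :=
  (Finsupp.liftAddHom fun b => zmultiplesHom _ (projClass γ b)).comp
    AddMonoidAlgebra.coeffAddEquiv.toAddMonoidHom

theorem ofLaurent_T (γ : Vtx) (b : ℤ) : ofLaurent γ (LaurentPolynomial.T b) = projClass γ b := by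
  change Finsupp.liftAddHom _ (Finsupp.single b (1 : ℤ)) = _
  simp

theorem eulerHom_projClass (γ : Vtx) (b : ℤ) :
    eulerHom (projClass γ b) = (U.unitT ^ b : Uˣ) * U.ofVtx γ := by
  rw [projClass, eulerHom_mk, eulerClass_twist, eulerClass_P,
    show -((0, b) : ℤ × ℤ) = (0, -b) by simp, U.wt_zero_left]

theorem rep_eulerHom_ofLaurent (γ : Vtx) (f : ℤ[T;T⁻¹]) :
    U.rep (eulerHom (ofLaurent γ f)) = Matrix.scalar (Fin 2) f * U.rep (U.ofVtx γ) := by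
  induction f using LaurentPolynomial.induction_on' with
  | add p q hp hq => rw [map_add, map_add, map_add, hp, hq, map_add, add_mul]
  | C_mul_T n a =>
    rw [show (LaurentPolynomial.C a * LaurentPolynomial.T n : ℤ[T;T⁻¹]) =
      a • LaurentPolynomial.T n from (LaurentPolynomial.smul_eq_C_mul a _).symm, map_zsmul,
      map_zsmul, map_zsmul, map_zsmul, ofLaurent_T, eulerHom_projClass, map_mul, U.rep_unitT_zpow,
      smul_mul_assoc]

/-- The sums on the right form a subgroup containing the classes of all P(γ){b}, and these generate.
-/
theorem exists_eq_sum_ofLaurent (x : K0 HP) :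
    ∃ f : Vtx → ℤ[T;T⁻¹], x = ∑ γ, ofLaurent γ (f γ) := by
  let Ψ : (Vtx → ℤ[T;T⁻¹]) →+ K0 HP :=
    ∑ γ, (ofLaurent γ).comp (Pi.evalAddMonoidHom (fun _ : Vtx => ℤ[T;T⁻¹]) γ)
  have hΨ : ∀ f, Ψ f = ∑ γ, ofLaurent γ (f γ) := fun f => by
    simp [Ψ, AddMonoidHom.finsetSum_apply]
  suffices h : x ∈ Ψ.range by
    obtain ⟨f, rfl⟩ := h
    exact ⟨f, hΨ f⟩
  refine mem_of_mk_mem (fun X => ?_) x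
  have h1 := mk_ofGenerated_mem (S := Ψ.range) (fun γ b => ⟨Pi.single γ (LaurentPolynomial.T b), by
    rw [hΨ, Finset.sum_eq_single γ, Pi.single_eq_same, ofLaurent_T]
    · rfl
    · intro γ' _ h
      rw [Pi.single_eq_of_ne h, map_zero]
    · simp⟩) X.property 0
  rwa [mk_ofGenerated_iso (X.obj.as.twistZero 0 rfl) _ X.property] at h1

/-- The images of F, 1, EF and E under `U.rep` are independent over the Laurent polynomials because
1 - T is nonzero in a domain; so the coefficients of any class in the kernel vanish. -/
theorem eulerHom_injective : Function.Injective eulerHom := by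
  rw [injective_iff_map_eq_zero]
  intro x hx
  obtain ⟨f, rfl⟩ := exists_eq_sum_ofLaurent x
  have h := congrArg U.rep hx
  rw [map_zero, map_sum, map_sum, Finset.sum_congr rfl fun γ _ => rep_eulerHom_ofLaurent γ (f γ),
    Vtx.sum_univ] at h
  have hT : (1 - LaurentPolynomial.T 1 : ℤ[T;T⁻¹]) ≠ 0 := by
    intro h0
    have := congrArg (fun p : ℤ[T;T⁻¹] => p.coeff 0) h0
    rw [← LaurentPolynomial.T_zero] at this
    simp [-LaurentPolynomial.T_zero] at this
  have hE : U.rep (U.gen .E) = !![0, 1; 0, 0] := U.rep_gen .E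
  have hF : U.rep (U.gen .F) = !![0, 0; 1 - LaurentPolynomial.T 1, 0] := U.rep_gen .F
  simp only [U.ofVtx, map_mul, map_one, hE, hF] at h
  -- The entries are f_E at (0, 1), f_I at (1, 1), (1 - T) f_F at (1, 0), and f_I + (1 - T) f_EF at
  -- (0, 0); the last one is used after f_I = 0.
  have h01 := congrFun (congrFun h 0) 1
  have h11 := congrFun (congrFun h 1) 1
  have h10 := congrFun (congrFun h 1) 0
  have h00 := congrFun (congrFun h 0) 0
  simp [Matrix.mul_apply, Fin.sum_univ_two, hT] at h01 h11 h10
  simp [Matrix.mul_apply, Fin.sum_univ_two, hT, h11] at h00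
  refine Finset.sum_eq_zero fun γ _ => ?_
  have : f γ = 0 := by cases γ <;> assumption
  rw [this, map_zero]

/-- The product on the Grothendieck group. -/
def tensorMul : K0 HP →+ K0 HP →+ K0 HP :=
  map₂ (N.hpBifunctor tens_generated) (N.hpBifunctor_isTriangulated tens_generated)
    (N.hpBifunctor_flip_isTriangulated tens_generated)

theorem tensorMul_mk (X Y : HP) :
    tensorMul (mk X) (mk Y) = mk (((N.hpBifunctor tens_generated).obj X).obj Y) :=
  map₂_mk _ _ _ X Y

/-- Both sides are biadditive, so it suffices to compare them on classes of objects. -/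
theorem eulerHom_tensorMul (x y : K0 HP) : eulerHom (tensorMul x y) = eulerHom x * eulerHom y := by
  have h : (AddMonoidHom.compHom eulerHom).comp tensorMul =
      (AddMonoidHom.mul.compl₂ eulerHom).comp eulerHom := hom_ext fun X => hom_ext fun Y => by
    change eulerHom (tensorMul (mk X) (mk Y)) = eulerHom (mk X) * eulerHom (mk Y)
    rw [tensorMul_mk, eulerHom_mk, eulerHom_mk, eulerHom_mk]
    exact (tens_generated_and_eulerClass X.property Y.property).2
  exact DFunLike.congr_fun (DFunLike.congr_fun h x) y

/-- Multiplicativity makes the image a subring; it contains E and F, and T and T^(-1) as the classes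
of P(I){1} and P(I){-1}. No spanning set of U_T is needed. -/
theorem eulerHom_surjective : Function.Surjective eulerHom := by
  let S : Subring U :=
    { eulerHom.range with
      one_mem' := ⟨mk (HP.proj .I), by rw [eulerHom_mk]; exact eulerClass_P .I⟩
      mul_mem' := by
        rintro _ _ ⟨x, rfl⟩ ⟨y, rfl⟩
        exact ⟨tensorMul x y, eulerHom_tensorMul x y⟩ }
  refine fun a => U.mem_subring S (fun x => ?_) a
  have hT : ∀ b : ℤ, ((U.unitT ^ b : Uˣ) : U) ∈ S := fun b =>
    ⟨projClass .I b, (eulerHom_projClass .I b).trans (mul_one _)⟩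
  cases x
  · exact ⟨mk (HP.proj .E), by rw [eulerHom_mk]; exact eulerClass_P .E⟩
  · exact ⟨mk (HP.proj .F), by rw [eulerHom_mk]; exact eulerClass_P .F⟩
  · have h := hT 1
    rw [zpow_one] at h
    exact h
  · have h := hT (-1)
    rw [zpow_neg_one] at h
    exact h

/-- The isomorphism of the Grothendieck group with `U_T`. -/
def equivUT : K0 HP ≃+ UT :=
  (AddEquiv.ofBijective eulerHom ⟨eulerHom_injective, eulerHom_surjective⟩).trans U.equiv.toAddEquiv

theorem equivUT_apply (x : K0 HP) : equivUT x = U.equiv (eulerHom x) := rfl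

theorem equivUT_proj (γ : Vtx) : equivUT (mk (HP.proj γ)) = UT.ofVtx γ := by
  rw [equivUT_apply, eulerHom_mk, ← U.equiv_ofVtx]
  exact congrArg U.equiv (eulerClass_P γ)

theorem equivUT_tShift (X : HP) : equivUT (mk (HP.tShift X)) = UT.T * equivUT (mk X) := by
  have h1 := finite_of_generated X.property
  have h : eulerClass (X.obj.as.twist (0, 1)) = U.T * eulerClass X.obj.as := by
    rw [eulerClass_twist, show -((0, 1) : ℤ × ℤ) = (0, -1) by simp, U.wt_zero_neg_one]
  rw [equivUT_apply, equivUT_apply, eulerHom_mk, eulerHom_mk]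
  exact (congrArg U.equiv h).trans (map_mul U.equiv _ _)

theorem equivUT_tensorMul (x y : K0 HP) :
    equivUT (tensorMul x y) = equivUT x * equivUT y := by
  rw [equivUT_apply, eulerHom_tensorMul]
  exact map_mul U.equiv _ _

end K0
end UTCat

end

/-! ### The main theorem -/

theorem theorem1p1 :
    ∃ (_ : Pretriangulated UTCat.HP),
      (∀ Δ : Triangle UTCat.HP, Δ ∈ distTriang UTCat.HP ↔
        ∃ (X Y : UTCat.DGMod UTCat.A) (u : X ⟶ Y), Nonempty
          (UTCat.HP.incl.mapTriangle.obj Δ ≅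
            (UTCat.toK UTCat.A).mapTriangle.obj (UTCat.DGMod.coneTriangle u))) ∧
      IsTriangulated UTCat.HP ∧
      ∃ (M : UTCat.HP ⥤ UTCat.HP ⥤ UTCat.HP) (_ : M.CommShift₂Int),
        (∀ X, (M.obj X).IsTriangulated) ∧ (∀ Y, (M.flip.obj Y).IsTriangulated) ∧
        Nonempty (UTCat.HP.Q.prod UTCat.HP.Q ⋙ Functor.uncurry.obj M ⋙ UTCat.HP.incl ≅
          UTCat.dgp.ι.prod UTCat.dgp.ι ⋙ UTCat.MDG ⋙ UTCat.toK UTCat.A) ∧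
        ∃ φ : UTCat.K0 UTCat.HP ≃+ UTCat.UT,
          (∀ γ, φ (UTCat.K0.mk (UTCat.HP.proj γ)) = UTCat.UT.ofVtx γ) ∧
          (∀ X : UTCat.HP, φ (UTCat.K0.mk (UTCat.HP.tShift X)) = UTCat.UT.T * φ (UTCat.K0.mk X)) ∧
          ∃ μ : UTCat.K0 UTCat.HP →+ UTCat.K0 UTCat.HP →+ UTCat.K0 UTCat.HP,
            (∀ X Y, μ (UTCat.K0.mk X) (UTCat.K0.mk Y) = UTCat.K0.mk ((M.obj X).obj Y)) ∧
            ∀ x y, φ (μ x y) = φ x * φ y :=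
  ⟨inferInstance, UTCat.mem_distTriang_hp_iff UTCat.P, inferInstance,
    UTCat.N.hpBifunctor UTCat.tens_generated, inferInstance,
    UTCat.N.hpBifunctor_isTriangulated UTCat.tens_generated,
    UTCat.N.hpBifunctor_flip_isTriangulated UTCat.tens_generated,
    ⟨UTCat.hpBifunctorIso UTCat.tens_generated⟩, UTCat.K0.equivUT, UTCat.K0.equivUT_proj,
    UTCat.K0.equivUT_tShift, UTCat.K0.tensorMul, UTCat.K0.tensorMul_mk,
    UTCat.K0.equivUT_tensorMul⟩
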